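/- All graphs are finite, undirected and simple. First-order formulas on graphs are built from the atoms $x=y$ and $x\sim y$ (adjacency) with $\neg,\wedge,\vee,\rightarrow,\leftrightarrow,\forall,\exists$. Let $\Sigma_0=\Pi_0$ be the class of quantifier-free formulas, and for $s\ge 1$ let $\Sigma_s$ be the class of formulas $\exists x_1\cdots\exists x_t\,\psi$ with $t\ge 0$ and $\psi\in\Pi_{s-1}$, and $\Pi_s$ the class of formulas $\forall x_1\cdots\forall x_t\,\psi$ with $t\ge 0$ and $\psi\in\Sigma_{s-1}$. The length $|\varphi|$ of a formula is its number of symbols. For a sentence $\varphi$ (a formula without free variables), the problem Vertex-Removal to $\varphi$, parameterized by $k$, asks, given a graph $G$ and $k\in\mathbb{N}$, whether there is $S\subseteq V(G)$ with $|S|\le k$ and $G-S\models\varphi$. **Theorem 1.** (i) For every sentence $\varphi\in\Sigma_3$, Vertex-Removal to $\varphi$ is fixed-parameter tractable: one algorithm decides it in time $f(k)\cdot|x|^{c}$ on instances $(x,k)$, where $f$ is computable and $c$ is a constant. More precisely, there is an absolute constant $C$ such that for every sentence $\varphi\in\Sigma_3$ some algorithm decides Vertex-Removal to $\varphi$ on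 all graphs with $n$ vertices (in the standard encoding) and all $k$ in time at most $|\varphi|^{k}\cdot(n+2)^{C|\varphi|}$. (ii) There is a sentence $\varphi\in\Pi_3$ such that Vertex-Removal to $\varphi$ is $\mathsf{W}[2]$-hard, that is, every problem in $\mathsf{W}[2]$ has a parameterized reduction to it. Here $\mathsf{W}[2]$ is the class of parameterized problems that have a parameterized reduction to the following problem for some $\Pi_2$-sentence $\theta(X)$ over a finite relational vocabulary with an additional relation variable $X$: given a finite structure $A$ and the parameter $k$, is there a relation $S$ with exactly $k$ tuples such that $A\models\theta(S)$? -/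

import Mathlib

/-! ### Data, programs and running time

Instances are binary trees (S-expressions), which play the role of strings. Algorithms are
programs of a small Turing-complete language of tree manipulations. Every elementary step is
charged the full size of the tree that it is applied to, so running times agree with those of
Turing machines up to a polynomial. -/

/-- Binary trees without labels. -/
inductive BinTree : Type
  | nil : BinTree
  | node : BinTree → BinTree → BinTree
  deriving DecidableEq

namespace BinTree

/-- The number of nodes and leaves of a tree; it is always positive. -/
def size : BinTree → ℕ
  | nil => 1
  | node a b => a.size + b.size + 1

/-- A tree read as a list: `node a b` is the list with head `a` and tail `b`. -/
def toList : BinTree → List BinTree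
  | nil => []
  | node a b => a :: b.toList

/-- The tree that codes a list of trees. -/
def ofList : List BinTree → BinTree
  | [] => nil
  | a :: l => node a (ofList l)

/-- The number `k` in unary, as a list of `k` empty trees. -/
def ofNat : ℕ → BinTree
  | 0 => nil
  | k + 1 => node nil (ofNat k)

/-- Left subtree (`nil` for `nil`). -/
def left : BinTree → BinTree
  | nil => nil
  | node a _ => a

/-- Right subtree (`nil` for `nil`). -/
def right : BinTree → BinTree
  | nil => nil
  | node _ b => b

end BinTree

/-- Programs. Each program computes a partial function from trees to trees; `nil` is read as
"false" and every other tree as "true". -/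
inductive Prog : Type
  /-- return the input -/
  | ident : Prog
  /-- return `nil` -/
  | empty : Prog
  /-- return the left subtree of the input -/
  | left : Prog
  /-- return the right subtree of the input -/
  | right : Prog
  /-- compare the two subtrees of the input -/
  | same : Prog
  /-- run both programs on the input and pair the results -/
  | pair : Prog → Prog → Prog
  /-- run the first program and then the second one on its result -/
  | seq : Prog → Prog → Prog
  /-- if the first program answers "true" run the second one, otherwise the third one -/
  | branch : Prog → Prog → Prog → Prog
  /-- while the first program answers "true" on the current tree, replace that tree by the
  result of the second program -/
  | loop : Prog → Prog → Prog

/-- `Run p x y T`: the program `p`, started on `x`, halts with result `y` after time `T`. -/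
inductive Run : Prog → BinTree → BinTree → ℕ → Prop
  | ident (x : BinTree) : Run Prog.ident x x x.size
  | empty (x : BinTree) : Run Prog.empty x BinTree.nil x.size
  | left (x : BinTree) : Run Prog.left x x.left x.size
  | right (x : BinTree) : Run Prog.right x x.right x.size
  | same_pos (x : BinTree) (h : x.left = x.right) :
      Run Prog.same x (BinTree.node BinTree.nil BinTree.nil) (x.size + 2)
  | same_neg (x : BinTree) (h : x.left ≠ x.right) :
      Run Prog.same x BinTree.nil (x.size + 2)
  | pair {p q : Prog} {x y z : BinTree} {T₁ T₂ : ℕ} :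
      Run p x y T₁ → Run q x z T₂ → Run (Prog.pair p q) x (BinTree.node y z) (T₁ + T₂ + 1)
  | seq {p q : Prog} {x y z : BinTree} {T₁ T₂ : ℕ} :
      Run p x y T₁ → Run q y z T₂ → Run (Prog.seq p q) x z (T₁ + T₂ + 1)
  | branch_pos {c p q : Prog} {x b y : BinTree} {T₁ T₂ : ℕ} :
      Run c x b T₁ → b ≠ BinTree.nil → Run p x y T₂ →
      Run (Prog.branch c p q) x y (T₁ + T₂ + 1)
  | branch_neg {c p q : Prog} {x y : BinTree} {T₁ T₂ : ℕ} :
      Run c x BinTree.nil T₁ → Run q x y T₂ → Run (Prog.branch c p q) x y (T₁ + T₂ + 1)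
  | loop_stop {c p : Prog} {x : BinTree} {T : ℕ} :
      Run c x BinTree.nil T → Run (Prog.loop c p) x x (T + 1)
  | loop_step {c p : Prog} {x b y z : BinTree} {T₁ T₂ T₃ : ℕ} :
      Run c x b T₁ → b ≠ BinTree.nil → Run p x y T₂ → Run (Prog.loop c p) y z T₃ →
      Run (Prog.loop c p) x z (T₁ + T₂ + T₃ + 1)

/-! ### Parameterized problems -/

/-- A parameterized problem: a set of pairs (instance, parameter). -/
abbrev ParamProblem : Type := Set (BinTree × ℕ)

/-- The input of a program for the instance `(x, k)`. -/
def inputTree (x : BinTree) (k : ℕ) : BinTree := BinTree.node x (BinTree.ofNat k)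

/-- On the instance `(x, k)` the program `p` halts within time `B`, and its answer is "true" if
and only if `Q` holds. -/
def DecidesWithin (p : Prog) (x : BinTree) (k : ℕ) (Q : Prop) (B : ℕ) : Prop :=
  ∃ (y : BinTree) (T : ℕ), Run p (inputTree x k) y T ∧ T ≤ B ∧ (y ≠ BinTree.nil ↔ Q)

/-- Fixed-parameter tractability: one algorithm decides the problem in time
`f(k) · |x| ^ c`, where `f` is computable. -/
def IsFPT (L : ParamProblem) : Prop :=
  ∃ (p : Prog) (f : ℕ → ℕ) (c : ℕ), Computable f ∧
    ∀ (x : BinTree) (k : ℕ), DecidesWithin p x k ((x, k) ∈ L) (f k * x.size ^ c)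

/-- Parameterized (many-one) reductions: an algorithm with running time `f(k) · |x| ^ c` maps
every instance `(x, k)` of `L` to an equivalent instance `(x', k')` of `L'` with `k' ≤ g(k)`,
where `f` and `g` are computable. -/
def FPTReducible (L L' : ParamProblem) : Prop :=
  ∃ (p : Prog) (f g : ℕ → ℕ) (c : ℕ), Computable f ∧ Computable g ∧
    ∀ (x : BinTree) (k : ℕ), ∃ (x' : BinTree) (k' T : ℕ),
      Run p (inputTree x k) (inputTree x' k') T ∧ T ≤ f k * x.size ^ c ∧ k' ≤ g k ∧
      ((x, k) ∈ L ↔ (x', k') ∈ L')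

/-! ### First-order formulas -/

/-- First-order formulas with equality over the relational vocabulary with symbols `ι` and
arities `ar`. The free variables are indexed by `Fin n`; a quantifier binds the variable `0` of
its body, and the variable `i + 1` of the body is the variable `i` of the quantified formula. -/
inductive FOFormula {ι : Type} (ar : ι → ℕ) : ℕ → Type
  | eq {n : ℕ} (x y : Fin n) : FOFormula ar n
  | rel {n : ℕ} (R : ι) (x : Fin (ar R) → Fin n) : FOFormula ar n
  | not {n : ℕ} (φ : FOFormula ar n) : FOFormula ar n
  | and {n : ℕ} (φ ψ : FOFormula ar n) : FOFormula ar n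
  | or {n : ℕ} (φ ψ : FOFormula ar n) : FOFormula ar n
  | imp {n : ℕ} (φ ψ : FOFormula ar n) : FOFormula ar n
  | iff {n : ℕ} (φ ψ : FOFormula ar n) : FOFormula ar n
  | all {n : ℕ} (φ : FOFormula ar (n + 1)) : FOFormula ar n
  | ex {n : ℕ} (φ : FOFormula ar (n + 1)) : FOFormula ar n

namespace FOFormula

variable {ι : Type} {ar : ι → ℕ}

/-- Truth of a formula in the structure with universe `U` and relations `I`, under the
assignment `v` of the free variables. -/
def Holds {U : Type} (I : (R : ι) → (Fin (ar R) → U) → Prop) :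
    {n : ℕ} → FOFormula ar n → (Fin n → U) → Prop
  | _, eq x y, v => v x = v y
  | _, rel R x, v => I R (fun i => v (x i))
  | _, not φ, v => ¬ φ.Holds I v
  | _, and φ ψ, v => φ.Holds I v ∧ ψ.Holds I v
  | _, or φ ψ, v => φ.Holds I v ∨ ψ.Holds I v
  | _, imp φ ψ, v => φ.Holds I v → ψ.Holds I v
  | _, iff φ ψ, v => (φ.Holds I v ↔ ψ.Holds I v)
  | _, all φ, v => ∀ a : U, φ.Holds I (Fin.cons a v : Fin _ → U)
  | _, ex φ, v => ∃ a : U, φ.Holds I (Fin.cons a v : Fin _ → U)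

/-- The length of a formula: its number of symbols, without parentheses. -/
def length : {n : ℕ} → FOFormula ar n → ℕ
  | _, eq _ _ => 3
  | _, rel R _ => ar R + 1
  | _, not φ => φ.length + 1
  | _, and φ ψ => φ.length + ψ.length + 1
  | _, or φ ψ => φ.length + ψ.length + 1
  | _, imp φ ψ => φ.length + ψ.length + 1
  | _, iff φ ψ => φ.length + ψ.length + 1
  | _, all φ => φ.length + 2
  | _, ex φ => φ.length + 2

/-- Quantifier-free formulas. -/
def IsQuantifierFree : {n : ℕ} → FOFormula ar n → Prop
  | _, eq _ _ => True
  | _, rel _ _ => True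
  | _, not φ => φ.IsQuantifierFree
  | _, and φ ψ => φ.IsQuantifierFree ∧ ψ.IsQuantifierFree
  | _, or φ ψ => φ.IsQuantifierFree ∧ ψ.IsQuantifierFree
  | _, imp φ ψ => φ.IsQuantifierFree ∧ ψ.IsQuantifierFree
  | _, iff φ ψ => φ.IsQuantifierFree ∧ ψ.IsQuantifierFree
  | _, all _ => False
  | _, ex _ => False

/-- Formulas `∃ x₁ ⋯ ∃ xₜ ψ` with `t ≥ 0` and `ψ` in the class `P`. -/
inductive ExPrefix (P : (n : ℕ) → FOFormula ar n → Prop) : (n : ℕ) → FOFormula ar n → Prop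
  | base {n : ℕ} {φ : FOFormula ar n} : P n φ → ExPrefix P n φ
  | ex {n : ℕ} {φ : FOFormula ar (n + 1)} : ExPrefix P (n + 1) φ → ExPrefix P n (ex φ)

/-- Formulas `∀ x₁ ⋯ ∀ xₜ ψ` with `t ≥ 0` and `ψ` in the class `P`. -/
inductive AllPrefix (P : (n : ℕ) → FOFormula ar n → Prop) : (n : ℕ) → FOFormula ar n → Prop
  | base {n : ℕ} {φ : FOFormula ar n} : P n φ → AllPrefix P n φ
  | all {n : ℕ} {φ : FOFormula ar (n + 1)} : AllPrefix P (n + 1) φ → AllPrefix P n (all φ)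

mutual

/-- The prefix class `Σ_s`. -/
def IsSigma : ℕ → (n : ℕ) → FOFormula ar n → Prop
  | 0 => fun _ φ => φ.IsQuantifierFree
  | s + 1 => ExPrefix (IsPi s)

/-- The prefix class `Π_s`. -/
def IsPi : ℕ → (n : ℕ) → FOFormula ar n → Prop
  | 0 => fun _ φ => φ.IsQuantifierFree
  | s + 1 => AllPrefix (IsSigma s)

end

end FOFormula

/-! ### The class W[t] -/

/-- The universe of the structure coded by a tree: the left subtree lists its elements, which
may be arbitrary trees. The right subtree lists the relations. -/
abbrev CodedUniverse (x : BinTree) : Type := {u : BinTree // u ∈ x.left.toList}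

/-- The `i`-th relation of the structure coded by a tree: the `i`-th entry of the right subtree
is the list of its tuples, each tuple being a list of elements. -/
def codedRel {m : ℕ} {ar : Fin m → ℕ} (x : BinTree) (i : Fin m)
    (v : Fin (ar i) → CodedUniverse x) : Prop :=
  BinTree.ofList (List.ofFn fun j => (v j).1) ∈
    (x.right.toList.getD i BinTree.nil).toList

/-- The arities of the vocabulary with the relation symbols `Fin m` and one more symbol, `none`,
of arity `r`, that stands for the relation to be found. -/
def arityWith {m : ℕ} (ar : Fin m → ℕ) (r : ℕ) : Option (Fin m) → ℕ
  | none => r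
  | some i => ar i

/-- The expansion of the structure coded by a tree by an `r`-ary relation `S`. -/
def expandBy {m : ℕ} (ar : Fin m → ℕ) (r : ℕ) (x : BinTree)
    (S : Finset (Fin r → CodedUniverse x)) :
    (R : Option (Fin m)) → (Fin (arityWith ar r R) → CodedUniverse x) → Prop
  | none => fun v => v ∈ S
  | some i => fun v => codedRel (ar := ar) x i v

/-- The weighted Fagin-definability problem of a sentence `φ(X)` with an `r`-ary relation
variable `X`: given a finite structure and `k`, is there an `r`-ary relation `S` with exactly `k`
tuples such that the structure satisfies `φ(S)`? The parameter is `k`. -/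
def weightedDefinability {m : ℕ} {ar : Fin m → ℕ} {r : ℕ}
    (φ : FOFormula (arityWith ar r) 0) : ParamProblem :=
  {q | ∃ S : Finset (Fin r → CodedUniverse q.1), S.card = q.2 ∧
    φ.Holds (expandBy ar r q.1 S) Fin.elim0}

/-- The class `W[t]`, `t ≥ 1`: the problems that have a parameterized reduction to the weighted
Fagin-definability problem of some `Π_t`-sentence `φ(X)`. -/
def InW (t : ℕ) (L : ParamProblem) : Prop :=
  ∃ (m : ℕ) (ar : Fin m → ℕ) (r : ℕ) (φ : FOFormula (arityWith ar r) 0),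
    FOFormula.IsPi t 0 φ ∧ FPTReducible L (weightedDefinability φ)

/-- `W[t]`-hardness (under parameterized reductions). -/
def WHard (t : ℕ) (L : ParamProblem) : Prop :=
  ∀ L' : ParamProblem, InW t L' → FPTReducible L' L

/-! ### Vertex removal -/

/-- First-order sentences on graphs; the only relation symbol is adjacency. -/
abbrev GraphSentence : Type := FOFormula (fun _ : Unit => 2) 0

/-- `G ⊨ φ`. -/
def GraphModels {V : Type} (G : SimpleGraph V) (φ : GraphSentence) : Prop :=
  φ.Holds (fun _ v => G.Adj (v 0) (v 1)) Fin.elim0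

/-- The question of Vertex-Removal to `φ`: is there a set `S` of at most `k` vertices such that
`G - S ⊨ φ`? -/
def VertexRemovable {V : Type} (φ : GraphSentence) (G : SimpleGraph V) (k : ℕ) : Prop :=
  ∃ S : Finset V, S.card ≤ k ∧ GraphModels (G.induce {v | v ∉ S}) φ

/-- The graph coded by a tree: the left subtree lists the vertices, which may be arbitrary trees,
and the right subtree lists the edges, as pairs of vertices. -/
def codedGraph (x : BinTree) : SimpleGraph (CodedUniverse x) where
  Adj u v := u ≠ v ∧ (BinTree.node u.1 v.1 ∈ x.right.toList ∨ BinTree.node v.1 u.1 ∈ x.right.toList)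
  symm := ⟨fun _ _ h => ⟨h.1.symm, h.2.symm⟩⟩
  loopless := ⟨fun _ h => h.1 rfl⟩

/-- The parameterized problem Vertex-Removal to `φ`, with parameter `k`. -/
def vertexRemoval (φ : GraphSentence) : ParamProblem :=
  {q | VertexRemovable φ (codedGraph q.1) q.2}

open Classical in
/-- The standard code of a graph with vertex set `{0, …, n - 1}`: the list of the vertices, in
unary, and the list of the ordered pairs of adjacent vertices. -/
noncomputable def graphCode {n : ℕ} (G : SimpleGraph (Fin n)) : BinTree :=
  BinTree.node
    (BinTree.ofList ((List.finRange n).map fun i => BinTree.ofNat i))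
    (BinTree.ofList
      ((((List.finRange n) ×ˢ (List.finRange n)).filter fun e => decide (G.Adj e.1 e.2)).map
        fun e => BinTree.node (BinTree.ofNat e.1) (BinTree.ofNat e.2)))

-- Tractability comes from a bounded search tree. Write `φ` as `∃x̄ ∀ȳ ∃z̄ ψ`. The values of `x̄`
-- are guessed and kept from then on. Suppose that, with `S` already removed, `∃z̄ ψ` fails at some
-- `ȳ`. Existential formulas are preserved when vertices are added, so no further removal that
-- spares `x̄` and `ȳ` can make this instance true: a member of `ȳ` that is not protected by `x̄`
-- has to go. Hence one branches over at most `b = |ȳ|` vertices, to depth `k`. A node of the search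
-- tree costs `n ^ O(|φ|)`, and there are at most about `(b + 1) ^ k` nodes. A quantifier has length
-- `2` and the kernel has length at least `3`, so `2 * (b + 1) ≤ |φ|`; the spare factor `2 ^ k`
-- swallows all polynomials in `k`, which leaves exactly `|φ| ^ k`. To obtain an absolute constant
-- `C`, every program construction has an overhead that is fixed before the formula. The steps are
-- `exists_eval`, `exists_violation`, `exists_search`, `exists_prefixSearch` and `exists_decider`.
--
-- Hardness is shown for the sentence "every triangle has an outside vertex that is adjacent to the
-- triangle and to nothing else". The reduction passes through a monotone selection problem: given
-- clauses, each a disjunction of terms, each term a conjunction of unnegated variables, choose few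
-- variables such that every clause contains a completely chosen term. In the graph, a clause is a
-- triangle, its terms are vertices attached to one corner, and each term vertex is joined to its
-- variables. Removing the chosen variables isolates a term vertex from all but the triangle. Each
-- clause has more copies than there are removals, so some copy of its triangle and of the copy
-- number attached to it is untouched (`removable_coverGraph`).
--
-- It remains to make a `Π₂` sentence `θ(X)` monotone although it contains `¬ X t`. List all tuples,
-- with a sentinel at the end. A set of `k` tuples is a path of `k + 1` steps through the suffixes
-- of this list, each step jumping to the next selected entry. With one variable for each possible
-- step, `X t` says that some chosen step selects `t`, and `¬ X t` says that some chosen step skips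
-- `t`: both are disjunctions of variables. Monotone clauses together with the bound `k + 1` force
-- the chosen variables to form a path (`selPath_of_satisfied`). Normal forms then translate `θ`
-- into clauses (`FOFormula.exists_clauses`), and `exists_chosen_iff` combines everything.

namespace BinTree

-- Sizes of trees and lists.

theorem size_pos (x : BinTree) : 0 < x.size := by
  cases x <;> simp [size]

@[simp] theorem size_nil : nil.size = 1 := rfl

@[simp] theorem size_node (a b : BinTree) : (node a b).size = a.size + b.size + 1 := rfl

@[simp] theorem left_node (a b : BinTree) : (node a b).left = a := rfl

@[simp] theorem right_node (a b : BinTree) : (node a b).right = b := rfl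

@[simp] theorem left_nil : nil.left = nil := rfl

@[simp] theorem right_nil : nil.right = nil := rfl

@[simp] theorem toList_nil : nil.toList = [] := rfl

@[simp] theorem toList_node (a b : BinTree) : (node a b).toList = a :: b.toList := rfl

@[simp] theorem ofList_nil : ofList [] = nil := rfl

@[simp] theorem ofList_cons (a : BinTree) (l : List BinTree) :
    ofList (a :: l) = node a (ofList l) := rfl

@[simp] theorem toList_ofList (l : List BinTree) : (ofList l).toList = l := by
  induction l <;> simp_all

@[simp] theorem ofList_toList : ∀ x : BinTree, ofList x.toList = x
  | nil => rfl
  | node a b => by simp [ofList_toList b]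

theorem ofList_injective : Function.Injective ofList :=
  Function.LeftInverse.injective toList_ofList

theorem size_left_le (x : BinTree) : x.left.size ≤ x.size := by
  cases x
  · simp
  · simp; omega

theorem size_right_le (x : BinTree) : x.right.size ≤ x.size := by
  cases x
  · simp
  · simp; omega

theorem length_toList_lt_size : ∀ x : BinTree, x.toList.length < x.size
  | nil => by simp
  | node a b => by
    have := length_toList_lt_size b
    have := a.size_pos
    simp; omega

theorem size_lt_of_mem_toList {u : BinTree} : ∀ {x : BinTree}, u ∈ x.toList → u.size < x.size
  | nil, h => by simp at h
  | node a b, h => by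
    rcases List.mem_cons.1 h with rfl | h
    · simp
    · have := size_lt_of_mem_toList h
      simp; omega

theorem size_ofList_append (l₁ l₂ : List BinTree) :
    (ofList (l₁ ++ l₂)).size + 1 = (ofList l₁).size + (ofList l₂).size := by
  induction l₁ with
  | nil => simp; omega
  | cons a l ih => simp; omega

theorem size_ofList_le {M : ℕ} (l : List BinTree) (h : ∀ u ∈ l, u.size ≤ M) :
    (ofList l).size ≤ l.length * (M + 1) + 1 := by
  induction l with
  | nil => simp
  | cons a l ih =>
    have h₁ := h a (by simp)
    have h₂ := ih fun u hu => h u (by simp [hu])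
    simp only [ofList_cons, size_node, List.length_cons]
    nlinarith

@[simp] theorem size_ofNat (k : ℕ) : (ofNat k).size = 2 * k + 1 := by
  induction k <;> simp_all [ofNat]; omega

@[simp] theorem length_toList_ofNat (k : ℕ) : (ofNat k).toList.length = k := by
  induction k <;> simp_all [ofNat]

theorem ofNat_injective : Function.Injective ofNat := fun a b h => by
  have := congrArg size h
  simp at this
  exact this

end BinTree

-- Running time against input and output size; termination of loops.

theorem inputTree_size (x : BinTree) (k : ℕ) : (inputTree x k).size = x.size + 2 * k + 2 := by
  simp [inputTree]; omega

/-- Elementary programs are charged the size of their input, and a compound program begins by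
running one of its parts on the same input. -/
theorem Run.input_size_le {p : Prog} {x y : BinTree} {T : ℕ} (h : Run p x y T) : x.size ≤ T := by
  induction h <;> omega

/-- This turns time bounds into size bounds, so that polynomial-time functions have outputs of
polynomial size without a separate argument. -/
theorem Run.output_size_le {p : Prog} {x y : BinTree} {T : ℕ} (h : Run p x y T) : y.size ≤ T := by
  induction h with
  | left x => exact x.size_left_le
  | right x => exact x.size_right_le
  | loop_stop h => exact h.input_size_le.trans (by omega)
  | empty x => exact x.size_pos
  | same_neg x => simp
  | same_pos x =>
    have := x.size_pos
    simp; omega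
  | _ => first | omega | (simp; omega)

/-- A loop halts when its states satisfy an invariant that comes with a decreasing potential. -/
theorem Run.exists_loop {c b : Prog} {A : ℕ} (Inv : ℕ → BinTree → Prop) (Done : BinTree → Prop)
    (step : ∀ n s, Inv n s → (Done s ∧ ∃ T ≤ A, Run c s BinTree.nil T) ∨
      ∃ m < n, ∃ t s' T₁ T₂, Inv m s' ∧ Run c s t T₁ ∧ t ≠ BinTree.nil ∧ Run b s s' T₂ ∧
        T₁ + T₂ ≤ A) :
    ∀ n s, Inv n s → ∃ s' m T, Inv m s' ∧ Done s' ∧ Run (Prog.loop c b) s s' T ∧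
      T ≤ (n + 1) * (A + 1) := by
  intro n
  induction n using Nat.strong_induction_on with
  | _ n ih =>
    intro s hs
    rcases step n s hs with ⟨hd, T, hT, hr⟩ | ⟨m, hm, t, s', T₁, T₂, hI, hc, ht, hb, hA⟩
    · exact ⟨s, n, _, hs, hd, Run.loop_stop hr, by nlinarith⟩
    · obtain ⟨s'', m', T, h1, h2, h3, h4⟩ := ih m hm s' hI
      refine ⟨s'', m', _, h1, h2, Run.loop_step hc ht hb h3, ?_⟩
      have : (m + 1) * (A + 1) ≤ n * (A + 1) := Nat.mul_le_mul_right _ hm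
      nlinarith

/-! ### Polynomial bounds -/

/-- A function on trees that is bounded by a polynomial in the size. -/
def PolyBdd (b : BinTree → ℕ) : Prop := ∃ c : ℕ, ∀ x, b x ≤ (x.size + 1) ^ c

namespace PolyBdd

theorem mono {a b : BinTree → ℕ} (hb : PolyBdd b) (h : ∀ x, a x ≤ b x) : PolyBdd a :=
  hb.imp fun _ hc x => (h x).trans (hc x)

theorem size : PolyBdd BinTree.size := ⟨1, fun x => by simp⟩

/-- The base `x.size + 1` is at least `2`, and `n < 2 ^ n`. -/
theorem const (n : ℕ) : PolyBdd fun _ => n :=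
  ⟨n, fun x => (Nat.lt_two_pow_self).le.trans
    (Nat.pow_le_pow_left (by have := x.size_pos; omega) n)⟩

theorem mul {a b : BinTree → ℕ} : PolyBdd a → PolyBdd b → PolyBdd fun x => a x * b x := by
  rintro ⟨c, hc⟩ ⟨d, hd⟩
  exact ⟨c + d, fun x => by rw [pow_add]; exact Nat.mul_le_mul (hc x) (hd x)⟩

theorem add {a b : BinTree → ℕ} : PolyBdd a → PolyBdd b → PolyBdd fun x => a x + b x := by
  rintro ⟨c, hc⟩ ⟨d, hd⟩
  -- The additional exponent `1` is a factor of at least `2`, which pays for two summands.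
  refine ⟨c + d + 1, fun x => ?_⟩
  have hs : 2 ≤ x.size + 1 := by have := x.size_pos; omega
  have h1 : (x.size + 1) ^ c ≤ (x.size + 1) ^ (c + d) := Nat.pow_le_pow_right (by omega) (by omega)
  have h2 : (x.size + 1) ^ d ≤ (x.size + 1) ^ (c + d) := Nat.pow_le_pow_right (by omega) (by omega)
  have := hc x
  have := hd x
  rw [pow_succ]
  nlinarith

theorem pow {a : BinTree → ℕ} (ha : PolyBdd a) (n : ℕ) : PolyBdd fun x => a x ^ n := by
  induction n with
  | zero => simpa using const 1
  | succ n ih => simpa only [pow_succ] using ih.mul ha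

theorem comp {b : BinTree → ℕ} {f : BinTree → BinTree} (hb : PolyBdd b)
    (hf : PolyBdd fun x => (f x).size) : PolyBdd fun x => b (f x) := by
  obtain ⟨c, hc⟩ := hb
  exact ((hf.add (const 1)).pow c).mono fun x => hc (f x)

end PolyBdd

/-! ### Functions computable in polynomial time -/

/-- The function is computed by a program in polynomial time. -/
def PolyTime (f : BinTree → BinTree) : Prop :=
  ∃ (p : Prog) (c : ℕ), ∀ x, ∃ T, Run p x (f x) T ∧ T ≤ (x.size + 1) ^ c

theorem PolyTime.of_bdd {f : BinTree → BinTree} {b : BinTree → ℕ} (hb : PolyBdd b) (p : Prog)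
    (h : ∀ x, ∃ T, Run p x (f x) T ∧ T ≤ b x) : PolyTime f := by
  obtain ⟨c, hc⟩ := hb
  exact ⟨p, c, fun x => let ⟨T, h1, h2⟩ := h x; ⟨T, h1, h2.trans (hc x)⟩⟩

theorem PolyTime.exists_bdd {f : BinTree → BinTree} (hf : PolyTime f) :
    ∃ (p : Prog) (b : BinTree → ℕ), PolyBdd b ∧ ∀ x, ∃ T, Run p x (f x) T ∧ T ≤ b x := by
  obtain ⟨p, c, h⟩ := hf
  exact ⟨p, _, ⟨c, fun _ => le_rfl⟩, h⟩

namespace PolyTime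

open BinTree

theorem size_bdd {f : BinTree → BinTree} (hf : PolyTime f) : PolyBdd fun x => (f x).size := by
  obtain ⟨p, c, h⟩ := hf
  exact ⟨c, fun x => let ⟨T, h1, h2⟩ := h x; h1.output_size_le.trans h2⟩

theorem id : PolyTime fun x => x :=
  of_bdd PolyBdd.size Prog.ident fun x => ⟨_, Run.ident x, le_rfl⟩

theorem nil : PolyTime fun _ => nil :=
  of_bdd PolyBdd.size Prog.empty fun x => ⟨_, Run.empty x, le_rfl⟩

theorem comp {f g : BinTree → BinTree} (hg : PolyTime g) (hf : PolyTime f) :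
    PolyTime fun x => g (f x) := by
  have hs := hf.size_bdd
  obtain ⟨p, a, ha, hp⟩ := hf.exists_bdd
  obtain ⟨q, b, hb, hq⟩ := hg.exists_bdd
  refine of_bdd ((ha.add (hb.comp hs)).add (PolyBdd.const 1)) (Prog.seq p q) fun x => ?_
  obtain ⟨T₁, h1, h2⟩ := hp x
  obtain ⟨T₂, h3, h4⟩ := hq (f x)
  exact ⟨_, Run.seq h1 h3, by omega⟩

theorem left {f : BinTree → BinTree} (hf : PolyTime f) : PolyTime fun x => (f x).left :=
  comp (g := BinTree.left) (of_bdd PolyBdd.size Prog.left fun x => ⟨_, Run.left x, le_rfl⟩) hf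

theorem right {f : BinTree → BinTree} (hf : PolyTime f) : PolyTime fun x => (f x).right :=
  comp (g := BinTree.right) (of_bdd PolyBdd.size Prog.right fun x => ⟨_, Run.right x, le_rfl⟩) hf

theorem node {f g : BinTree → BinTree} (hf : PolyTime f) (hg : PolyTime g) :
    PolyTime fun x => node (f x) (g x) := by
  obtain ⟨p, a, ha, hp⟩ := hf.exists_bdd
  obtain ⟨q, b, hb, hq⟩ := hg.exists_bdd
  refine of_bdd ((ha.add hb).add (PolyBdd.const 1)) (Prog.pair p q) fun x => ?_
  obtain ⟨T₁, h1, h2⟩ := hp x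
  obtain ⟨T₂, h3, h4⟩ := hq x
  exact ⟨_, Run.pair h1 h3, by omega⟩

theorem const : ∀ t : BinTree, PolyTime fun _ => t
  | .nil => nil
  | .node a b => (const a).node (const b)

theorem iteNil {c f g : BinTree → BinTree} (hc : PolyTime c) (hf : PolyTime f) (hg : PolyTime g) :
    PolyTime fun x => if c x = .nil then g x else f x := by
  obtain ⟨r, d, hd, hr⟩ := hc.exists_bdd
  obtain ⟨p, a, ha, hp⟩ := hf.exists_bdd
  obtain ⟨q, b, hb, hq⟩ := hg.exists_bdd
  refine of_bdd (((hd.add ha).add hb).add (PolyBdd.const 1)) (Prog.branch r p q) fun x => ?_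
  obtain ⟨T₀, h1, h2⟩ := hr x
  obtain ⟨T₁, h3, h4⟩ := hp x
  obtain ⟨T₂, h5, h6⟩ := hq x
  by_cases h : c x = .nil
  · exact ⟨_, by simpa [h] using Run.branch_neg (h ▸ h1) h5, by omega⟩
  · exact ⟨_, by simpa [h] using Run.branch_pos h1 h h3, by omega⟩

/-- Folding a polynomial-time step over a list, when all intermediate results are of polynomial
size. -/
theorem foldl {F : BinTree → BinTree → BinTree → BinTree} {l a : BinTree → BinTree}
    (hF : PolyTime fun z => F z.left z.right.left z.right.right) (hl : PolyTime l)
    (ha : PolyTime a) {d : BinTree → ℕ} (hd : PolyBdd d)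
    (hs : ∀ x l', l' <+: (l x).toList → (l'.foldl (fun s u => F x u s) (a x)).size ≤ d x) :
    PolyTime fun x => (l x).toList.foldl (fun s u => F x u s) (a x) := by
  -- The states of the loop are `node x (node rest acc)`; a round moves the head of `rest` into
  -- `acc`.
  have hbody : PolyTime fun z => .node z.left (.node z.right.left.right
      (F z.left z.right.left.left z.right.right)) := by
    refine id.left.node (id.right.left.right.node ?_)
    exact comp (f := fun z => .node z.left (.node z.right.left.left z.right.right)) hF
      (id.left.node (id.right.left.left.node id.right.right))
  obtain ⟨pb, b, ⟨cb, hb⟩, hpb⟩ := hbody.exists_bdd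
  obtain ⟨pc, c, ⟨cc, hc⟩, hpc⟩ := id.right.left.exists_bdd
  obtain ⟨pl, tl, htl, hpl⟩ := (id.node (hl.node ha)).exists_bdd
  obtain ⟨po, o, ⟨co, ho⟩, hpo⟩ := id.right.right.exists_bdd
  -- `M x` bounds the size of every state, hence `A x` bounds the cost of every round.
  let M : BinTree → ℕ := fun x => x.size + (l x).size + d x + 2
  have hM : PolyBdd M := ((PolyBdd.size.add hl.size_bdd).add hd).add (PolyBdd.const 2)
  let A : BinTree → ℕ := fun x => (M x + 1) ^ cb + (M x + 1) ^ cc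
  have hA : PolyBdd A :=
    ((hM.add (PolyBdd.const 1)).pow cb).add ((hM.add (PolyBdd.const 1)).pow cc)
  refine of_bdd (b := fun x => tl x + (((l x).size + 1) * (A x + 1) + (M x + 1) ^ co + 1) + 1)
    ((htl.add ((((hl.size_bdd.add (.const 1)).mul (hA.add (.const 1))).add
      ((hM.add (.const 1)).pow co)).add (.const 1))).add (.const 1))
    (Prog.seq pl (Prog.seq (Prog.loop pc pb) po)) fun x => ?_
  obtain ⟨T₀, hr₀, hT₀⟩ := hpl x
  let Inv : ℕ → BinTree → Prop := fun n s => ∃ l₁ l₂, (l x).toList = l₁ ++ l₂ ∧ n = l₂.length ∧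
    s = .node x (.node (ofList l₂) (l₁.foldl (fun s u => F x u s) (a x)))
  have hsize : ∀ n s, Inv n s → s.size ≤ M x := by
    rintro n s ⟨l₁, l₂, h1, -, rfl⟩
    have h2 := hs x l₁ ⟨l₂, h1.symm⟩
    have h3 := size_ofList_append l₁ l₂
    rw [← h1, ofList_toList] at h3
    have := (ofList l₁).size_pos
    simp only [size_node, M]
    omega
  obtain ⟨s', m, T₁, hI, hD, hr₁, hT₁⟩ := Run.exists_loop (c := pc) (b := pb) (A := A x) Inv
    (fun s => s.right.left = .nil) (by
      intro n s hns
      have hsz := hsize n s hns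
      obtain ⟨T₁, h1, h2⟩ := hpc s
      obtain ⟨T₂, h3, h4⟩ := hpb s
      have hT₁ : T₁ ≤ (M x + 1) ^ cc :=
        (h2.trans (hc s)).trans (Nat.pow_le_pow_left (by omega) _)
      have hT₂ : T₂ ≤ (M x + 1) ^ cb :=
        (h4.trans (hb s)).trans (Nat.pow_le_pow_left (by omega) _)
      by_cases hn : s.right.left = .nil
      · exact Or.inl ⟨hn, T₁, hT₁.trans (Nat.le_add_left _ _), hn ▸ h1⟩
      · right
        obtain ⟨l₁, l₂, h5, h6, h7⟩ := hns
        cases l₂ with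
        | nil => simp [h7] at hn
        | cons u l₂ =>
          refine ⟨l₂.length, by simp [h6], _, _, T₁, T₂, ⟨l₁ ++ [u], l₂, by simp [h5], rfl, rfl⟩,
            h1, hn, ?_, by simp only [A]; omega⟩
          rw [h7] at h3 ⊢
          simpa using h3) (l x).toList.length (.node x (.node (l x) (a x)))
      ⟨[], _, rfl, rfl, by simp⟩
  obtain ⟨T₂, hr₂, hT₂⟩ := hpo s'
  have hsz := hsize m s' hI
  obtain ⟨l₁, l₂, h5, h6, h7⟩ := hI
  have hl₂ : l₂ = [] := by
    rw [h7] at hD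
    cases l₂ with
    | nil => rfl
    | cons u l₂ => simp at hD
  subst hl₂
  rw [List.append_nil] at h5
  have hres : s'.right.right = (l x).toList.foldl (fun s u => F x u s) (a x) := by
    rw [h7, h5]; rfl
  refine ⟨_, Run.seq hr₀ (Run.seq hr₁ (hres ▸ hr₂)), ?_⟩
  have hT₂' : T₂ ≤ (M x + 1) ^ co :=
    (hT₂.trans (ho s')).trans (Nat.pow_le_pow_left (by omega) _)
  have hT₁' : T₁ ≤ ((l x).size + 1) * (A x + 1) := hT₁.trans (Nat.mul_le_mul_right _ (by
    have := (l x).length_toList_lt_size; omega))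
  show T₀ + (T₁ + T₂ + 1) + 1 ≤ _
  omega

end PolyTime

-- Concatenation and flattening of lists in polynomial time.

namespace BinTree

/-- The list coded by `a`, reversed and put in front of the list coded by `b`. -/
def revAppend (a b : BinTree) : BinTree := a.toList.foldl (fun s u => node u s) b

@[simp] theorem toList_revAppend (a b : BinTree) :
    (revAppend a b).toList = a.toList.reverse ++ b.toList := by
  have : ∀ (l : List BinTree) (b : BinTree),
      (l.foldl (fun s u => node u s) b).toList = l.reverse ++ b.toList := by
    intro l
    induction l with
    | nil => simp
    | cons u l ih => intro b; simp [ih]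
  exact this _ _

theorem size_foldl_node (l : List BinTree) (b : BinTree) :
    (l.foldl (fun s u => node u s) b).size + 1 = (ofList l).size + b.size := by
  induction l generalizing b with
  | nil => simp; omega
  | cons u l ih => simp only [List.foldl_cons, ih, size_node, ofList_cons]; omega

theorem size_revAppend (a b : BinTree) : (revAppend a b).size + 1 = a.size + b.size := by
  rw [revAppend, size_foldl_node, ofList_toList]

/-- The concatenation (in some order) of the lists `F u`, where `u` runs through the list `l`. -/
def collect (F : BinTree → BinTree) (l : BinTree) : BinTree :=
  l.toList.foldl (fun s u => revAppend (F u) s) nil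

@[simp] theorem mem_collect {F : BinTree → BinTree} {l t : BinTree} :
    t ∈ (collect F l).toList ↔ ∃ u ∈ l.toList, t ∈ (F u).toList := by
  have : ∀ (l : List BinTree) (b : BinTree),
      t ∈ (l.foldl (fun s u => revAppend (F u) s) b).toList ↔
        (∃ u ∈ l, t ∈ (F u).toList) ∨ t ∈ b.toList := by
    intro l
    induction l with
    | nil => simp
    | cons u l ih =>
      intro b
      rw [List.foldl_cons, ih]
      simp only [toList_revAppend, List.mem_append, List.mem_reverse, List.exists_mem_cons_iff]
      rw [or_left_comm, or_assoc]
  simpa [collect] using this l.toList nil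

theorem size_foldl_revAppend_le {F : BinTree → BinTree} {M : ℕ} (l : List BinTree)
    (h : ∀ u ∈ l, (F u).size ≤ M) (b : BinTree) :
    (l.foldl (fun s u => revAppend (F u) s) b).size ≤ l.length * M + b.size := by
  induction l generalizing b with
  | nil => simp
  | cons u l ih =>
    have h1 := ih (fun v hv => h v (by simp [hv])) (revAppend (F u) b)
    have h2 := size_revAppend (F u) b
    have h3 := h u (by simp)
    simp only [List.foldl_cons, List.length_cons]
    nlinarith

end BinTree

namespace PolyTime

open BinTree

theorem revAppend {f g : BinTree → BinTree} (hf : PolyTime f) (hg : PolyTime g) :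
    PolyTime fun x => revAppend (f x) (g x) := by
  refine foldl (F := fun _ u s => .node u s) (id.right.left.node id.right.right) hf hg
    (hf.size_bdd.add hg.size_bdd) ?_
  rintro x l' ⟨l'', h⟩
  have h1 := size_foldl_node l' (g x)
  have h2 := size_ofList_append l' l''
  have := (ofList l'').size_pos
  rw [h, ofList_toList] at h2
  omega

/-- The accumulator grows additively: each member `u` contributes one value of a polynomial-time
function at `node x u`, and `u` is smaller than `l x`. So the size hypothesis of `PolyTime.foldl` is
met. -/
theorem collect {F : BinTree → BinTree → BinTree} {l : BinTree → BinTree}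
    (hF : PolyTime fun z => F z.left z.right) (hl : PolyTime l) :
    PolyTime fun x => collect (F x) (l x) := by
  obtain ⟨c, hc⟩ := hF.size_bdd
  have hM : PolyBdd fun x => (l x).size * (x.size + (l x).size + 1 + 1) ^ c + 1 :=
    (hl.size_bdd.mul ((((PolyBdd.size.add hl.size_bdd).add (.const 1)).add (.const 1)).pow c)).add
      (.const 1)
  refine foldl (F := fun x u s => BinTree.revAppend (F x u) s)
    (revAppend (comp (f := fun z => .node z.left z.right.left) hF (id.left.node id.right.left))
      id.right.right) hl nil hM ?_
  intro x l' hl'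
  refine (size_foldl_revAppend_le (M := (x.size + (l x).size + 1 + 1) ^ c) l' ?_ _).trans ?_
  · intro u hu
    refine (hc (.node x u)).trans (Nat.pow_le_pow_left ?_ _)
    have := size_lt_of_mem_toList (hl'.subset hu)
    simp; omega
  · have := hl'.length_le
    have := (l x).length_toList_lt_size
    gcongr
    · omega
    · simp

end PolyTime

-- Properties decidable in polynomial time.

/-- The property is decided by a program in polynomial time. -/
def PolyDec (P : BinTree → Prop) : Prop :=
  ∃ f : BinTree → BinTree, PolyTime f ∧ ∀ x, f x ≠ BinTree.nil ↔ P x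

namespace PolyDec

open BinTree

theorem congr {P Q : BinTree → Prop} (hP : PolyDec P) (h : ∀ x, P x ↔ Q x) : PolyDec Q :=
  (funext fun x => propext (h x) : P = Q) ▸ hP

theorem not {P : BinTree → Prop} : PolyDec P → PolyDec fun x => ¬ P x := by
  rintro ⟨f, hf, h⟩
  refine ⟨_, hf.iteNil .nil (.const (.node .nil .nil)), fun x => ?_⟩
  beta_reduce
  rw [← h x]
  by_cases hx : f x = .nil <;> simp [hx]

theorem and {P Q : BinTree → Prop} : PolyDec P → PolyDec Q → PolyDec fun x => P x ∧ Q x := by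
  rintro ⟨f, hf, h⟩ ⟨g, hg, h'⟩
  refine ⟨_, hf.iteNil hg .nil, fun x => ?_⟩
  beta_reduce
  rw [← h x, ← h' x]
  by_cases hx : f x = .nil <;> simp [hx]

theorem or {P Q : BinTree → Prop} (hP : PolyDec P) (hQ : PolyDec Q) :
    PolyDec fun x => P x ∨ Q x :=
  (hP.not.and hQ.not).not.congr fun x => by tauto

theorem eq {f g : BinTree → BinTree} (hf : PolyTime f) (hg : PolyTime g) :
    PolyDec fun x => f x = g x := by
  have : PolyTime fun x => if x.left = x.right then .node .nil .nil else .nil := by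
    refine .of_bdd (PolyBdd.size.add (.const 2)) Prog.same fun x => ?_
    by_cases h : x.left = x.right
    · exact ⟨_, by simpa [h] using Run.same_pos x h, le_rfl⟩
    · exact ⟨_, by simpa [h] using Run.same_neg x h, le_rfl⟩
  refine ⟨_, this.comp (hf.node hg), fun x => ?_⟩
  by_cases h : f x = g x <;> simp [h]

theorem true : PolyDec fun _ => True := (eq .nil .nil).congr fun _ => by simp

theorem false : PolyDec fun _ => False := true.not.congr fun _ => by simp

end PolyDec

theorem PolyTime.ite {P : BinTree → Prop} [DecidablePred P] {f g : BinTree → BinTree}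
    (hP : PolyDec P) (hf : PolyTime f) (hg : PolyTime g) :
    PolyTime fun x => if P x then f x else g x := by
  obtain ⟨c, hc, h⟩ := hP
  have : (fun x => if P x then f x else g x) = fun x => if c x = .nil then g x else f x := by
    funext x
    by_cases hx : P x
    · simp [hx, (h x).2 hx]
    · simp [hx, not_not.1 (mt (h x).1 hx)]
  exact this ▸ hc.iteNil hf hg

namespace PolyDec

open BinTree

/-- Each witness contributes one entry to a list, so existence of a witness becomes being different
from `nil`. -/
theorem exists_mem {P : BinTree → BinTree → Prop} {l : BinTree → BinTree}
    (hP : PolyDec fun z => P z.left z.right) (hl : PolyTime l) :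
    PolyDec fun x => ∃ u ∈ (l x).toList, P x u := by
  classical
  refine ⟨_, PolyTime.collect (F := fun x u => if P x u then .node .nil .nil else .nil)
    (.ite hP (.const _) .nil) hl, fun x => ?_⟩
  have : ∀ t : BinTree, t ≠ .nil ↔ ∃ u, u ∈ t.toList := by
    intro t
    cases t <;> simp
  simp only [this, mem_collect]
  constructor
  · rintro ⟨v, u, hu, hv⟩
    by_cases h : P x u
    · exact ⟨u, hu, h⟩
    · simp [h] at hv
  · rintro ⟨u, hu, h⟩
    exact ⟨.nil, u, hu, by simp [h]⟩

theorem mem {f l : BinTree → BinTree} (hf : PolyTime f) (hl : PolyTime l) :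
    PolyDec fun x => f x ∈ (l x).toList :=
  (exists_mem (P := fun x u => u = f x) (eq PolyTime.id.right (hf.comp PolyTime.id.left))
    hl).congr fun x => by simp

end PolyDec

/-- The members of the list `l` that satisfy `P`. -/
def BinTree.select (P : BinTree → Prop) [DecidablePred P] (l : BinTree) : BinTree :=
  BinTree.collect (fun u => if P u then .node u .nil else .nil) l

@[simp] theorem BinTree.mem_select {P : BinTree → Prop} [DecidablePred P] {l u : BinTree} :
    u ∈ (BinTree.select P l).toList ↔ u ∈ l.toList ∧ P u := by
  simp only [select, mem_collect]
  constructor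
  · rintro ⟨v, hv, h⟩
    by_cases hP : P v
    · simp only [hP, if_true, toList_node, toList_nil, List.mem_singleton] at h
      exact h ▸ ⟨hv, hP⟩
    · simp [hP] at h
  · rintro ⟨h, hP⟩
    exact ⟨u, h, by simp [hP]⟩

theorem PolyTime.select {P : BinTree → BinTree → Prop} [∀ x, DecidablePred (P x)]
    {l : BinTree → BinTree} (hP : PolyDec fun z => P z.left z.right) (hl : PolyTime l) :
    PolyTime fun x => BinTree.select (P x) (l x) :=
  PolyTime.collect (F := fun x u => if P x u then .node u .nil else .nil)
    (.ite hP (PolyTime.id.right.node .nil) .nil) hl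

/-! ### Reductions in polynomial time -/

theorem Computable.natPow {f : ℕ → ℕ} (hf : Computable f) (c : ℕ) :
    Computable fun k => f k ^ c := by
  induction c with
  | zero => simpa using Computable.const 1
  | succ c ih => simpa only [pow_succ] using Primrec.nat_mul.to_comp.comp ih hf

/-- The first reduction produces a tree no larger than its running time, so the second one is
polynomial in `f k * x.size ^ c`, which separates into a computable function of `k` and a power of
`x.size`. Monotonicity of `g` carries over the bound on the intermediate parameter. -/
theorem FPTReducible.trans_polyTime {L L' L'' : ParamProblem} (h : FPTReducible L L')
    {F : BinTree → BinTree} {g : ℕ → ℕ} (hF : PolyTime F) (hg : Computable g)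
    (hmono : Monotone g)
    (hred : ∀ x k, ∃ x', F (inputTree x k) = inputTree x' (g k) ∧
      ((x, k) ∈ L' ↔ (x', g k) ∈ L'')) : FPTReducible L L'' := by
  obtain ⟨p, f, g', c, hf, hg', h⟩ := h
  obtain ⟨q, d, hq⟩ := hF
  refine ⟨Prog.seq p q, fun k => (f k + 2) ^ (d + 1), fun k => g (g' k), (c + 1) * (d + 1), ?_,
    hg.comp hg', fun x k => ?_⟩
  · exact Computable.natPow (Primrec.nat_add.to_comp.comp hf (Computable.const 2)) _
  obtain ⟨x', k', T, h1, h2, h3, h4⟩ := h x k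
  obtain ⟨x'', h5, h6⟩ := hred x' k'
  obtain ⟨T', h7, h8⟩ := hq (inputTree x' k')
  rw [h5] at h7
  refine ⟨x'', g k', _, Run.seq h1 h7, ?_, hmono h3, h4.trans h6⟩
  have hs := h1.output_size_le
  have hx := x.size_pos
  have hX : 1 ≤ x.size ^ c := Nat.one_le_pow _ _ hx
  have h9 : T' ≤ (T + 1) ^ d := h8.trans (Nat.pow_le_pow_left (by omega) _)
  have h10 : 1 ≤ (T + 1) ^ d := Nat.one_le_pow _ _ (by omega)
  have h11 : T + T' + 1 ≤ (T + 2) * (T + 1) ^ d := by nlinarith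
  have h12 : T + 2 ≤ (f k + 2) * x.size ^ c := by nlinarith
  calc T + T' + 1 ≤ (T + 2) * (T + 2) ^ d :=
        h11.trans (Nat.mul_le_mul_left _ (Nat.pow_le_pow_left (by omega) _))
    _ = (T + 2) ^ (d + 1) := by ring
    _ ≤ ((f k + 2) * x.size ^ c) ^ (d + 1) := Nat.pow_le_pow_left h12 _
    _ = (f k + 2) ^ (d + 1) * x.size ^ (c * (d + 1)) := by rw [mul_pow, ← pow_mul]
    _ ≤ _ := Nat.mul_le_mul_left _ (Nat.pow_le_pow_right hx (Nat.mul_le_mul_right _ (by omega)))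

/-! ### The hard sentence -/

/-- Adjacency of two variables. -/
def adjAtom {n : ℕ} (i j : Fin n) : FOFormula (fun _ : Unit => 2) n := .rel () ![i, j]

/-- For every triangle there is a vertex outside of it that has a neighbour in the triangle, but
no neighbour outside of the triangle. -/
def triangleSentence : GraphSentence :=
  .all <| .all <| .all <| .ex <| .all <|
    .imp (.and (.and (adjAtom 4 3) (adjAtom 3 2)) (adjAtom 4 2))
      (.and (.and (.or (.or (adjAtom 1 2) (adjAtom 1 3)) (adjAtom 1 4))
          (.not (.or (.or (.eq 1 2) (.eq 1 3)) (.eq 1 4))))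
        (.imp (adjAtom 0 1) (.or (.or (.eq 0 2) (.eq 0 3)) (.eq 0 4))))

theorem triangleSentence_isPi : FOFormula.IsPi 3 0 triangleSentence := by
  refine .all (.all (.all (.base (.ex (.base (.all (.base ?_)))))))
  simp [FOFormula.IsSigma, FOFormula.IsQuantifierFree, adjAtom]

theorem graphModels_triangleSentence {V : Type} (G : SimpleGraph V) :
    GraphModels G triangleSentence ↔ ∀ y a b : V, G.Adj y a → G.Adj a b → G.Adj y b →
      ∃ c, (G.Adj c b ∨ G.Adj c a ∨ G.Adj c y) ∧ (c ≠ b ∧ c ≠ a ∧ c ≠ y) ∧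
        ∀ v, G.Adj v c → v = b ∨ v = a ∨ v = y := by
  have : GraphModels G triangleSentence ↔ ∀ y a b : V, ∃ c, ∀ v,
      (G.Adj y a ∧ G.Adj a b) ∧ G.Adj y b → (((G.Adj c b ∨ G.Adj c a) ∨ G.Adj c y) ∧
        ¬ ((c = b ∨ c = a) ∨ c = y)) ∧ (G.Adj v c → (v = b ∨ v = a) ∨ v = y) := Iff.rfl
  rw [this]
  refine forall₃_congr fun y a b => ⟨?_, ?_⟩
  · rintro ⟨c, hc⟩ h1 h2 h3
    -- The conditions on `c` alone do not involve `v`, so they are read off at `v = c`.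
    have h := fun v => hc v ⟨⟨h1, h2⟩, h3⟩
    refine ⟨c, ?_, ?_, fun v hv => ?_⟩
    · have := (h c).1.1; tauto
    · have := (h c).1.2; tauto
    · have := (h v).2 hv; tauto
  · intro h
    by_cases ht : (G.Adj y a ∧ G.Adj a b) ∧ G.Adj y b
    · obtain ⟨c, h1, h2, h3⟩ := h ht.1.1 ht.1.2 ht.2
      refine ⟨c, fun v _ => ⟨⟨by tauto, by tauto⟩, fun hv => ?_⟩⟩
      have := h3 v hv
      tauto
    -- The prenex form asks for `c` even if there is no triangle; any vertex will do.
    · exact ⟨y, fun v hv => absurd hv ht⟩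

/-! ### The reduction from set families -/

namespace BinTree

/-- The `i`-th vertex (`i = 1, 2, 3`) of the triangle for the copy `j` of the clause `q`. -/
def triVertex (i : ℕ) (q j : BinTree) : BinTree := node (ofNat i) (node j q)

/-- The vertex for the term `τ` of the copy `j` of the clause `q`. -/
def termVertex (τ q j : BinTree) : BinTree := node (ofNat 4) (node τ (node j q))

/-- The vertex for the variable `w`. -/
def varVertex (w : BinTree) : BinTree := node nil w

/-- The list of the vertices of `coverGraph`. -/
def coverVertices (J K : BinTree) : BinTree :=
  collect (fun q => revAppend
    (collect (fun j => node (triVertex 1 q j) (node (triVertex 2 q j)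
      (node (triVertex 3 q j) nil))) J)
    (collect (fun τ => revAppend (collect (fun w => node (varVertex w) nil) τ)
      (collect (fun j => node (termVertex τ q j) nil) J)) q)) K

/-- The list of the edges of `coverGraph`. -/
def coverEdges (J K : BinTree) : BinTree :=
  collect (fun q => collect (fun j => revAppend
    (node (node (triVertex 1 q j) (triVertex 2 q j))
      (node (node (triVertex 2 q j) (triVertex 3 q j))
        (node (node (triVertex 3 q j) (triVertex 1 q j)) nil)))
    (collect (fun τ => node (node (triVertex 1 q j) (termVertex τ q j))
      (collect (fun w => node (node (termVertex τ q j) (varVertex w)) nil) τ)) q)) J) K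

/-- The graph for the list `K` of clauses. A clause is a list of terms, a term is a list of
variables. For every clause there is a copy for each member of `J`. -/
def coverGraph (J K : BinTree) : BinTree := node (coverVertices J K) (coverEdges J K)

/-- The edges of `coverGraph`. -/
inductive CoverEdge (J K : BinTree) : BinTree → BinTree → Prop
  | tri₁₂ {q j : BinTree} : q ∈ K.toList → j ∈ J.toList →
      CoverEdge J K (triVertex 1 q j) (triVertex 2 q j)
  | tri₂₃ {q j : BinTree} : q ∈ K.toList → j ∈ J.toList →
      CoverEdge J K (triVertex 2 q j) (triVertex 3 q j)
  | tri₃₁ {q j : BinTree} : q ∈ K.toList → j ∈ J.toList →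
      CoverEdge J K (triVertex 3 q j) (triVertex 1 q j)
  | clause {q j τ : BinTree} : q ∈ K.toList → j ∈ J.toList → τ ∈ q.toList →
      CoverEdge J K (triVertex 1 q j) (termVertex τ q j)
  | term {q j τ w : BinTree} : q ∈ K.toList → j ∈ J.toList → τ ∈ q.toList → w ∈ τ.toList →
      CoverEdge J K (termVertex τ q j) (varVertex w)

theorem mem_coverEdges {J K u v : BinTree} :
    node u v ∈ (coverEdges J K).toList ↔ CoverEdge J K u v := by
  simp only [coverEdges, mem_collect, toList_revAppend, List.mem_append, List.mem_reverse,
    toList_node, toList_nil, List.mem_cons, List.not_mem_nil, or_false, node.injEq]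
  constructor
  · rintro ⟨q, hq, j, hj, (⟨rfl, rfl⟩ | ⟨rfl, rfl⟩ | ⟨rfl, rfl⟩) |
      ⟨τ, hτ, ⟨rfl, rfl⟩ | ⟨w, hw, rfl, rfl⟩⟩⟩
    · exact .tri₁₂ hq hj
    · exact .tri₂₃ hq hj
    · exact .tri₃₁ hq hj
    · exact .clause hq hj hτ
    · exact .term hq hj hτ hw
  · rintro (⟨hq, hj⟩ | ⟨hq, hj⟩ | ⟨hq, hj⟩ | ⟨hq, hj, hτ⟩ | ⟨hq, hj, hτ, hw⟩)
    · exact ⟨_, hq, _, hj, .inl (.inl ⟨rfl, rfl⟩)⟩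
    · exact ⟨_, hq, _, hj, .inl (.inr (.inl ⟨rfl, rfl⟩))⟩
    · exact ⟨_, hq, _, hj, .inl (.inr (.inr ⟨rfl, rfl⟩))⟩
    · exact ⟨_, hq, _, hj, .inr ⟨_, hτ, .inl ⟨rfl, rfl⟩⟩⟩
    · exact ⟨_, hq, _, hj, .inr ⟨_, hτ, .inr ⟨_, hw, rfl, rfl⟩⟩⟩

theorem mem_coverVertices {J K u : BinTree} :
    u ∈ (coverVertices J K).toList ↔ ∃ q ∈ K.toList,
      (∃ j ∈ J.toList, u = triVertex 1 q j ∨ u = triVertex 2 q j ∨ u = triVertex 3 q j) ∨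
      ∃ τ ∈ q.toList, (∃ w ∈ τ.toList, u = varVertex w) ∨
        ∃ j ∈ J.toList, u = termVertex τ q j := by
  simp only [coverVertices, mem_collect, toList_revAppend, List.mem_append, List.mem_reverse,
    toList_node, toList_nil, List.mem_cons, List.not_mem_nil, or_false]

/-- Away from the vertices with tag `1` only edges between tags `2` and `3` and between tags `4` and
`0` are left, and these respect the two-colouring by `{2, 4}` and `{0, 3}`. -/
theorem CoverEdge.tri_or_bipartite {J K u v : BinTree} (h : CoverEdge J K u v) :
    (∃ q ∈ K.toList, ∃ j ∈ J.toList, triVertex 1 q j = u ∨ triVertex 1 q j = v) ∨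
      ((u.left = ofNat 2 ∨ u.left = ofNat 4) ↔ ¬ (v.left = ofNat 2 ∨ v.left = ofNat 4)) := by
  rcases h with ⟨hq, hj⟩ | ⟨hq, hj⟩ | ⟨hq, hj⟩ | ⟨hq, hj, hτ⟩ | ⟨hq, hj, hτ, hw⟩
  · exact .inl ⟨_, hq, _, hj, .inl rfl⟩
  · right; simp [triVertex, ofNat]
  · exact .inl ⟨_, hq, _, hj, .inr rfl⟩
  · exact .inl ⟨_, hq, _, hj, .inl rfl⟩
  · right; simp [termVertex, varVertex, ofNat]

/-- A triangle has no two-colouring, so one of its corners is exceptional in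
`CoverEdge.tri_or_bipartite`. No classification of the triangles is needed. -/
theorem CoverEdge.exists_tri {J K y a b : BinTree}
    (h₁ : CoverEdge J K y a ∨ CoverEdge J K a y) (h₂ : CoverEdge J K a b ∨ CoverEdge J K b a)
    (h₃ : CoverEdge J K y b ∨ CoverEdge J K b y) :
    ∃ q ∈ K.toList, ∃ j ∈ J.toList,
      triVertex 1 q j = b ∨ triVertex 1 q j = a ∨ triVertex 1 q j = y := by
  obtain ⟨col, key⟩ : ∃ col : BinTree → Prop, ∀ u v : BinTree,
      CoverEdge J K u v ∨ CoverEdge J K v u →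
      (∃ q ∈ K.toList, ∃ j ∈ J.toList, triVertex 1 q j = u ∨ triVertex 1 q j = v) ∨
        (col u ↔ ¬ col v) := by
    refine ⟨fun u => u.left = ofNat 2 ∨ u.left = ofNat 4, ?_⟩
    rintro u v (h | h)
    · exact h.tri_or_bipartite
    · rcases h.tri_or_bipartite with ⟨q, hq, j, hj, h⟩ | h
      · exact .inl ⟨q, hq, j, hj, h.symm⟩
      · exact .inr (iff_not_comm.1 h)
  rcases key _ _ h₁ with ⟨q, hq, j, hj, h | h⟩ | e₁
  · exact ⟨q, hq, j, hj, .inr (.inr h)⟩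
  · exact ⟨q, hq, j, hj, .inr (.inl h)⟩
  rcases key _ _ h₂ with ⟨q, hq, j, hj, h | h⟩ | e₂
  · exact ⟨q, hq, j, hj, .inr (.inl h)⟩
  · exact ⟨q, hq, j, hj, .inl h⟩
  rcases key _ _ h₃ with ⟨q, hq, j, hj, h | h⟩ | e₃
  · exact ⟨q, hq, j, hj, .inr (.inr h)⟩
  · exact ⟨q, hq, j, hj, .inl h⟩
  clear h₁ h₂ h₃
  tauto

theorem CoverEdge.of_term {J K v τ q j : BinTree}
    (h : CoverEdge J K v (termVertex τ q j) ∨ CoverEdge J K (termVertex τ q j) v) :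
    v = triVertex 1 q j ∨ ∃ w ∈ τ.toList, v = varVertex w := by
  generalize hu : termVertex τ q j = u at h
  rcases h with h | h <;> rcases h with ⟨hq, hj⟩ | ⟨hq, hj⟩ | ⟨hq, hj⟩ | ⟨hq, hj, hτ⟩ |
    ⟨hq, hj, hτ, hw⟩ <;> simp [termVertex, triVertex, varVertex, ofNat] at hu ⊢
  · obtain ⟨rfl, rfl, rfl⟩ := hu; simp
  · obtain ⟨rfl, rfl, rfl⟩ := hu; exact hw

/-- The cases `i = 2` and `i = 3` are vacuous: only the first corner has neighbours outside of its
triangle. -/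
theorem CoverEdge.of_tri {J K c q j : BinTree} {i : ℕ} (hi : i = 1 ∨ i = 2 ∨ i = 3)
    (hc : c ≠ triVertex 1 q j ∧ c ≠ triVertex 2 q j ∧ c ≠ triVertex 3 q j)
    (h : CoverEdge J K c (triVertex i q j) ∨ CoverEdge J K (triVertex i q j) c) :
    ∃ τ ∈ q.toList, c = termVertex τ q j := by
  generalize hu : triVertex i q j = u at h
  rcases hi with rfl | rfl | rfl <;> rcases h with h | h <;>
    rcases h with ⟨hq, hj⟩ | ⟨hq, hj⟩ | ⟨hq, hj⟩ | ⟨hq, hj, hτ⟩ | ⟨hq, hj, hτ, hw⟩ <;>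
    simp [termVertex, triVertex, varVertex, ofNat] at hu hc ⊢ <;> grind

/-- A removed set of size at most `k` spares the triangle of some copy of each clause. The vertex
that the sentence demands for this triangle is a term vertex of that copy, and all its variables
must have been removed. Conversely, once the variables in `C` are removed, the vertex of a satisfied
term keeps a single neighbour. -/
theorem removable_coverGraph {J K : BinTree} {k : ℕ} (hJ : J.toList.Nodup)
    (hk : k < J.toList.length) :
    VertexRemovable triangleSentence (codedGraph (coverGraph J K)) k ↔
      ∃ C : Finset BinTree, C.card ≤ k ∧
        ∀ q ∈ K.toList, ∃ τ ∈ q.toList, ∀ w ∈ τ.toList, w ∈ C := by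
  classical
  have adj : ∀ u v : CodedUniverse (coverGraph J K), (codedGraph (coverGraph J K)).Adj u v ↔
      u ≠ v ∧ (CoverEdge J K u.1 v.1 ∨ CoverEdge J K v.1 u.1) := fun u v => by
    show _ ∧ (_ ∈ (coverEdges J K).toList ∨ _ ∈ (coverEdges J K).toList) ↔ _
    rw [mem_coverEdges, mem_coverEdges]
  have mem : ∀ u, u ∈ (coverGraph J K).left.toList ↔ u ∈ (coverVertices J K).toList :=
    fun u => Iff.rfl
  simp only [VertexRemovable, graphModels_triangleSentence]
  constructor
  · rintro ⟨S, hS, h⟩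
    -- `right` sends `varVertex w` to `w`; the values at other removed vertices do no harm.
    refine ⟨S.image fun u => u.1.right, Finset.card_image_le.trans hS, fun q hq => ?_⟩
    -- `right.left` reads off the copy of a triangle vertex; its at most `k` values on `S` cannot
    -- exhaust `J`.
    obtain ⟨j, hj, hjS⟩ : ∃ j ∈ J.toList.toFinset, j ∉ S.image fun u => u.1.right.left := by
      by_contra! hcon
      have h1 := Finset.card_le_card (show J.toList.toFinset ⊆ _ from hcon)
      rw [List.toFinset_card_of_nodup hJ] at h1
      have h2 := Finset.card_image_le (s := S) (f := fun u => u.1.right.left)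
      omega
    rw [List.mem_toFinset] at hj
    have htri : ∀ i, i = 1 ∨ i = 2 ∨ i = 3 → triVertex i q j ∈ (coverGraph J K).left.toList := by
      intro i hi
      rw [mem, mem_coverVertices]
      exact ⟨q, hq, .inl ⟨j, hj, by rcases hi with rfl | rfl | rfl <;> simp⟩⟩
    have hnot : ∀ i hi, (⟨triVertex i q j, htri i hi⟩ : CodedUniverse (coverGraph J K)) ∉ S :=
      fun i hi hs => hjS (Finset.mem_image.2 ⟨_, hs, rfl⟩)
    let t : ∀ i, i = 1 ∨ i = 2 ∨ i = 3 → {v : CodedUniverse (coverGraph J K) // v ∉ S} :=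
      fun i hi => ⟨⟨triVertex i q j, htri i hi⟩, hnot i hi⟩
    obtain ⟨c, hc, hne, hall⟩ := h (t 1 (by simp)) (t 2 (by simp)) (t 3 (by simp))
      ((adj _ _).2 ⟨by simp [t, triVertex, ofNat], .inl (.tri₁₂ hq hj)⟩)
      ((adj _ _).2 ⟨by simp [t, triVertex, ofNat], .inl (.tri₂₃ hq hj)⟩)
      ((adj _ _).2 ⟨by simp [t, triVertex, ofNat], .inr (.tri₃₁ hq hj)⟩)
    have hne' : c.1.1 ≠ triVertex 1 q j ∧ c.1.1 ≠ triVertex 2 q j ∧ c.1.1 ≠ triVertex 3 q j :=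
      ⟨fun e => hne.2.2 (Subtype.ext (Subtype.ext e)), fun e => hne.2.1 (Subtype.ext (Subtype.ext e)),
        fun e => hne.1 (Subtype.ext (Subtype.ext e))⟩
    obtain ⟨τ, hτ, hcτ⟩ : ∃ τ ∈ q.toList, c.1.1 = termVertex τ q j := by
      rcases hc with hc | hc | hc
      · exact CoverEdge.of_tri (i := 3) (by simp) hne' ((adj _ _).1 hc).2
      · exact CoverEdge.of_tri (i := 2) (by simp) hne' ((adj _ _).1 hc).2
      · exact CoverEdge.of_tri (i := 1) (by simp) hne' ((adj _ _).1 hc).2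
    refine ⟨τ, hτ, fun w hw => ?_⟩
    by_contra hwS
    have hwV : varVertex w ∈ (coverGraph J K).left.toList := by
      rw [mem, mem_coverVertices]
      exact ⟨q, hq, .inr ⟨τ, hτ, .inl ⟨w, hw, rfl⟩⟩⟩
    have hwS' : (⟨varVertex w, hwV⟩ : CodedUniverse (coverGraph J K)) ∉ S :=
      fun hs => hwS (Finset.mem_image.2 ⟨_, hs, rfl⟩)
    have := hall ⟨⟨varVertex w, hwV⟩, hwS'⟩ ((adj _ _).2 ⟨fun e => ?_, .inr ?_⟩)
    · rcases this with e | e | e <;>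
        simpa [t, varVertex, triVertex, ofNat] using congrArg (fun v => v.1.1) e
    · have : varVertex w = c.1.1 := congrArg Subtype.val e
      rw [hcτ] at this
      simp [varVertex, termVertex, ofNat] at this
    · show CoverEdge J K c.1.1 _
      rw [hcτ]
      exact .term hq hj hτ hw
  · rintro ⟨C, hC, h⟩
    refine ⟨(C.image varVertex).subtype _, ?_, ?_⟩
    · rw [Finset.card_subtype]
      exact (Finset.card_filter_le _ _).trans (Finset.card_image_le.trans hC)
    rintro y a b h₁ h₂ h₃
    obtain ⟨q, hq, j, hj, htri⟩ := CoverEdge.exists_tri ((adj _ _).1 h₁).2 ((adj _ _).1 h₂).2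
      ((adj _ _).1 h₃).2
    obtain ⟨τ, hτ, hw⟩ := h q hq
    have hcV : termVertex τ q j ∈ (coverGraph J K).left.toList := by
      rw [mem, mem_coverVertices]
      exact ⟨q, hq, .inr ⟨τ, hτ, .inr ⟨j, hj, rfl⟩⟩⟩
    have hcS : (⟨termVertex τ q j, hcV⟩ : CodedUniverse (coverGraph J K)) ∉
        (C.image varVertex).subtype (· ∈ (coverGraph J K).left.toList) := by
      simp [Finset.mem_subtype, termVertex, varVertex, ofNat]
    have htri' : ∀ x : CodedUniverse (coverGraph J K), triVertex 1 q j = x.1 →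
        (codedGraph (coverGraph J K)).Adj ⟨termVertex τ q j, hcV⟩ x := fun x hx =>
      (adj _ _).2 ⟨fun e => by
        have := hx.trans (congrArg Subtype.val e).symm
        simp [triVertex, termVertex, ofNat] at this, .inr (hx ▸ .clause hq hj hτ)⟩
    have hnb : ∀ v : CodedUniverse (coverGraph J K),
        v ∉ (C.image varVertex).subtype (· ∈ (coverGraph J K).left.toList) →
        (codedGraph (coverGraph J K)).Adj v ⟨termVertex τ q j, hcV⟩ → triVertex 1 q j = v.1 := by
      intro v hvS hv
      rcases CoverEdge.of_term ((adj _ _).1 hv).2 with e | ⟨w, hwτ, e⟩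
      · exact e.symm
      · refine absurd ?_ hvS
        rw [Finset.mem_subtype, e]
        exact Finset.mem_image_of_mem _ (hw w hwτ)
    refine ⟨⟨⟨termVertex τ q j, hcV⟩, hcS⟩, ?_, ⟨?_, ?_, ?_⟩, fun v hv => ?_⟩
    · rcases htri with h | h | h
      · exact .inl (htri' _ h)
      · exact .inr (.inl (htri' _ h))
      · exact .inr (.inr (htri' _ h))
    -- If the term vertex were a corner, the other two corners would be two distinct neighbours of
    -- it, but only `triVertex 1 q j` is left.
    · rintro rfl
      exact h₁.ne (Subtype.ext (Subtype.ext ((hnb _ y.2 h₃).symm.trans (hnb _ a.2 h₂))))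
    · rintro rfl
      exact h₃.ne (Subtype.ext (Subtype.ext ((hnb _ y.2 h₁).symm.trans (hnb _ b.2 h₂.symm))))
    · rintro rfl
      exact h₂.ne (Subtype.ext (Subtype.ext ((hnb _ a.2 h₁.symm).symm.trans (hnb _ b.2 h₃.symm))))
    · have hv := hnb _ v.2 hv
      rcases htri with h | h | h
      · exact .inl (Subtype.ext (Subtype.ext (hv.symm.trans h)))
      · exact .inr (.inl (Subtype.ext (Subtype.ext (hv.symm.trans h))))
      · exact .inr (.inr (Subtype.ext (Subtype.ext (hv.symm.trans h))))

end BinTree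

theorem PolyTime.coverGraph {J K : BinTree → BinTree} (hJ : PolyTime J) (hK : PolyTime K) :
    PolyTime fun x => BinTree.coverGraph (J x) (K x) := by
  have hid := PolyTime.id
  have tri : ∀ i {q j : BinTree → BinTree}, PolyTime q → PolyTime j →
      PolyTime fun x => BinTree.triVertex i (q x) (j x) :=
    fun i _ _ hq hj => (PolyTime.const _).node (hj.node hq)
  have term : ∀ {τ q j : BinTree → BinTree}, PolyTime τ → PolyTime q → PolyTime j →
      PolyTime fun x => BinTree.termVertex (τ x) (q x) (j x) :=
    fun hτ hq hj => (PolyTime.const _).node (hτ.node (hj.node hq))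
  have var : ∀ {w : BinTree → BinTree}, PolyTime w → PolyTime fun x => BinTree.varVertex (w x) :=
    fun hw => PolyTime.nil.node hw
  have hJ' := hJ.comp hid.left
  refine .node (.collect (.revAppend (.collect ?_ hJ')
      (.collect (.revAppend (.collect ?_ hid.right) (.collect ?_ (hJ.comp hid.left.left)))
        hid.right)) hK)
    (.collect (.collect (.revAppend ?_ (.collect (.node ?_ (.collect ?_ hid.right)) hid.left.right))
      hJ') hK)
  · exact (tri 1 hid.left.right hid.right).node ((tri 2 hid.left.right hid.right).node
      ((tri 3 hid.left.right hid.right).node .nil))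
  · exact (var hid.right).node .nil
  · exact (term hid.left.right hid.left.left.right hid.right).node .nil
  · exact ((tri 1 hid.left.right hid.right).node (tri 2 hid.left.right hid.right)).node
      (((tri 2 hid.left.right hid.right).node (tri 3 hid.left.right hid.right)).node
        (((tri 3 hid.left.right hid.right).node (tri 1 hid.left.right hid.right)).node .nil))
  · exact (tri 1 hid.left.left.right hid.left.right).node
      (term hid.right hid.left.left.right hid.left.right)
  · exact ((term hid.left.right hid.left.left.left.right hid.left.left.right).node
      (var hid.right)).node .nil

instance : Inhabited BinTree := ⟨BinTree.nil⟩

/-! ### Subsets of a list as paths through its suffixes -/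

/-- A chain of suffixes of the list `L`; its `n` steps select the members `b i` of `L` and skip all
other members. -/
structure SelPath (n : ℕ) (L : List BinTree) (p : ℕ → List BinTree) (b : ℕ → BinTree) : Prop where
  zero : p 0 = []
  top : p n = L
  step : ∀ i < n, b i :: p i <:+ p (i + 1)

namespace SelPath

variable {n : ℕ} {L : List BinTree} {p : ℕ → List BinTree} {b : ℕ → BinTree}

theorem suffix (h : SelPath n L p b) {i j : ℕ} (hij : i ≤ j) (hj : j ≤ n) : p i <:+ p j := by
  induction j, hij using Nat.le_induction with
  | base => exact List.suffix_refl _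
  | succ j hij ih =>
    exact ((ih (by omega)).trans (List.suffix_cons _ _)).trans (h.step j (by omega))

theorem suffix_top (h : SelPath n L p b) {i : ℕ} (hi : i ≤ n) : p i <:+ L :=
  h.top ▸ h.suffix hi le_rfl

theorem mem (h : SelPath n L p b) {i : ℕ} (hi : i < n) : b i ∈ L :=
  (h.suffix_top hi).subset ((h.step i hi).subset (by simp))

/-- On the way down from `L` to `[]` every member drops out at some step, either as its selected
head or among the entries it jumps over. -/
theorem selected_or_skipped (h : SelPath n L p b) {t : BinTree} (ht : t ∈ L) :
    (∃ i < n, b i = t) ∨ ∃ i < n, t ∈ p (i + 1) ∧ t ∉ b i :: p i := by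
  suffices H : ∀ j ≤ n, t ∈ p j →
      (∃ i < n, b i = t) ∨ ∃ i < n, t ∈ p (i + 1) ∧ t ∉ b i :: p i from H n le_rfl (h.top ▸ ht)
  intro j
  induction j with
  | zero => intro _ ht; simp [h.zero] at ht
  | succ j ih =>
    intro hj ht
    by_cases h1 : t ∈ b j :: p j
    · rcases List.mem_cons.1 h1 with rfl | h1
      · exact .inl ⟨j, hj, rfl⟩
      · exact ih (by omega) h1
    · exact .inr ⟨j, hj, ht, h1⟩

theorem notMem (h : SelPath n L p b) (hL : L.Nodup) {i j : ℕ} (hij : i ≤ j) (hj : j < n) :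
    b j ∉ p i := fun hm =>
  (List.nodup_cons.1 (((h.step j hj).trans (h.suffix_top hj)).sublist.nodup hL)).1
    ((h.suffix hij hj.le).subset hm)

/-- With `selected_or_skipped` this makes "skipped by some step" the exact complement of "selected
by some step", so non-membership can be certified without negation. -/
theorem not_skipped (h : SelPath n L p b) (hL : L.Nodup) {i j : ℕ} (hi : i < n) (hj : j < n)
    (h₁ : b j ∈ p (i + 1)) (h₂ : b j ∉ b i :: p i) : False := by
  rcases lt_trichotomy i j with hij | rfl | hij
  · exact h.notMem hL hij hj h₁
  · simp at h₂
  · exact h₂ (List.mem_cons_of_mem _ ((h.suffix hij hi.le).subset ((h.step j hj).subset (by simp))))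

theorem injective (h : SelPath n L p b) (hL : L.Nodup) {i j : ℕ} (hi : i < n) (hj : j < n)
    (e : b i = b j) : i = j := by
  by_contra hne
  wlog hij : i < j generalizing i j
  · exact this hj hi e.symm (Ne.symm hne) (by omega)
  · exact h.notMem hL hij hj (e ▸ (h.step i hi).subset (by simp))

/-- Since `p 0 = []`, step `0` selects the very last entry; a sentinel placed there lies on every
path. -/
theorem first_eq (h : SelPath n L p b) (hn : 0 < n) {L' : List BinTree} {z : BinTree}
    (hL : L = L' ++ [z]) : b 0 = z := by
  have h1 : [b 0] <:+ L := by
    have := (h.step 0 hn).trans (h.suffix_top hn)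
    rwa [h.zero] at this
  obtain ⟨t, ht⟩ := h1
  rw [hL] at ht
  simpa using (List.append_inj' ht rfl).2

end SelPath

/-- The list is built from its end, where the path has its level `0`. A new head with `X` becomes
one more step on top; any other head only lengthens the top suffix and is skipped by the topmost
step. -/
theorem exists_selPath (X : BinTree → Prop) [DecidablePred X] (L : List BinTree) {z : BinTree}
    (hz : X z) : ∃ p b, SelPath ((L ++ [z]).filter X).length (L ++ [z]) p b ∧
      (∀ i < ((L ++ [z]).filter X).length, X (b i)) ∧
      ∀ t ∈ L ++ [z], X t → ∃ i < ((L ++ [z]).filter X).length, b i = t := by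
  induction L with
  | nil =>
    have hl : (([] ++ [z]).filter X).length = 1 := by simp [hz]
    rw [hl]
    refine ⟨fun i => if i = 0 then [] else [z], fun _ => z, ⟨rfl, rfl, ?_⟩, fun _ _ => hz, ?_⟩
    · rintro i hi
      obtain rfl : i = 0 := by omega
      simp
    · rintro t ht -
      exact ⟨0, one_pos, (by simpa using ht : t = z).symm⟩
  | cons a L ih =>
    obtain ⟨p, b, h1, h2, h3⟩ := ih
    by_cases ha : X a
    · have hl : ((a :: L ++ [z]).filter X).length = ((L ++ [z]).filter X).length + 1 := by
        simp [ha]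
      rw [hl]
      set n := ((L ++ [z]).filter X).length
      refine ⟨fun i => if i ≤ n then p i else a :: L ++ [z], fun i => if i < n then b i else a,
        ⟨?_, ?_, ?_⟩, ?_, ?_⟩
      · simp [h1.zero]
      · simp
      · intro i hi
        rcases Nat.lt_succ_iff_lt_or_eq.1 hi with hi | rfl
        · simpa [hi, hi.le, Nat.succ_le_of_lt hi] using h1.step i hi
        · simp [h1.top]
      · intro i hi
        by_cases hi' : i < n
        · simpa [hi'] using h2 i hi'
        · simpa [hi'] using ha
      · intro t ht hX
        rcases List.mem_cons.1 ht with rfl | ht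
        · exact ⟨n, by omega, by simp⟩
        · obtain ⟨i, hi, e⟩ := h3 t ht hX
          exact ⟨i, by omega, by simpa [hi] using e⟩
    · have hl : ((a :: L ++ [z]).filter X).length = ((L ++ [z]).filter X).length := by
        simp [ha]
      rw [hl]
      have hn : 0 < ((L ++ [z]).filter X).length :=
        List.length_pos_of_mem (a := z) (by simp [hz])
      set n := ((L ++ [z]).filter X).length
      refine ⟨fun i => if i < n then p i else a :: L ++ [z], b, ⟨?_, ?_, ?_⟩, h2, ?_⟩
      · simp [h1.zero, hn]
      · simp
      · intro i hi
        have hs := h1.step i hi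
        by_cases hi' : i + 1 < n
        · simpa [hi, hi'] using hs
        · have : i + 1 = n := by omega
          rw [this, h1.top] at hs
          simpa [hi, hi'] using hs.trans (List.suffix_cons a _)
      · intro t ht hX
        rcases List.mem_cons.1 ht with rfl | ht
        · exact absurd hX ha
        · exact h3 t ht hX

/-! ### Clauses that express the choice of a path -/

namespace BinTree

/-- The variable for a step in level `i` from the suffix `P` to the suffix `Q`. -/
def stepVar (i : ℕ) (P Q : List BinTree) : BinTree := node (ofNat i) (node (ofList P) (ofList Q))

/-- The list of all variables, for the list `I` of levels and the list `T` of suffixes. -/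
def stepVars (I T : BinTree) : BinTree :=
  collect (fun i => collect (fun P => collect (fun Q => node (node i (node P Q)) nil)
    (select (fun Q => Q.left ∈ P.toList) T)) T) I

/-- The terms that say that the first step in the level `i` starts from `P`. -/
def startClause (i P V : BinTree) : BinTree :=
  collect (fun w => node (node w nil) nil) (select (fun w => w.left = i ∧ w.right.left = P) V)

/-- The terms that say that the last step exhausts the list. -/
def endClause (V : BinTree) : BinTree :=
  collect (fun w => node (node w nil) nil)
    (select (fun w => w.left = nil ∧ w.right.right.right = nil) V)

/-- For every level, the terms that say that the next step starts where this one ends. -/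
def linkClauses (I V : BinTree) : BinTree :=
  collect (fun i => node (collect (fun w => collect (fun w' => node (node w (node w' nil)) nil)
    (select (fun w' => w'.left = i.right ∧ w'.right.left = w.right.right.right) V))
    (select (fun w => w.left = i) V)) nil) (select (fun i => i ≠ nil) I)

/-- The clauses that say that the chosen variables form a path. -/
def pathClauses (i I T : BinTree) : BinTree :=
  node (startClause i T.left (stepVars I T)) (node (endClause (stepVars I T))
    (linkClauses I (stepVars I T)))

/-- The list `A` of terms contains a term with all its variables in `C`. -/
def Satisfied (C : Finset BinTree) (A : BinTree) : Prop :=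
  ∃ τ ∈ A.toList, ∀ w ∈ τ.toList, w ∈ C

/-- In a duplicate-free list, one suffix is contained in another one as soon as its head occurs
there. This is why the filter in `stepVars` tests the head only. -/
theorem mem_stepVars {I T w : BinTree} {k : ℕ} {L : List BinTree} (hL : L.Nodup)
    (hI : ∀ t, t ∈ I.toList ↔ ∃ i ≤ k, t = ofNat i)
    (hT : ∀ t, t ∈ T.toList ↔ ∃ s, s ≠ [] ∧ s <:+ L ∧ t = ofList s) :
    w ∈ (stepVars I T).toList ↔
      ∃ i ≤ k, ∃ P b Q, P <:+ L ∧ b :: Q <:+ P ∧ w = stepVar i P (b :: Q) := by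
  simp only [stepVars, mem_collect, mem_select, hI, hT, toList_node, toList_nil, List.mem_singleton]
  constructor
  · rintro ⟨_, ⟨i, hi, rfl⟩, _, ⟨P, hP, hPL, rfl⟩, _, ⟨⟨_ | ⟨b, Q⟩, hQ, hQL, rfl⟩, hb⟩, rfl⟩
    · simp at hQ
    refine ⟨i, hi, P, b, Q, hPL, ?_, rfl⟩
    simp only [ofList_cons, left_node, toList_ofList] at hb
    rcases List.suffix_or_suffix_of_suffix hQL hPL with h | h
    · exact h
    · rcases List.suffix_cons_iff.1 h with h | h
      · exact h ▸ List.suffix_refl _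
      · exact absurd (h.subset hb) (List.nodup_cons.1 (hQL.sublist.nodup hL)).1
  · rintro ⟨i, hi, P, b, Q, hP, hQ, rfl⟩
    have hb : b ∈ P := hQ.subset (by simp)
    exact ⟨_, ⟨i, hi, rfl⟩, _, ⟨P, List.ne_nil_of_mem hb, hP, rfl⟩, _,
      ⟨⟨_, by simp, hQ.trans hP, rfl⟩, by simpa using hb⟩, rfl⟩

theorem satisfied_startClause {C : Finset BinTree} {i P V : BinTree} :
    Satisfied C (startClause i P V) ↔ ∃ w ∈ C, w ∈ V.toList ∧ w.left = i ∧ w.right.left = P := by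
  simp only [Satisfied, startClause, mem_collect, mem_select, toList_node, toList_nil,
    List.mem_singleton]
  constructor
  · rintro ⟨_, ⟨w, hw, rfl⟩, h⟩
    exact ⟨w, h w (by simp), hw⟩
  · rintro ⟨w, hC, hw⟩
    exact ⟨_, ⟨w, hw, rfl⟩, by simpa using hC⟩

theorem satisfied_endClause {C : Finset BinTree} {V : BinTree} :
    Satisfied C (endClause V) ↔
      ∃ w ∈ C, w ∈ V.toList ∧ w.left = nil ∧ w.right.right.right = nil := by
  simp only [Satisfied, endClause, mem_collect, mem_select, toList_node, toList_nil,
    List.mem_singleton]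
  constructor
  · rintro ⟨_, ⟨w, hw, rfl⟩, h⟩
    exact ⟨w, h w (by simp), hw⟩
  · rintro ⟨w, hC, hw⟩
    exact ⟨_, ⟨w, hw, rfl⟩, by simpa using hC⟩

theorem satisfied_linkClauses {C : Finset BinTree} {I V : BinTree} :
    (∀ q ∈ (linkClauses I V).toList, Satisfied C q) ↔ ∀ i ∈ I.toList, i ≠ nil →
      ∃ w ∈ C, w ∈ V.toList ∧ w.left = i ∧
        ∃ w' ∈ C, w' ∈ V.toList ∧ w'.left = i.right ∧ w'.right.left = w.right.right.right := by
  simp only [Satisfied, linkClauses, mem_collect, mem_select, toList_node, toList_nil,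
    List.mem_singleton]
  constructor
  · intro h i hi hi'
    obtain ⟨_, hτ, hC⟩ := h _ ⟨i, ⟨hi, hi'⟩, rfl⟩
    simp only [mem_collect, mem_select, toList_node, toList_nil, List.mem_singleton] at hτ
    obtain ⟨w, hw, w', hw', rfl⟩ := hτ
    exact ⟨w, hC w (by simp), hw.1, hw.2, w', hC w' (by simp), hw'⟩
  · rintro h _ ⟨i, ⟨hi, hi'⟩, rfl⟩
    obtain ⟨w, hC, hw, hwi, w', hC', hw'⟩ := h i hi hi'
    refine ⟨node w (node w' nil), ?_, by simp [hC, hC']⟩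
    simp only [mem_collect, mem_select, toList_node, toList_nil, List.mem_singleton]
    exact ⟨w, ⟨hw, hwi⟩, w', hw', rfl⟩

variable {I T : BinTree} {k : ℕ} {L : List BinTree}

/-- The clauses demand a chosen variable in each of the `k + 1` levels, and at most `k + 1`
variables are chosen. So there is exactly one per level and no other, and the link clauses can only
be satisfied by consecutive steps that fit together. -/
theorem selPath_of_satisfied (hL : L.Nodup) (hI : ∀ t, t ∈ I.toList ↔ ∃ i ≤ k, t = ofNat i)
    (hT : ∀ t, t ∈ T.toList ↔ ∃ s, s ≠ [] ∧ s <:+ L ∧ t = ofList s) (htop : T.left = ofList L)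
    {C : Finset BinTree} (hC : C.card ≤ k + 1)
    (hsat : ∀ q ∈ (pathClauses (ofNat k) I T).toList, Satisfied C q) :
    ∃ p b, SelPath (k + 1) L p b ∧
      ∀ w, w ∈ C ↔ ∃ i < k + 1, w = stepVar i (p (i + 1)) (b i :: p i) := by
  classical
  simp only [pathClauses, toList_node, List.forall_mem_cons, satisfied_startClause,
    satisfied_endClause, satisfied_linkClauses] at hsat
  obtain ⟨⟨w₁, hw₁, hV₁, hl₁, hs₁⟩, ⟨w₀, hw₀, hV₀, hl₀, hs₀⟩, hlink⟩ := hsat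
  have hlev : ∀ i ≤ k, ∃ w ∈ C, w.left = ofNat i := by
    intro i hi
    rcases hi.eq_or_lt with rfl | hi
    · exact ⟨w₁, hw₁, hl₁⟩
    · obtain ⟨w, -, -, -, w', hw', -, hl, -⟩ := hlink (ofNat (i + 1))
        ((hI _).2 ⟨i + 1, hi, rfl⟩) (by simp [ofNat])
      exact ⟨w', hw', hl⟩
  have hsub : (Finset.range (k + 1)).image ofNat ⊆ C.image left := by
    intro t ht
    obtain ⟨i, hi, rfl⟩ := Finset.mem_image.1 ht
    obtain ⟨w, hw, e⟩ := hlev i (by simpa [Nat.lt_succ_iff] using hi)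
    exact Finset.mem_image.2 ⟨w, hw, e⟩
  have hcard : ((Finset.range (k + 1)).image ofNat).card = k + 1 := by
    rw [Finset.card_image_of_injective _ ofNat_injective, Finset.card_range]
  have hle := Finset.card_image_le (s := C) (f := left)
  have hinj : Set.InjOn left (C : Set BinTree) := by
    rw [← Finset.card_image_iff]
    have := Finset.card_le_card hsub
    omega
  have himg : (Finset.range (k + 1)).image ofNat = C.image left :=
    Finset.eq_of_subset_of_card_le hsub (by omega)
  have hVar : ∀ i ≤ k, ∃ P b Q, P <:+ L ∧ b :: Q <:+ P ∧ stepVar i P (b :: Q) ∈ C := by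
    intro i hi
    obtain ⟨w, hw, hwV, e⟩ : ∃ w ∈ C, w ∈ (stepVars I T).toList ∧ w.left = ofNat i := by
      rcases hi.eq_or_lt with rfl | hi
      · exact ⟨w₁, hw₁, hV₁, hl₁⟩
      · obtain ⟨w, -, -, -, w', hw', hV', hl, -⟩ := hlink (ofNat (i + 1))
          ((hI _).2 ⟨i + 1, hi, rfl⟩) (by simp [ofNat])
        exact ⟨w', hw', hV', hl⟩
    obtain ⟨j, hj, P, b, Q, hP, hQ, rfl⟩ := (mem_stepVars hL hI hT).1 hwV
    obtain rfl : j = i := ofNat_injective e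
    exact ⟨P, b, Q, hP, hQ, hw⟩
  choose! P b Q hP hQ hmem using hVar
  have huniq : ∀ i ≤ k, ∀ w ∈ C, w.left = ofNat i → w = stepVar i (P i) (b i :: Q i) :=
    fun i hi w hw e => hinj hw (hmem i hi) e
  have h0 : Q 0 = [] := by
    rw [huniq 0 (Nat.zero_le _) w₀ hw₀ hl₀] at hs₀
    exact ofList_injective hs₀
  have hk : P k = L := by
    rw [huniq k le_rfl w₁ hw₁ hl₁, htop] at hs₁
    exact ofList_injective hs₁
  have hnext : ∀ i < k, Q (i + 1) = P i := by
    intro i hi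
    obtain ⟨w, hw, -, hl, w', hw', -, hl', e⟩ := hlink (ofNat (i + 1))
      ((hI _).2 ⟨i + 1, hi, rfl⟩) (by simp [ofNat])
    rw [huniq _ hi w hw hl, huniq _ hi.le w' hw' hl'] at e
    exact (ofList_injective e).symm
  -- Step `i` starts from `P i = p (i + 1)` and leaves the tail `Q i = p i`.
  let p : ℕ → List BinTree := fun i => Nat.casesOn i [] P
  have hp : ∀ i ≤ k, p i = Q i := by
    intro i hi
    cases i with
    | zero => exact h0.symm
    | succ i => exact (hnext i hi).symm
  refine ⟨p, b, ⟨rfl, hk, fun i hi => ?_⟩, fun w => ⟨fun hw => ?_, ?_⟩⟩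
  · rw [hp i (by omega)]
    exact hQ i (by omega)
  · have : w.left ∈ C.image left := Finset.mem_image_of_mem _ hw
    rw [← himg] at this
    obtain ⟨i, hi, e⟩ := Finset.mem_image.1 this
    have hi := Finset.mem_range.1 hi
    refine ⟨i, hi, ?_⟩
    rw [hp i (by omega)]
    exact huniq i (by omega) w hw e.symm
  · rintro ⟨i, hi, rfl⟩
    rw [hp i (by omega)]
    exact hmem i (by omega)

theorem satisfied_of_selPath (hL : L.Nodup) (hI : ∀ t, t ∈ I.toList ↔ ∃ i ≤ k, t = ofNat i)
    (hT : ∀ t, t ∈ T.toList ↔ ∃ s, s ≠ [] ∧ s <:+ L ∧ t = ofList s) (htop : T.left = ofList L)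
    {C : Finset BinTree} {p : ℕ → List BinTree} {b : ℕ → BinTree} (hp : SelPath (k + 1) L p b)
    (hC : ∀ i < k + 1, stepVar i (p (i + 1)) (b i :: p i) ∈ C) :
    ∀ q ∈ (pathClauses (ofNat k) I T).toList, Satisfied C q := by
  have hV : ∀ i < k + 1, stepVar i (p (i + 1)) (b i :: p i) ∈ (stepVars I T).toList :=
    fun i hi => (mem_stepVars hL hI hT).2
      ⟨i, by omega, _, _, _, hp.suffix_top hi, hp.step i hi, rfl⟩
  simp only [pathClauses, toList_node, List.forall_mem_cons, satisfied_startClause,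
    satisfied_endClause, satisfied_linkClauses]
  refine ⟨⟨_, hC k (by omega), hV k (by omega), rfl, ?_⟩,
    ⟨_, hC 0 (by omega), hV 0 (by omega), rfl, ?_⟩, ?_⟩
  · rw [htop, ← hp.top]; rfl
  · rw [hp.zero]; rfl
  · intro t ht hne
    obtain ⟨i, hi, rfl⟩ := (hI t).1 ht
    cases i with
    | zero => exact absurd rfl hne
    | succ i =>
      exact ⟨_, hC (i + 1) (by omega), hV (i + 1) (by omega), rfl, _, hC i (by omega),
        hV i (by omega), rfl, rfl⟩

end BinTree

theorem PolyTime.stepVars {I T : BinTree → BinTree} (hI : PolyTime I) (hT : PolyTime T) :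
    PolyTime fun x => BinTree.stepVars (I x) (T x) := by
  have hid := PolyTime.id
  refine .collect (.collect (.collect ?_ (.select ?_ (hT.comp hid.left.left))) (hT.comp hid.left)) hI
  · exact (hid.left.left.right.node (hid.left.right.node hid.right)).node .nil
  · exact .mem hid.right.left hid.left.right

theorem PolyTime.pathClauses {i I T : BinTree → BinTree} (hi : PolyTime i) (hI : PolyTime I)
    (hT : PolyTime T) : PolyTime fun x => BinTree.pathClauses (i x) (I x) (T x) := by
  have hid := PolyTime.id
  have hV := hI.stepVars hT
  refine .node (.collect ((hid.right.node .nil).node .nil) (.select (.and ?_ ?_) hV))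
    (.node (.collect ((hid.right.node .nil).node .nil) (.select (.and ?_ ?_) hV))
      (.collect (.node (.collect (.collect ?_ (.select (.and ?_ ?_) (hV.comp hid.left.left)))
        (.select ?_ (hV.comp hid.left))) .nil) (.select ?_ hI)))
  · exact .eq hid.right.left (hi.comp hid.left)
  · exact .eq hid.right.right.left (hT.comp hid.left).left
  · exact .eq hid.right.left .nil
  · exact .eq hid.right.right.right.right .nil
  · exact (hid.left.right.node (hid.right.node .nil)).node .nil
  · exact .eq hid.right.left hid.left.left.right.right
  · exact .eq hid.right.right.left hid.left.right.right.right.right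
  · exact .eq hid.right.left hid.left.right
  · exact (PolyDec.eq hid.right .nil).not

/-! ### Relativized semantics on trees -/

namespace FOFormula

variable {ι : Type} {ar : ι → ℕ}

/-- Truth of a formula under an assignment of trees, with the quantifiers relativized to `D`. -/
def HoldsOn (D : BinTree → Prop) (I : (R : ι) → (Fin (ar R) → BinTree) → Prop) :
    {n : ℕ} → FOFormula ar n → (Fin n → BinTree) → Prop
  | _, eq x y, v => v x = v y
  | _, rel R x, v => I R (fun i => v (x i))
  | _, not φ, v => ¬ φ.HoldsOn D I v
  | _, and φ ψ, v => φ.HoldsOn D I v ∧ ψ.HoldsOn D I v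
  | _, or φ ψ, v => φ.HoldsOn D I v ∨ ψ.HoldsOn D I v
  | _, imp φ ψ, v => φ.HoldsOn D I v → ψ.HoldsOn D I v
  | _, iff φ ψ, v => (φ.HoldsOn D I v ↔ ψ.HoldsOn D I v)
  | _, all φ, v => ∀ a, D a → φ.HoldsOn D I (Fin.cons a v : Fin _ → BinTree)
  | _, ex φ, v => ∃ a, D a ∧ φ.HoldsOn D I (Fin.cons a v : Fin _ → BinTree)

/-- All universes become sets of trees. In particular the removal of vertices changes only `D`, and
no induced subgraph has to be constructed. -/
theorem holds_iff_holdsOn {U : Type} {J : (R : ι) → (Fin (ar R) → U) → Prop}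
    {D : BinTree → Prop} {I : (R : ι) → (Fin (ar R) → BinTree) → Prop} {f : U → BinTree}
    (hf : Function.Injective f) (hD : ∀ t, D t ↔ ∃ u, f u = t)
    (hI : ∀ R v, J R v ↔ I R fun i => f (v i)) {n : ℕ} (φ : FOFormula ar n) (v : Fin n → U) :
    φ.Holds J v ↔ φ.HoldsOn D I (f ∘ v) := by
  induction φ with
  | eq x y => exact hf.eq_iff.symm
  | rel R x => exact hI R _
  | not φ ih => exact not_congr (ih v)
  | and φ ψ ih₁ ih₂ => exact and_congr (ih₁ v) (ih₂ v)
  | or φ ψ ih₁ ih₂ => exact or_congr (ih₁ v) (ih₂ v)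
  | imp φ ψ ih₁ ih₂ => exact imp_congr (ih₁ v) (ih₂ v)
  | iff φ ψ ih₁ ih₂ => exact iff_congr (ih₁ v) (ih₂ v)
  | all φ ih =>
    have e : ∀ a, (Fin.cons (f a) (f ∘ v) : Fin _ → BinTree) = f ∘ (Fin.cons a v : Fin _ → U) :=
      fun a => (Fin.comp_cons f a v).symm
    simp only [Holds, HoldsOn, hD, forall_exists_index, forall_apply_eq_imp_iff, e, ih]
  | ex φ ih =>
    have e : ∀ a, (Fin.cons (f a) (f ∘ v) : Fin _ → BinTree) = f ∘ (Fin.cons a v : Fin _ → U) :=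
      fun a => (Fin.comp_cons f a v).symm
    simp only [Holds, HoldsOn, hD, exists_exists_eq_and, e, ih]

end FOFormula

/-! ### Access to lists -/

namespace BinTree

/-- The `i`-th entry of a list, and `nil` if there is none. -/
def nth : ℕ → BinTree → BinTree
  | 0, t => t.left
  | i + 1, t => nth i t.right

theorem nth_eq_getD : ∀ (i : ℕ) (t : BinTree), nth i t = t.toList.getD i nil
  | 0, nil => rfl
  | 0, node _ _ => rfl
  | i + 1, nil => by simpa [nth] using nth_eq_getD i nil
  | i + 1, node _ b => by simpa [nth] using nth_eq_getD i b

theorem nth_ofFn {n : ℕ} (v : Fin n → BinTree) (i : Fin n) : nth i (ofList (List.ofFn v)) = v i := by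
  rw [nth_eq_getD, toList_ofList, List.getD_eq_getElem _ _ (by simp)]
  simp

theorem ofList_ofFn_cons {n : ℕ} (a : BinTree) (v : Fin n → BinTree) :
    ofList (List.ofFn (Fin.cons a v : Fin (n + 1) → BinTree)) = node a (ofList (List.ofFn v)) := by
  simp [List.ofFn_succ]

end BinTree

theorem PolyTime.nth {f : BinTree → BinTree} (hf : PolyTime f) (i : ℕ) :
    PolyTime fun x => BinTree.nth i (f x) := by
  induction i generalizing f with
  | zero => exact hf.left
  | succ i ih => exact ih hf.right

theorem PolyTime.ofFn {m : ℕ} {g : Fin m → BinTree → BinTree} (hg : ∀ j, PolyTime (g j)) :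
    PolyTime fun x => BinTree.ofList (List.ofFn fun j => g j x) := by
  induction m with
  | zero => exact PolyTime.nil
  | succ m ih =>
    have := (hg 0).node (ih fun j => hg j.succ)
    simpa only [List.ofFn_succ, BinTree.ofList_cons] using this

/-! ### The lists of tuples and of suffixes -/

namespace BinTree

/-- The list of the `r`-tuples of members of the list `U`. -/
def tuples (U : BinTree) : ℕ → BinTree
  | 0 => node nil nil
  | r + 1 => collect (fun u => collect (fun t => node (node u t) nil) (tuples U r)) U

theorem mem_tuples {U t : BinTree} {r : ℕ} : t ∈ (tuples U r).toList ↔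
    ∃ v : Fin r → BinTree, (∀ j, v j ∈ U.toList) ∧ t = ofList (List.ofFn v) := by
  induction r generalizing t with
  | zero => simp [tuples]
  | succ r ih =>
    simp only [tuples, mem_collect, ih, toList_node, toList_nil, List.mem_singleton]
    constructor
    · rintro ⟨u, hu, _, ⟨v, hv, rfl⟩, rfl⟩
      refine ⟨Fin.cons u v, fun j => ?_, (ofList_ofFn_cons u v).symm⟩
      refine Fin.cases ?_ (fun j => ?_) j
      · simpa using hu
      · simpa using hv j
    · rintro ⟨v, hv, rfl⟩
      exact ⟨v 0, hv 0, _, ⟨fun j => v j.succ, fun j => hv j.succ, rfl⟩, by simp [List.ofFn_succ]⟩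

/-- Extends a list `s` of lists by adding, for every member `u` of `l`, the list that starts with
`u` and continues with the present first member of `s`; members `u` with `P u s` are left out. -/
def growTails (P : BinTree → BinTree → Prop) [∀ u s, Decidable (P u s)] (s l : BinTree) : BinTree :=
  l.toList.foldl (fun s u => if P u s then s else node (node u s.left) s) s

theorem size_foldl_growTails_le (P : BinTree → BinTree → Prop) [∀ u s, Decidable (P u s)]
    (l : List BinTree) (s : BinTree) :
    (l.foldl (fun s u => if P u s then s else node (node u s.left) s) s).size ≤
      s.size + l.length * (s.left.size + (ofList l).size + 1) := by
  induction l generalizing s with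
  | nil => simp
  | cons u l ih =>
    have h1 := ih s
    have h2 := ih (node (node u s.left) s)
    have h3 := (ofList l).size_pos
    have h4 := u.size_pos
    by_cases h : P u s
    · simp only [List.foldl_cons, h, if_true, List.length_cons, ofList_cons, size_node]
      nlinarith
    · simp only [List.foldl_cons, h, if_false, List.length_cons, ofList_cons, size_node, left_node]
        at h2 ⊢
      nlinarith

/-- `L` consists of the members of `l` without repetition, later ones in front. The accumulator
holds all nonempty suffixes, the longest first, so a repetition is recognized by looking into its
head. -/
theorem growTails_dedup (l : BinTree) {z : BinTree} (hz : z ∉ l.toList) :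
    ∃ L : List BinTree, (L ++ [z]).Nodup ∧ (∀ t, t ∈ L ↔ t ∈ l.toList) ∧
      (growTails (fun u s => u ∈ s.left.toList) (node (node z nil) nil) l).left =
        ofList (L ++ [z]) ∧
      ∀ t, t ∈ (growTails (fun u s => u ∈ s.left.toList) (node (node z nil) nil) l).toList ↔
        ∃ s, s ≠ [] ∧ s <:+ L ++ [z] ∧ t = ofList s := by
  suffices H : ∀ (l : List BinTree) (s : BinTree) (L₀ : List BinTree), z ∉ l →
      (L₀ ++ [z]).Nodup → s.left = ofList (L₀ ++ [z]) →
      (∀ t, t ∈ s.toList ↔ ∃ s, s ≠ [] ∧ s <:+ L₀ ++ [z] ∧ t = ofList s) →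
      ∃ L : List BinTree, (L ++ [z]).Nodup ∧ (∀ t, t ∈ L ↔ t ∈ L₀ ∨ t ∈ l) ∧
      (l.foldl (fun s u => if u ∈ s.left.toList then s else node (node u s.left) s) s).left =
        ofList (L ++ [z]) ∧
      ∀ t, t ∈ (l.foldl (fun s u => if u ∈ s.left.toList then s else node (node u s.left) s)
        s).toList ↔ ∃ s, s ≠ [] ∧ s <:+ L ++ [z] ∧ t = ofList s by
    obtain ⟨L, h1, h2, h3, h4⟩ := H l.toList (node (node z nil) nil) [] hz (by simp) (by simp)
      (by
        intro t
        simp only [toList_node, toList_nil, List.mem_singleton, List.nil_append]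
        constructor
        · rintro rfl
          exact ⟨[z], by simp, List.suffix_refl _, by simp⟩
        · rintro ⟨s, hs, hsz, rfl⟩
          rcases List.suffix_cons_iff.1 hsz with rfl | h
          · simp
          · simp_all)
    exact ⟨L, h1, by simpa using h2, h3, h4⟩
  intro l
  induction l with
  | nil => exact fun s L₀ _ h1 h2 h3 => ⟨L₀, h1, by simp, h2, h3⟩
  | cons u l ih =>
    intro s L₀ hz h1 h2 h3
    rw [List.mem_cons, not_or] at hz
    by_cases hu : u ∈ s.left.toList
    · obtain ⟨L, h4, h5, h6⟩ := ih s L₀ hz.2 h1 h2 h3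
      refine ⟨L, h4, fun t => (h5 t).trans ?_, by simpa only [List.foldl_cons, hu, if_true] using h6⟩
      rw [h2, toList_ofList, List.mem_append, List.mem_singleton] at hu
      have hu := hu.resolve_right (Ne.symm hz.1)
      rw [List.mem_cons]
      constructor
      · tauto
      · rintro (h | rfl | h)
        · exact .inl h
        · exact .inl hu
        · exact .inr h
    · have hu' := hu
      rw [h2, toList_ofList] at hu'
      obtain ⟨L, h4, h5, h6⟩ := ih (node (node u s.left) s) (u :: L₀) hz.2
        (List.nodup_cons.2 ⟨hu', h1⟩) (by simp [h2]) (by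
          intro t
          rw [toList_node, List.mem_cons, h3, h2]
          constructor
          · rintro (rfl | ⟨s, hs, hsL, rfl⟩)
            · exact ⟨_, by simp, List.suffix_refl _, by simp⟩
            · exact ⟨s, hs, hsL.trans (List.suffix_cons _ _), rfl⟩
          · rintro ⟨s, hs, hsL, rfl⟩
            rcases List.suffix_cons_iff.1 hsL with rfl | h
            · left; simp
            · exact .inr ⟨s, hs, h, rfl⟩)
      refine ⟨L, h4, fun t => (h5 t).trans ?_, by
        simpa only [List.foldl_cons, hu, if_false] using h6⟩
      simp only [List.mem_cons]
      tauto

/-- The list of the numbers from `k` down to `0`, if `t` codes the number `k`. -/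
def numerals (t : BinTree) : BinTree := growTails (fun _ _ => False) (node nil nil) t

/-- All members of `ofNat k` are `nil`, and putting `nil` in front of a unary number is the
successor. -/
theorem toList_numerals (k : ℕ) :
    (numerals (ofNat k)).toList = ((List.range (k + 1)).map ofNat).reverse := by
  suffices H : ∀ (k j : ℕ) (s : BinTree), s.left = ofNat j →
      s.toList = ((List.range (j + 1)).map ofNat).reverse →
      ((ofNat k).toList.foldl (fun s u => if False then s else node (node u s.left) s) s).toList =
        ((List.range (j + k + 1)).map ofNat).reverse from by
    simpa [numerals, growTails] using H k 0 (node nil nil) rfl rfl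
  intro k
  induction k with
  | zero => exact fun j s _ h => h
  | succ k ih =>
    intro j s h1 h2
    have := ih (j + 1) (node (node nil s.left) s) (by simp [h1, ofNat]) (by
      rw [List.range_succ, List.map_append, List.reverse_append, toList_node, h1, h2]; rfl)
    rw [show j + (k + 1) + 1 = j + 1 + k + 1 by ring, ← this]
    rfl

theorem mem_numerals {k : ℕ} {t : BinTree} :
    t ∈ (numerals (ofNat k)).toList ↔ ∃ i ≤ k, t = ofNat i := by
  simp [toList_numerals, eq_comm]

end BinTree

theorem PolyTime.tuples {U : BinTree → BinTree} (hU : PolyTime U) (r : ℕ) :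
    PolyTime fun x => BinTree.tuples (U x) r := by
  induction r with
  | zero => exact .const _
  | succ r ih => exact .collect (.collect ((PolyTime.id.left.right.node PolyTime.id.right).node .nil)
      (ih.comp PolyTime.id.left)) hU

theorem PolyTime.growTails {P : BinTree → BinTree → Prop} [∀ u s, Decidable (P u s)]
    {s l : BinTree → BinTree} (hP : PolyDec fun z => P z.left z.right) (hs : PolyTime s)
    (hl : PolyTime l) : PolyTime fun x => BinTree.growTails P (s x) (l x) := by
  refine PolyTime.foldl (F := fun _ u s => if P u s then s else .node (.node u s.left) s) ?_ hl hs
    (d := fun x => (s x).size + (l x).size * ((s x).size + (l x).size + 1))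
    (hs.size_bdd.add (hl.size_bdd.mul ((hs.size_bdd.add hl.size_bdd).add (.const 1)))) ?_
  · have h : PolyTime fun z => if P z.left z.right then z.right
        else .node (.node z.left z.right.left) z.right :=
      .ite hP PolyTime.id.right ((PolyTime.id.left.node PolyTime.id.right.left).node
        PolyTime.id.right)
    exact h.comp PolyTime.id.right
  · rintro x l' ⟨l'', h⟩
    refine (BinTree.size_foldl_growTails_le P l' _).trans ?_
    have h1 := BinTree.size_ofList_append l' l''
    have h2 := (BinTree.ofList l'').size_pos
    have h3 := (l x).length_toList_lt_size
    have h4 := (s x).size_left_le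
    rw [h, BinTree.ofList_toList] at h1
    have h5 : l'.length ≤ (l x).toList.length := by rw [← h]; simp
    gcongr
    all_goals omega

theorem PolyTime.numerals {t : BinTree → BinTree} (ht : PolyTime t) :
    PolyTime fun x => BinTree.numerals (t x) :=
  .growTails .false (.const _) ht

/-! ### Positive normal forms -/

namespace BinTree

/-- The list of the unions of a term of `A` and a term of `B`. -/
def product (A B : BinTree) : BinTree :=
  collect (fun σ => collect (fun τ => node (revAppend σ τ) nil) B) A

variable {C : Finset BinTree}

theorem satisfied_truth {P : Prop} [Decidable P] :
    Satisfied C (if P then node nil nil else nil) ↔ P := by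
  by_cases h : P <;> simp [Satisfied, h]

theorem satisfied_revAppend {A B : BinTree} :
    Satisfied C (revAppend A B) ↔ Satisfied C A ∨ Satisfied C B := by
  simp only [Satisfied, toList_revAppend, List.mem_append, List.mem_reverse, or_and_right,
    exists_or]

theorem satisfied_product {A B : BinTree} :
    Satisfied C (product A B) ↔ Satisfied C A ∧ Satisfied C B := by
  simp only [Satisfied, product, mem_collect, toList_node, toList_nil, List.mem_singleton]
  constructor
  · rintro ⟨_, ⟨σ, hσ, τ, hτ, rfl⟩, h⟩
    simp only [toList_revAppend, List.mem_append, List.mem_reverse] at h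
    exact ⟨⟨σ, hσ, fun w hw => h w (.inl hw)⟩, τ, hτ, fun w hw => h w (.inr hw)⟩
  · rintro ⟨⟨σ, hσ, h₁⟩, τ, hτ, h₂⟩
    refine ⟨_, ⟨σ, hσ, τ, hτ, rfl⟩, ?_⟩
    simp only [toList_revAppend, List.mem_append, List.mem_reverse]
    rintro w (hw | hw)
    · exact h₁ w hw
    · exact h₂ w hw

theorem satisfied_collect {F : BinTree → BinTree} {l : BinTree} :
    Satisfied C (collect F l) ↔ ∃ u ∈ l.toList, Satisfied C (F u) := by
  simp only [Satisfied, mem_collect]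
  constructor
  · rintro ⟨τ, ⟨u, hu, hτ⟩, h⟩
    exact ⟨u, hu, τ, hτ, h⟩
  · rintro ⟨u, hu, τ, hτ, h⟩
    exact ⟨τ, ⟨u, hu, hτ⟩, h⟩

theorem satisfied_singletons {V : BinTree} {P : BinTree → Prop} [DecidablePred P] :
    Satisfied C (collect (fun w => node (node w nil) nil) (select P V)) ↔
      ∃ w ∈ C, w ∈ V.toList ∧ P w := by
  simp only [satisfied_collect, mem_select]
  simp only [Satisfied, toList_node, toList_nil, List.mem_singleton, exists_eq_left, forall_eq]
  exact exists_congr fun w => and_comm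

end BinTree

theorem PolyTime.product {A B : BinTree → BinTree} (hA : PolyTime A) (hB : PolyTime B) :
    PolyTime fun x => BinTree.product (A x) (B x) :=
  .collect (.collect ((PolyTime.id.left.right.revAppend PolyTime.id.right).node .nil)
    (hB.comp PolyTime.id.left)) hA

theorem PolyTime.truth {P : BinTree → Prop} [DecidablePred P] (hP : PolyDec P) :
    PolyTime fun x => if P x then .node .nil .nil else .nil :=
  .ite hP (.const _) .nil

/-- The relations of the structure coded by the tree `x`, together with the set `X` of tuples. -/
def structRel {m : ℕ} (ar : Fin m → ℕ) (r : ℕ) (x : BinTree) (X : BinTree → Prop) :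
    (R : Option (Fin m)) → (Fin (arityWith ar r R) → BinTree) → Prop
  | none => fun v => X (BinTree.ofList (List.ofFn v))
  | some i => fun v =>
      BinTree.ofList (List.ofFn v) ∈ (x.right.toList.getD i BinTree.nil).toList

/-- The chosen variables witness for every `r`-tuple whether it belongs to `X` or not. -/
def Certifies (r : ℕ) (x V : BinTree) (C : Finset BinTree) (X : BinTree → Prop) : Prop :=
  ∀ t ∈ (BinTree.tuples x.left r).toList,
    (X t ↔ ∃ w ∈ C, w ∈ V.toList ∧ w.right.right.left = t) ∧
    (¬ X t ↔ ∃ w ∈ C, w ∈ V.toList ∧ t ∈ w.right.left.toList ∧ t ∉ w.right.right.toList)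

/-- The tree that codes the structure `x`, the variables `V` and the assignment `v`. -/
def evalTree {n : ℕ} (c : BinTree) (v : Fin n → BinTree) : BinTree :=
  .node c (BinTree.ofList (List.ofFn v))

theorem evalTree_elim0 (c : BinTree) : evalTree c (Fin.elim0 : Fin 0 → BinTree) = .node c .nil := by
  simp [evalTree]

theorem evalTree_cons {n : ℕ} (c a : BinTree) (v : Fin n → BinTree) :
    evalTree c (Fin.cons a v : Fin (n + 1) → BinTree) =
      .node (evalTree c v).left (.node a (evalTree c v).right) := by
  rw [evalTree, BinTree.ofList_ofFn_cons]; rfl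

namespace FOFormula

open BinTree

variable {m : ℕ} {ar : Fin m → ℕ} {r : ℕ}

/-- Disjunctive normal forms of `φ` and of `¬ φ` are built together, so that negation swaps them.
The formula is fixed, so the products of term lists stay polynomial; `Certifies` keeps all terms
free of negation. -/
theorem exists_normalForms {n : ℕ} (φ : FOFormula (arityWith ar r) n) (hφ : φ.IsQuantifierFree) :
    ∃ f g : BinTree → BinTree, PolyTime f ∧ PolyTime g ∧
      ∀ (x V : BinTree) (C : Finset BinTree) (X : BinTree → Prop) (v : Fin n → BinTree),
        Certifies r x V C X → (∀ i, v i ∈ x.left.toList) →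
        (Satisfied C (f (evalTree (node x V) v)) ↔
          φ.HoldsOn (· ∈ x.left.toList) (structRel ar r x X) v) ∧
        (Satisfied C (g (evalTree (node x V) v)) ↔
          ¬ φ.HoldsOn (· ∈ x.left.toList) (structRel ar r x X) v) := by
  have hid := PolyTime.id
  have hxor : ∀ P Q : Prop, P ∧ ¬ Q ∨ ¬ P ∧ Q ↔ ¬ (P ↔ Q) := fun P Q => by tauto
  induction φ with
  | eq a b =>
    have h := PolyDec.eq (hid.right.nth a) (hid.right.nth b)
    refine ⟨_, _, .truth h, .truth h.not, fun x V C X v _ _ => ?_⟩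
    simp only [satisfied_truth, evalTree, right_node, nth_ofFn]
    exact ⟨Iff.rfl, Iff.rfl⟩
  | rel R a =>
    have ht : PolyTime fun z => ofList (List.ofFn fun j => nth (a j) z.right) :=
      .ofFn fun j => hid.right.nth _
    cases R with
    | none =>
      -- For `X t` the steps that select `t`, for `¬ X t` the steps that skip it, each as a term
      -- with one variable.
      refine ⟨_, _, .collect (F := fun _ w => node (node w nil) nil)
        ((hid.right.node .nil).node .nil)
        (.select (P := fun z w => w.right.right.left = ofList (List.ofFn fun j => nth (a j) z.right))
          (.eq hid.right.right.right.left (ht.comp hid.left)) hid.left.right),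
        .collect (F := fun _ w => node (node w nil) nil)
        ((hid.right.node .nil).node .nil)
        (.select (P := fun z w => ofList (List.ofFn fun j => nth (a j) z.right) ∈
            w.right.left.toList ∧ ofList (List.ofFn fun j => nth (a j) z.right) ∉
            w.right.right.toList)
          (.and (.mem (ht.comp hid.left) hid.right.right.left)
            (PolyDec.mem (ht.comp hid.left) hid.right.right.right).not) hid.left.right), ?_⟩
      intro x V C X v hC hv
      have h := hC (ofList (List.ofFn fun j => v (a j))) (mem_tuples.2 ⟨_, fun j => hv _, rfl⟩)
      simp only [satisfied_singletons, evalTree, right_node, left_node, nth_ofFn]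
      exact ⟨h.1.symm, h.2.symm⟩
    | some i =>
      have h := PolyDec.mem ht (hid.left.left.right.nth i)
      refine ⟨_, _, .truth h, .truth h.not, fun x V C X v _ _ => ?_⟩
      simp only [satisfied_truth, evalTree, right_node, left_node, nth_ofFn]
      rw [nth_eq_getD]
      exact ⟨Iff.rfl, Iff.rfl⟩
  | not φ ih =>
    obtain ⟨f, g, hf, hg, h⟩ := ih hφ
    refine ⟨g, f, hg, hf, fun x V C X v hC hv => ?_⟩
    have := h x V C X v hC hv
    exact ⟨this.2, this.1.trans not_not.symm⟩
  | and φ ψ ih₁ ih₂ =>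
    obtain ⟨f, g, hf, hg, h⟩ := ih₁ hφ.1
    obtain ⟨f', g', hf', hg', h'⟩ := ih₂ hφ.2
    refine ⟨_, _, hf.product hf', hg.revAppend hg', fun x V C X v hC hv => ?_⟩
    have h1 := h x V C X v hC hv
    have h2 := h' x V C X v hC hv
    simp only [satisfied_product, satisfied_revAppend, h1, h2, HoldsOn]
    exact ⟨trivial, not_and_or.symm⟩
  | or φ ψ ih₁ ih₂ =>
    obtain ⟨f, g, hf, hg, h⟩ := ih₁ hφ.1
    obtain ⟨f', g', hf', hg', h'⟩ := ih₂ hφ.2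
    refine ⟨_, _, hf.revAppend hf', hg.product hg', fun x V C X v hC hv => ?_⟩
    have h1 := h x V C X v hC hv
    have h2 := h' x V C X v hC hv
    simp only [satisfied_product, satisfied_revAppend, h1, h2, HoldsOn]
    exact ⟨trivial, not_or.symm⟩
  | imp φ ψ ih₁ ih₂ =>
    obtain ⟨f, g, hf, hg, h⟩ := ih₁ hφ.1
    obtain ⟨f', g', hf', hg', h'⟩ := ih₂ hφ.2
    refine ⟨_, _, hg.revAppend hf', hf.product hg', fun x V C X v hC hv => ?_⟩
    have h1 := h x V C X v hC hv
    have h2 := h' x V C X v hC hv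
    simp only [satisfied_product, satisfied_revAppend, h1, h2, HoldsOn]
    exact ⟨imp_iff_not_or.symm, Classical.not_imp.symm⟩
  | iff φ ψ ih₁ ih₂ =>
    obtain ⟨f, g, hf, hg, h⟩ := ih₁ hφ.1
    obtain ⟨f', g', hf', hg', h'⟩ := ih₂ hφ.2
    refine ⟨_, _, (hf.product hf').revAppend (hg.product hg'),
      (hf.product hg').revAppend (hg.product hf'), fun x V C X v hC hv => ?_⟩
    have h1 := h x V C X v hC hv
    have h2 := h' x V C X v hC hv
    simp only [satisfied_product, satisfied_revAppend, h1, h2, HoldsOn]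
    exact ⟨iff_iff_and_or_not_and_not.symm, hxor _ _⟩
  | all φ => exact hφ.elim
  | ex φ => exact hφ.elim

/-- An existential quantifier is a disjunction over the universe, so the term lists are concatenated
and the whole formula becomes a single clause. -/
theorem exists_terms {n : ℕ} {φ : FOFormula (arityWith ar r) n} (hφ : IsSigma 1 n φ) :
    ∃ f : BinTree → BinTree, PolyTime f ∧
      ∀ (x V : BinTree) (C : Finset BinTree) (X : BinTree → Prop) (v : Fin n → BinTree),
        Certifies r x V C X → (∀ i, v i ∈ x.left.toList) →
        (Satisfied C (f (evalTree (node x V) v)) ↔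
          φ.HoldsOn (· ∈ x.left.toList) (structRel ar r x X) v) := by
  have hid := PolyTime.id
  change ExPrefix (fun _ φ => φ.IsQuantifierFree) n φ at hφ
  induction hφ with
  | base h =>
    obtain ⟨f, _, hf, _, hspec⟩ := exists_normalForms _ h
    exact ⟨f, hf, fun x V C X v hC hv => (hspec x V C X v hC hv).1⟩
  | @ex n φ _ ih =>
    obtain ⟨f, hf, h⟩ := ih
    refine ⟨_, .collect (F := fun z u => f (node z.left (node u z.right)))
      (hf.comp (hid.left.left.node (hid.right.node hid.left.right))) hid.left.left.left, ?_⟩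
    intro x V C X v hC hv
    simp only [satisfied_collect, HoldsOn, ← evalTree_cons]
    refine exists_congr fun u => and_congr_right fun hu => h x V C X _ hC fun i => ?_
    exact Fin.cases hu hv i

/-- A universal quantifier is a conjunction over the universe, so here lists of clauses are
concatenated. -/
theorem exists_clauses {n : ℕ} {φ : FOFormula (arityWith ar r) n} (hφ : IsPi 2 n φ) :
    ∃ f : BinTree → BinTree, PolyTime f ∧
      ∀ (x V : BinTree) (C : Finset BinTree) (X : BinTree → Prop) (v : Fin n → BinTree),
        Certifies r x V C X → (∀ i, v i ∈ x.left.toList) →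
        ((∀ q ∈ (f (evalTree (node x V) v)).toList, Satisfied C q) ↔
          φ.HoldsOn (· ∈ x.left.toList) (structRel ar r x X) v) := by
  have hid := PolyTime.id
  change AllPrefix (IsSigma 1) n φ at hφ
  induction hφ with
  | base h =>
    obtain ⟨f, hf, hspec⟩ := exists_terms h
    refine ⟨_, hf.node .nil, fun x V C X v hC hv => ?_⟩
    simpa using hspec x V C X v hC hv
  | @all n φ _ ih =>
    obtain ⟨f, hf, h⟩ := ih
    refine ⟨_, .collect (F := fun z u => f (node z.left (node u z.right)))
      (hf.comp (hid.left.left.node (hid.right.node hid.left.right))) hid.left.left.left, ?_⟩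
    intro x V C X v hC hv
    simp only [mem_collect, HoldsOn, ← evalTree_cons, forall_exists_index, and_imp]
    rw [forall_comm]
    refine forall_congr' fun u => ?_
    rw [forall_comm]
    refine forall_congr' fun hu => h x V C X _ hC fun i => ?_
    exact Fin.cases hu hv i

end FOFormula

/-! ### Hardness -/

open BinTree in
theorem weightedDefinability_iff {m : ℕ} {ar : Fin m → ℕ} {r : ℕ}
    (φ : FOFormula (arityWith ar r) 0) (x : BinTree) (k : ℕ) :
    (x, k) ∈ weightedDefinability φ ↔
      ∃ S : Finset BinTree, S.card = k ∧ (∀ t ∈ S, t ∈ (tuples x.left r).toList) ∧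
        φ.HoldsOn (· ∈ x.left.toList) (structRel ar r x (· ∈ S)) Fin.elim0 := by
  classical
  let f : (Fin r → CodedUniverse x) → BinTree := fun v => ofList (List.ofFn fun j => (v j).1)
  have hf : Function.Injective f := fun v w h => by
    funext j
    exact Subtype.ext (congrFun (List.ofFn_injective (ofList_injective h)) j)
  have hrange : ∀ t, t ∈ (tuples x.left r).toList ↔ ∃ v, f v = t := fun t => by
    rw [mem_tuples]
    constructor
    · rintro ⟨v, hv, rfl⟩
      exact ⟨fun j => ⟨v j, hv j⟩, rfl⟩
    · rintro ⟨v, rfl⟩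
      exact ⟨_, fun j => (v j).2, rfl⟩
  have hiff : ∀ S : Finset (Fin r → CodedUniverse x),
      φ.Holds (expandBy ar r x S) Fin.elim0 ↔
        φ.HoldsOn (· ∈ x.left.toList) (structRel ar r x (· ∈ S.image f)) Fin.elim0 := fun S => by
    rw [FOFormula.holds_iff_holdsOn (D := (· ∈ x.left.toList))
      (I := structRel ar r x (· ∈ S.image f)) Subtype.val_injective]
    · rw [show ((Subtype.val : CodedUniverse x → BinTree) ∘ (Fin.elim0 : Fin 0 → CodedUniverse x)) =
        Fin.elim0 from funext fun i => i.elim0]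
    · intro t
      exact ⟨fun h => ⟨⟨t, h⟩, rfl⟩, by rintro ⟨u, rfl⟩; exact u.2⟩
    · rintro (_ | i) v
      · exact (hf.mem_finset_image (s := S) (a := v)).symm
      · exact Iff.rfl
  constructor
  · rintro ⟨S, hS, h⟩
    refine ⟨S.image f, (Finset.card_image_of_injective _ hf).trans hS, fun t ht => ?_, (hiff S).1 h⟩
    obtain ⟨v, -, rfl⟩ := Finset.mem_image.1 ht
    exact (hrange _).2 ⟨v, rfl⟩
  · rintro ⟨S, hS, hsub, h⟩
    have himg : (S.preimage f hf.injOn).image f = S := by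
      rw [Finset.image_preimage]
      exact Finset.filter_true_of_mem fun t ht => (hrange t).1 (hsub t ht)
    refine ⟨S.preimage f hf.injOn, ?_, (hiff _).2 (by rwa [himg])⟩
    rw [← Finset.card_image_of_injective _ hf, himg, hS]

namespace BinTree

/-- This provides the sentinel: as a list it has one entry more than the tuples. -/
theorem ofNat_notMem_tuples {U : BinTree} {r : ℕ} : ofNat (r + 1) ∉ (tuples U r).toList := by
  intro h
  obtain ⟨v, -, hv⟩ := mem_tuples.1 h
  have h₂ := congrArg (fun t : BinTree => t.toList.length) hv
  simp only [length_toList_ofNat, toList_ofList, List.length_ofFn] at h₂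
  omega

theorem certifies_of_selPath {r k : ℕ} {x V z : BinTree} {L : List BinTree} {C : Finset BinTree}
    {p : ℕ → List BinTree} {b : ℕ → BinTree} {X : BinTree → Prop} (hL : (L ++ [z]).Nodup)
    (hmem : ∀ t, t ∈ L ↔ t ∈ (tuples x.left r).toList) (hp : SelPath (k + 1) (L ++ [z]) p b)
    (hC : ∀ w, w ∈ C ↔ ∃ i < k + 1, w = stepVar i (p (i + 1)) (b i :: p i))
    (hV : ∀ w ∈ C, w ∈ V.toList) (hX : ∀ t ∈ L, X t ↔ ∃ i < k + 1, b i = t) :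
    Certifies r x V C X := by
  intro t ht
  rw [← hmem] at ht
  have hpos : (∃ w ∈ C, w ∈ V.toList ∧ w.right.right.left = t) ↔ ∃ i < k + 1, b i = t := by
    constructor
    · rintro ⟨w, hw, -, e⟩
      obtain ⟨i, hi, rfl⟩ := (hC w).1 hw
      exact ⟨i, hi, e⟩
    · rintro ⟨i, hi, e⟩
      have hw := (hC _).2 ⟨i, hi, rfl⟩
      exact ⟨_, hw, hV _ hw, e⟩
  have hneg : (∃ w ∈ C, w ∈ V.toList ∧ t ∈ w.right.left.toList ∧ t ∉ w.right.right.toList) ↔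
      ∃ i < k + 1, t ∈ p (i + 1) ∧ t ∉ b i :: p i := by
    constructor
    · rintro ⟨w, hw, -, h⟩
      obtain ⟨i, hi, rfl⟩ := (hC w).1 hw
      exact ⟨i, hi, by simpa only [stepVar, right_node, left_node, toList_ofList] using h⟩
    · rintro ⟨i, hi, h⟩
      have hw := (hC _).2 ⟨i, hi, rfl⟩
      exact ⟨_, hw, hV _ hw, by simpa only [stepVar, right_node, left_node, toList_ofList] using h⟩
  rw [hpos, hneg, hX t ht]
  refine ⟨Iff.rfl, fun h => ?_, ?_⟩
  · exact (hp.selected_or_skipped (List.mem_append_left _ ht)).resolve_left h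
  · rintro ⟨i, hi, h₁, h₂⟩ ⟨j, hj, rfl⟩
    exact hp.not_skipped hL hi hj h₁ h₂

end BinTree

-- Sets of `k` tuples correspond to paths of `k + 1` steps, the extra step leading to the sentinel
-- `z`. That step skips the tuples behind the last selected one, whose absence would otherwise have
-- no certificate.
open BinTree in
theorem exists_chosen_iff {m : ℕ} {ar : Fin m → ℕ} {r k : ℕ} {φ : FOFormula (arityWith ar r) 0}
    {cl : BinTree → BinTree} {x I T z : BinTree} {L : List BinTree}
    (hcl : ∀ (x V : BinTree) (C : Finset BinTree) (X : BinTree → Prop) (v : Fin 0 → BinTree),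
        Certifies r x V C X → (∀ i, v i ∈ x.left.toList) →
        ((∀ q ∈ (cl (evalTree (node x V) v)).toList, Satisfied C q) ↔
          φ.HoldsOn (· ∈ x.left.toList) (structRel ar r x X) v))
    (hL : (L ++ [z]).Nodup) (hmem : ∀ t, t ∈ L ↔ t ∈ (tuples x.left r).toList)
    (hI : ∀ t, t ∈ I.toList ↔ ∃ i ≤ k, t = ofNat i)
    (hT : ∀ t, t ∈ T.toList ↔ ∃ s, s ≠ [] ∧ s <:+ L ++ [z] ∧ t = ofList s)
    (htop : T.left = ofList (L ++ [z])) :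
    (∃ C : Finset BinTree, C.card ≤ k + 1 ∧
      ∀ q ∈ (revAppend (pathClauses (ofNat k) I T)
        (cl (evalTree (node x (stepVars I T)) Fin.elim0))).toList, Satisfied C q) ↔
      (x, k) ∈ weightedDefinability φ := by
  classical
  have hzL : z ∉ L := fun h => by
    have := List.nodup_append.1 hL
    exact this.2.2 z h z (by simp) rfl
  simp only [weightedDefinability_iff, toList_revAppend, List.mem_append, List.mem_reverse, or_imp,
    forall_and]
  constructor
  · rintro ⟨C, hC, hpath, hphi⟩
    obtain ⟨p, b, hp, hpC⟩ := selPath_of_satisfied hL hI hT htop hC hpath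
    have hb0 : b 0 = z := hp.first_eq (Nat.succ_pos k) rfl
    have hb : ∀ i < k, b (i + 1) ∈ L := fun i hi => by
      rcases List.mem_append.1 (hp.mem (show i + 1 < k + 1 by omega)) with h | h
      · exact h
      · rw [List.mem_singleton, ← hb0] at h
        have := hp.injective hL (by omega) (by omega) h
        omega
    -- Step `0` selects `z`; the other `k` steps select the tuples.
    refine ⟨(Finset.range k).image fun i => b (i + 1), ?_, ?_, ?_⟩
    · rw [Finset.card_image_of_injOn, Finset.card_range]
      intro i hi j hj e
      have hi := Finset.mem_range.1 hi
      have hj := Finset.mem_range.1 hj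
      have := hp.injective hL (by omega) (by omega) e
      omega
    · intro t ht
      obtain ⟨i, hi, rfl⟩ := Finset.mem_image.1 ht
      exact (hmem _).1 (hb i (Finset.mem_range.1 hi))
    · refine (hcl x (stepVars I T) C _ _ (certifies_of_selPath hL hmem hp hpC ?_ ?_)
        fun i => i.elim0).1 hphi
      · intro w hw
        obtain ⟨i, hi, rfl⟩ := (hpC w).1 hw
        exact (mem_stepVars hL hI hT).2
          ⟨i, by omega, _, _, _, hp.suffix_top hi, hp.step i hi, rfl⟩
      · intro t ht
        simp only [Finset.mem_image, Finset.mem_range]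
        constructor
        · rintro ⟨i, hi, e⟩
          exact ⟨i + 1, by omega, e⟩
        · rintro ⟨_ | i, hi, e⟩
          · exact absurd (hb0 ▸ e ▸ ht) hzL
          · exact ⟨i, by omega, e⟩
  · rintro ⟨S, hS, hsub, h⟩
    have hzS : z ∉ S := fun h => hzL ((hmem z).2 (hsub z h))
    obtain ⟨p, b, hp, hb, hall⟩ := exists_selPath (fun t => t ∈ S ∨ t = z) L (z := z) (.inr rfl)
    have hlen : ((L ++ [z]).filter fun t => t ∈ S ∨ t = z).length = k + 1 := by
      rw [← List.toFinset_card_of_nodup (hL.filter _), List.toFinset_filter]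
      rw [show ((L ++ [z]).toFinset.filter fun t => decide (t ∈ S ∨ t = z) = true) = insert z S from ?_]
      · rw [Finset.card_insert_of_notMem hzS, hS]
      · ext t
        simp only [Finset.mem_filter, List.mem_toFinset, List.mem_append, List.mem_singleton,
          decide_eq_true_eq, Finset.mem_insert]
        constructor
        · rintro ⟨-, h | h⟩
          · exact .inr h
          · exact .inl h
        · rintro (h | h)
          · exact ⟨.inr h, .inr h⟩
          · exact ⟨.inl ((hmem t).2 (hsub t h)), .inl h⟩
    rw [hlen] at hp hb hall
    have hCmem : ∀ w, w ∈ (Finset.range (k + 1)).image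
        (fun i => stepVar i (p (i + 1)) (b i :: p i)) ↔
        ∃ i < k + 1, w = stepVar i (p (i + 1)) (b i :: p i) := fun w => by
      simp [eq_comm]
    refine ⟨(Finset.range (k + 1)).image fun i => stepVar i (p (i + 1)) (b i :: p i), ?_, ?_, ?_⟩
    · exact Finset.card_image_le.trans (by simp)
    · exact satisfied_of_selPath hL hI hT htop hp fun i hi => (hCmem _).2 ⟨i, hi, rfl⟩
    · refine (hcl x (stepVars I T) _ _ _ (certifies_of_selPath hL hmem hp hCmem ?_ ?_)
        fun i => i.elim0).2 h
      · intro w hw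
        obtain ⟨i, hi, rfl⟩ := (hCmem w).1 hw
        exact (mem_stepVars hL hI hT).2
          ⟨i, by omega, _, _, _, hp.suffix_top hi, hp.step i hi, rfl⟩
      · intro t ht
        constructor
        · exact fun h => hall t (List.mem_append_left _ ht) (.inl h)
        · rintro ⟨i, hi, rfl⟩
          exact (hb i hi).resolve_right fun e => hzL (e ▸ ht)

open BinTree in
theorem wHard_vertexRemoval_triangleSentence : WHard 2 (vertexRemoval triangleSentence) := by
  rintro L' ⟨m, ar, r, φ, hφ, hred⟩
  obtain ⟨cl, hcl, hspec⟩ := FOFormula.exists_clauses hφ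
  have hid := PolyTime.id
  let I : BinTree → BinTree := fun y => numerals y.right
  let T : BinTree → BinTree := fun y => growTails (fun u s => u ∈ s.left.toList)
    (node (node (ofNat (r + 1)) nil) nil) (tuples y.left.left r)
  let K : BinTree → BinTree := fun y => revAppend (pathClauses y.right (I y) (T y))
    (cl (node (node y.left (stepVars (I y) (T y))) nil))
  have hI : PolyTime I := hid.right.numerals
  have hT : PolyTime T := .growTails (.mem hid.left hid.right.left) (.const _) (hid.left.left.tuples r)
  have hK : PolyTime K := (hid.right.pathClauses hI hT).revAppend
    (hcl.comp ((hid.left.node (hI.stepVars hT)).node .nil))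
  -- The new parameter `k + 1` is the number of steps of a path. The numerals up to `k + 1` are `k +
  -- 2` many, which gives one copy more than there are removals.
  refine hred.trans_polyTime (F := fun y => node (coverGraph (numerals (node nil y.right)) (K y))
    (node nil y.right)) (g := fun k => k + 1)
    (((PolyTime.nil.node hid.right).numerals.coverGraph hK).node (PolyTime.nil.node hid.right))
    Primrec.succ.to_comp (fun a b h => Nat.succ_le_succ h) fun x k => ?_
  refine ⟨coverGraph (numerals (ofNat (k + 1))) (K (inputTree x k)), rfl, ?_⟩
  obtain ⟨L, hL, hmem, htop, hTmem⟩ := growTails_dedup (tuples x.left r)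
    (ofNat_notMem_tuples (U := x.left) (r := r))
  have hnum := toList_numerals (k + 1)
  have hcover := removable_coverGraph (K := K (inputTree x k)) (k := k + 1)
    (J := numerals (ofNat (k + 1)))
    (by
      rw [hnum, List.nodup_reverse]
      exact List.nodup_range.map ofNat_injective) (by simp [hnum])
  refine Iff.trans ?_ hcover.symm
  have := exists_chosen_iff hspec hL hmem (fun t => mem_numerals (k := k)) hTmem htop
  rw [← this, evalTree_elim0]
  rfl

/-! ### Polynomially bounded overheads -/

/-- A function on the natural numbers that is bounded by a polynomial. -/
def NatPoly (h : ℕ → ℕ) : Prop := ∃ c : ℕ, ∀ M, h M ≤ (M + 2) ^ c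

namespace NatPoly

theorem id : NatPoly fun M => M := ⟨1, fun M => by simp⟩

theorem const (n : ℕ) : NatPoly fun _ => n :=
  ⟨n, fun M => (Nat.lt_two_pow_self).le.trans (Nat.pow_le_pow_left (by omega) n)⟩

theorem mul {a b : ℕ → ℕ} : NatPoly a → NatPoly b → NatPoly fun x => a x * b x := by
  rintro ⟨c, hc⟩ ⟨d, hd⟩
  exact ⟨c + d, fun x => by rw [pow_add]; exact Nat.mul_le_mul (hc x) (hd x)⟩

theorem add {a b : ℕ → ℕ} : NatPoly a → NatPoly b → NatPoly fun x => a x + b x := by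
  rintro ⟨c, hc⟩ ⟨d, hd⟩
  refine ⟨c + d + 1, fun M => ?_⟩
  have h1 : (M + 2) ^ c ≤ (M + 2) ^ (c + d) := Nat.pow_le_pow_right (by omega) (by omega)
  have h2 : (M + 2) ^ d ≤ (M + 2) ^ (c + d) := Nat.pow_le_pow_right (by omega) (by omega)
  have := hc M
  have := hd M
  rw [pow_succ]
  nlinarith

theorem pow {a : ℕ → ℕ} (ha : NatPoly a) (n : ℕ) : NatPoly fun x => a x ^ n := by
  induction n with
  | zero => simpa using const 1
  | succ n ih => simpa only [pow_succ] using ih.mul ha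

theorem comp {h g : ℕ → ℕ} : NatPoly h → NatPoly g → NatPoly fun M => h (g M) := by
  rintro ⟨c, hc⟩ hg
  obtain ⟨d, hd⟩ := (hg.add (const 2)).pow c
  exact ⟨d, fun M => (hc _).trans (hd M)⟩

end NatPoly

theorem PolyTime.exists_natPoly {f : BinTree → BinTree} (hf : PolyTime f) :
    ∃ (p : Prog) (h : ℕ → ℕ), NatPoly h ∧
      ∀ x M, x.size ≤ M → ∃ T, Run p x (f x) T ∧ T ≤ h M := by
  obtain ⟨p, c, hp⟩ := hf
  refine ⟨p, fun M => (M + 2) ^ c, ⟨c, fun _ => le_rfl⟩, fun x M hx => ?_⟩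
  obtain ⟨T, h1, h2⟩ := hp x
  exact ⟨T, h1, h2.trans (Nat.pow_le_pow_left (by omega) _)⟩

/-! ### Search through the universe -/

namespace BinTree

/-- The list of the elements of the structure that `evalTree` refers to. -/
def elements (e : BinTree) : List BinTree := e.left.left.left.toList

/-- The assignment of `e`, extended by one more element. -/
def extend (e u : BinTree) : BinTree := node e.left (node u e.right)

theorem size_elements_le (e : BinTree) : (ofList e.elements).size ≤ e.size := by
  rw [elements, ofList_toList]
  exact (size_left_le _).trans ((size_left_le _).trans (size_left_le _))

end BinTree

-- A linear search that calls `p` on every extended assignment. The overhead `h` is chosen before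
-- `p`, so nesting the search along a formula does not raise the degree of `h`. The relation `R`
-- leaves open what the answers of `p` mean.
open BinTree in
theorem exists_find : ∃ (F : Prog → Prog) (h : ℕ → ℕ), NatPoly h ∧
    ∀ (p : Prog) (e : BinTree) (M B : ℕ) (R : BinTree → BinTree → Prop), e.size ≤ M →
      (∀ u ∈ e.elements, ∃ y T, Run p (e.extend u) y T ∧ T ≤ B ∧ y.size ≤ M ∧ R u y) →
      ∃ y T, Run (F p) e y T ∧ T ≤ (e.elements.length + 1) * (B + h M) ∧ y.size ≤ M ∧
        ((y = nil ∧ ∀ u ∈ e.elements, R u nil) ∨ (y ≠ nil ∧ ∃ u ∈ e.elements, R u y)) := by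
  have hid := PolyTime.id
  obtain ⟨pI, hI, hIp, hIr⟩ := (hid.node (hid.left.left.left.node .nil)).exists_natPoly
  obtain ⟨pC, hC, hCp, hCr⟩ := (hid.right.right.iteNil .nil hid.right.left).exists_natPoly
  obtain ⟨pE, hE, hEp, hEr⟩ :=
    (hid.left.left.node (hid.right.left.left.node hid.left.right)).exists_natPoly
  obtain ⟨pN, hN, hNp, hNr⟩ :=
    (hid.left.left.node (hid.left.right.left.right.node hid.right)).exists_natPoly
  obtain ⟨pO, hO, hOp, hOr⟩ := hid.right.right.exists_natPoly
  have hlin : NatPoly fun M => 4 * M + 4 := ((NatPoly.const 4).mul .id).add (.const 4)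
  refine ⟨fun p => .seq pI (.seq (.loop pC (.seq (.pair .ident (.seq pE p)) pN)) pO),
    fun M => hI (4 * M + 4) + hC (4 * M + 4) + hE (4 * M + 4) + hN (4 * M + 4) + hO (4 * M + 4) +
      (4 * M + 4) + 6,
    ((((((hIp.comp hlin).add (hCp.comp hlin)).add (hEp.comp hlin)).add (hNp.comp hlin)).add
      (hOp.comp hlin)).add hlin).add (.const 6), ?_⟩
  intro p e M B R he hp
  set K := 4 * M + 4 with hK
  obtain ⟨T₀, hr₀, hT₀⟩ := hIr e K (by omega)
  -- The members of `l₁` have been tried and `y` is the latest answer; the loop ends with the first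
  -- `y` other than `nil`.
  let Inv : ℕ → BinTree → Prop := fun n s => ∃ l₁ l₂ y, e.elements = l₁ ++ l₂ ∧
    s = node e (node (ofList l₂) y) ∧ y.size ≤ M ∧ n = l₂.length ∧
    ((y = nil ∧ ∀ u ∈ l₁, R u nil) ∨ (y ≠ nil ∧ ∃ u ∈ e.elements, R u y))
  have hsize : ∀ n s, Inv n s → s.size ≤ 3 * M + 2 := by
    rintro n s ⟨l₁, l₂, y, h1, rfl, h2, -, -⟩
    have h3 := size_ofList_append l₁ l₂
    have h4 := size_elements_le e
    have := (ofList l₁).size_pos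
    rw [h1] at h4
    simp only [size_node]
    omega
  obtain ⟨s', m, T₁, hInv, hD, hr₁, hT₁⟩ := Run.exists_loop (c := pC)
    (b := .seq (.pair .ident (.seq pE p)) pN)
    (A := B + hC K + hE K + hN K + K + 3) Inv
    (fun s => s.right.right ≠ nil ∨ s.right.left = nil) (by
      intro n s hs
      have hsz := hsize n s hs
      obtain ⟨Tc, hc, hTc⟩ := hCr s K (by omega)
      obtain ⟨l₁, l₂, y, h1, rfl, h2, h3, h4⟩ := hs
      simp only [right_node, left_node] at hc ⊢
      by_cases hy : y = nil
      · cases l₂ with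
        | nil =>
          left
          refine ⟨.inr rfl, Tc, by omega, ?_⟩
          simpa [hy] using hc
        | cons u l₂ =>
          right
          obtain ⟨y', Tp, hpr, hTp, hy', hR⟩ := hp u (by simp [h1])
          set s := node e (node (ofList (u :: l₂)) y) with hs
          obtain ⟨Te, her, hTe⟩ := hEr s K (by omega)
          obtain ⟨Tn, hnr, hTn⟩ := hNr (node s y') K (by simp only [size_node]; omega)
          refine ⟨l₂.length, by simp [h3], _, node e (node (ofList l₂) y'), Tc, _, ?_, hc, ?_,
            Run.seq (Run.pair (Run.ident s) (Run.seq her hpr)) hnr, ?_⟩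
          · refine ⟨l₁ ++ [u], l₂, y', by simp [h1], rfl, hy', rfl, ?_⟩
            by_cases h : y' = nil
            · left
              refine ⟨h, fun w hw => ?_⟩
              rcases List.mem_append.1 hw with hw | hw
              · exact (h4.resolve_right fun h => h.1 hy).2 w hw
              · rw [List.mem_singleton] at hw
                exact hw ▸ h ▸ hR
            · exact .inr ⟨h, u, by simp [h1], hR⟩
          · simp [hy]
          · omega
      · left
        refine ⟨.inl hy, Tc, by omega, ?_⟩
        simpa [hy] using hc) e.elements.length (node e (node (ofList e.elements) nil))
      ⟨[], _, nil, rfl, rfl, by have := e.size_pos; simp; omega, rfl, by simp⟩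
  obtain ⟨T₂, hr₂, hT₂⟩ := hOr s' K (by have := hsize _ _ hInv; omega)
  obtain ⟨l₁, l₂, y, h1, rfl, h2, -, h4⟩ := hInv
  have hr₀' : Run pI e (node e (node (ofList e.elements) nil)) T₀ := by
    rw [elements, ofList_toList]; exact hr₀
  refine ⟨y, _, Run.seq hr₀' (Run.seq hr₁ hr₂), ?_, h2, ?_⟩
  · have : T₁ ≤ (e.elements.length + 1) * (B + hC K + hE K + hN K + K + 4) := hT₁
    have h5 : T₀ + T₂ + 2 ≤ (e.elements.length + 1) * (hI K + hO K + 2) := by nlinarith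
    nlinarith
  · rcases h4 with h4 | h4
    · have : l₂ = [] := by
        rcases hD with hD | hD
        · exact absurd h4.1 hD
        · cases l₂ with
          | nil => rfl
          | cons u l => simp at hD
      refine .inl ⟨h4.1, ?_⟩
      rw [h1, this, List.append_nil]
      exact h4.2
    · exact .inr h4

-- The removed vertices are listed in `e.left.right`. They are answered by `nil` without calling
-- `p`, so the search runs through the remaining graph only.
open BinTree in
theorem exists_guardedFind : ∃ (F : Prog → Prog) (h : ℕ → ℕ), NatPoly h ∧
    ∀ (p : Prog) (e : BinTree) (M B : ℕ) (R : BinTree → BinTree → Prop), e.size ≤ M →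
      (∀ u ∈ e.elements, u ∉ e.left.right.toList → (e.extend u).size ≤ M ∧
        ∃ y T, Run p (e.extend u) y T ∧ T ≤ B ∧ y.size ≤ M ∧ R u y) →
      ∃ y T, Run (F p) e y T ∧ T ≤ (e.elements.length + 1) * (B + h M) ∧ y.size ≤ M ∧
        ((y = nil ∧ ∀ u ∈ e.elements, u ∉ e.left.right.toList → R u nil) ∨
          (y ≠ nil ∧ ∃ u ∈ e.elements, u ∉ e.left.right.toList ∧ R u y)) := by
  have hid := PolyTime.id
  obtain ⟨F, h, hh, hF⟩ := exists_find
  obtain ⟨f, hf, hfs⟩ := PolyDec.mem hid.right.left hid.left.right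
  obtain ⟨q, h', hh', hq⟩ := hf.exists_natPoly
  have hlin : NatPoly fun M => 2 * M + 3 := ((NatPoly.const 2).mul .id).add (.const 3)
  refine ⟨fun p => F (.branch q .empty p), fun M => h M + h' (2 * M + 3) + (2 * M + 3) + 2,
    ((hh.add (hh'.comp hlin)).add hlin).add (.const 2), ?_⟩
  intro p e M B R he hp
  obtain ⟨y, T, h1, h2, h3, h4⟩ := hF (.branch q .empty p) e M (B + h' (2 * M + 3) + (2 * M + 3) + 2)
    (fun u y => (u ∈ e.left.right.toList ∧ y = nil) ∨ (u ∉ e.left.right.toList ∧ R u y)) he (by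
      intro u hu
      have hsz : (e.extend u).size ≤ 2 * M + 3 := by
        have h1 := size_lt_of_mem_toList hu
        have h2 := size_left_le e
        have h3 := size_left_le e.left
        have h4 := size_left_le e.left.left
        have h5 : e.left.size + e.right.size ≤ e.size + 1 := by
          cases e with
          | nil => simp
          | node a b => simp; omega
        simp only [extend, size_node]
        omega
      obtain ⟨T, hr, hT⟩ := hq (e.extend u) _ hsz
      by_cases hS : u ∈ e.left.right.toList
      · refine ⟨nil, _, Run.branch_pos hr ((hfs _).2 hS) (Run.empty _), by omega, ?_, .inl ⟨hS, rfl⟩⟩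
        have := e.size_pos
        simp; omega
      · obtain ⟨-, y, T', hr', hT', hy, hR⟩ := hp u hu hS
        have hnil : f (e.extend u) = nil := not_not.1 fun hne => hS ((hfs _).1 hne)
        exact ⟨y, _, Run.branch_neg (hnil ▸ hr) hr', by omega, hy, .inr ⟨hS, hR⟩⟩)
  refine ⟨y, T, h1, ?_, h3, ?_⟩
  · refine h2.trans (Nat.mul_le_mul_left _ (by beta_reduce; omega))
  · rcases h4 with ⟨h4, h5⟩ | ⟨h4, u, hu, h5⟩
    · exact .inl ⟨h4, fun u hu hS => ((h5 u hu).resolve_left fun h => hS h.1).2⟩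
    · have h5 := h5.resolve_left fun h => h4 h.2
      exact .inr ⟨h4, u, hu, h5.1, h5.2⟩

/-! ### Evaluation of formulas -/

/-- Adjacency in the graph coded by the tree `x`. -/
def graphRel (x : BinTree) (_ : Unit) (v : Fin 2 → BinTree) : Prop :=
  v 0 ≠ v 1 ∧ (BinTree.node (v 0) (v 1) ∈ x.right.toList ∨
    BinTree.node (v 1) (v 0) ∈ x.right.toList)

/-- The vertices of the graph coded by `x` that remain when the members of `S` are removed. -/
def Remaining (x : BinTree) (S : List BinTree) (u : BinTree) : Prop :=
  u ∈ x.left.toList ∧ u ∉ S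

/-- Truth of a formula in the graph coded by `x` after the removal of the members of `S`. -/
def HoldsAfter (x : BinTree) (S : List BinTree) {n : ℕ} (φ : FOFormula (fun _ : Unit => 2) n)
    (v : Fin n → BinTree) : Prop :=
  φ.HoldsOn (Remaining x S) (graphRel x) v

theorem extend_evalTree {n : ℕ} (c u : BinTree) (v : Fin n → BinTree) :
    (evalTree c v).extend u = evalTree c (Fin.cons u v : Fin (n + 1) → BinTree) :=
  (evalTree_cons c u v).symm

theorem FOFormula.three_le_length {n : ℕ} (φ : FOFormula (fun _ : Unit => 2) n) :
    3 ≤ φ.length := by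
  induction φ <;> simp only [length] <;> omega

/-- The program that computes `BinTree.nth i`. -/
def nthProg : ℕ → Prog
  | 0 => .left
  | i + 1 => .seq .right (nthProg i)

theorem run_nthProg (i : ℕ) (x : BinTree) :
    ∃ T, Run (nthProg i) x (BinTree.nth i x) T ∧ T ≤ (i + 1) * (x.size + 1) := by
  induction i generalizing x with
  | zero => exact ⟨_, Run.left x, by simp⟩
  | succ i ih =>
    obtain ⟨T, h1, h2⟩ := ih x.right
    refine ⟨_, Run.seq (Run.right x) h1, ?_⟩
    have := x.size_right_le
    have : (i + 1) * (x.right.size + 1) ≤ (i + 1) * (x.size + 1) := Nat.mul_le_mul_left _ (by omega)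
    nlinarith

theorem run_variable {n M : ℕ} (c : BinTree) (v : Fin n → BinTree) (i : Fin n)
    (hM : (evalTree c v).size ≤ M) :
    ∃ T, Run (.seq .right (nthProg i)) (evalTree c v) (v i) T ∧ T ≤ (M + 1) * (M + 3) := by
  obtain ⟨T, h1, h2⟩ := run_nthProg i (BinTree.ofList (List.ofFn v))
  rw [BinTree.nth_ofFn] at h1
  refine ⟨_, Run.seq (Run.right _) h1, ?_⟩
  have h3 := BinTree.length_toList_lt_size (BinTree.ofList (List.ofFn v))
  have h4 := i.2
  have h5 : (evalTree c v).size = c.size + (BinTree.ofList (List.ofFn v)).size + 1 := rfl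
  have := c.size_pos
  rw [BinTree.toList_ofList, List.length_ofFn] at h3
  have : T ≤ (M + 1) * (M + 1) := h2.trans (Nat.mul_le_mul (by omega) (by omega))
  nlinarith

theorem PolyDec.exists_small {P : BinTree → Prop} (hP : PolyDec P) :
    ∃ f : BinTree → BinTree, PolyTime f ∧ (∀ x, f x ≠ .nil ↔ P x) ∧ ∀ x, (f x).size ≤ 3 := by
  obtain ⟨f, hf, h⟩ := hP
  refine ⟨_, hf.iteNil (.const (.node .nil .nil)) .nil, fun x => ?_, fun x => ?_⟩
  · rw [← h x]
    by_cases hx : f x = .nil <;> simp [hx]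
  · by_cases hx : f x = .nil <;> simp [hx]

/-- The program that always answers "true". -/
def yesProg : Prog := .pair .empty .empty

theorem run_yesProg (x : BinTree) : Run yesProg x (.node .nil .nil) (x.size + x.size + 1) :=
  Run.pair (Run.empty x) (Run.empty x)

section Arithmetic

variable {a l l' H T T' : ℕ}

/-- Time bounds `a ^ l * (l * H)`, with `l` the length of the formula and `a` one more than the
number of listed vertices, survive binary connectives; the next two lemmas treat negation and
quantifiers. -/
theorem add_le_pow_mul (ha : 1 ≤ a) (h : T ≤ a ^ l * (l * H)) (h' : T' ≤ a ^ l' * (l' * H)) :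
    T + T' + H ≤ a ^ (l + l' + 1) * ((l + l' + 1) * H) := by
  have h1 : a ^ l ≤ a ^ (l + l' + 1) := Nat.pow_le_pow_right ha (by omega)
  have h2 : a ^ l' ≤ a ^ (l + l' + 1) := Nat.pow_le_pow_right ha (by omega)
  have h3 : 1 ≤ a ^ (l + l' + 1) := Nat.one_le_pow _ _ ha
  have h4 := h.trans (Nat.mul_le_mul_right _ h1)
  have h5 := h'.trans (Nat.mul_le_mul_right _ h2)
  have h6 : H ≤ a ^ (l + l' + 1) * H := Nat.le_mul_of_pos_left _ h3
  calc T + T' + H ≤ _ := Nat.add_le_add (Nat.add_le_add h4 h5) h6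
    _ = _ := by ring

theorem add_le_pow_succ_mul (ha : 1 ≤ a) (h : T ≤ a ^ l * (l * H)) :
    T + H ≤ a ^ (l + 1) * ((l + 1) * H) := by
  simpa using add_le_pow_mul (T' := 0) (l' := 0) ha h (by simp)

theorem mul_add_le_pow_mul (ha : 1 ≤ a) (h : T ≤ a ^ l * (l * H)) :
    a * (T + H) + H ≤ a ^ (l + 2) * ((l + 2) * H) := by
  have h1 := Nat.mul_le_mul_left a (add_le_pow_succ_mul ha h)
  have h2 : a * (a ^ (l + 1) * ((l + 1) * H)) = a ^ (l + 2) * ((l + 1) * H) := by ring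
  have h3 : H ≤ a ^ (l + 2) * H := Nat.le_mul_of_pos_left _ (Nat.one_le_pow _ _ ha)
  calc a * (T + H) + H ≤ a ^ (l + 2) * ((l + 1) * H) + a ^ (l + 2) * H := by
        rw [← h2]; exact Nat.add_le_add h1 h3
    _ = _ := by ring

end Arithmetic

-- Each quantifier lengthens the assignment by a vertex smaller than `x`; the summand `φ.length *
-- x.size` reserves room for this in `M`. The polynomial `h` does not depend on `φ`.
open BinTree in
theorem exists_eval : ∃ h : ℕ → ℕ, NatPoly h ∧ ∀ {n : ℕ} (φ : FOFormula (fun _ : Unit => 2) n),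
    ∃ p : Prog, ∀ (x S : BinTree) (v : Fin n → BinTree) (M : ℕ),
      (evalTree (node x S) v).size + φ.length * x.size ≤ M →
      ∃ y T, Run p (evalTree (node x S) v) y T ∧ y.size ≤ M ∧
        (y ≠ nil ↔ HoldsAfter x S.toList φ v) ∧
        T ≤ (x.left.toList.length + 1) ^ φ.length * (φ.length * h M) := by
  have hid := PolyTime.id
  obtain ⟨F, hF, hFp, hFind⟩ := exists_guardedFind
  obtain ⟨f, hf, hfs, hf3⟩ := ((PolyDec.eq hid.right.left hid.right.right).not.and
    ((PolyDec.mem hid.right hid.left.right).or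
      (PolyDec.mem (hid.right.right.node hid.right.left) hid.left.right))).exists_small
  obtain ⟨q, hq, hqp, hqr⟩ := hf.exists_natPoly
  have hlin : NatPoly fun M => 3 * M + 3 := ((NatPoly.const 3).mul .id).add (.const 3)
  let h : ℕ → ℕ := fun M => hF M + hq (3 * M + 3) + 4 * ((M + 1) * (M + 3)) + (3 * M + 3) + 10
  have hh : NatPoly h := (((hFp.add (hqp.comp hlin)).add ((NatPoly.const 4).mul
    ((NatPoly.id.add (.const 1)).mul (NatPoly.id.add (.const 3))))).add hlin).add (.const 10)
  refine ⟨h, hh, fun φ => ?_⟩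
  have hhM : ∀ M, h M =
    hF M + hq (3 * M + 3) + 4 * ((M + 1) * (M + 3)) + (3 * M + 3) + 10 := fun _ => rfl
  have hbig : ∀ {n : ℕ} (x S : BinTree) (v : Fin n → BinTree),
      5 ≤ (evalTree (node x S) v).size := fun x S v => by
    have := x.size_pos
    have := S.size_pos
    have := (ofList (List.ofFn v)).size_pos
    simp only [evalTree, size_node]
    omega
  -- Atoms have length `3`.
  have hatom : ∀ (N T M : ℕ), T ≤ h M → T ≤ (N + 1) ^ 3 * (3 * h M) := fun N T M hT => by
    have : 1 ≤ (N + 1) ^ 3 := Nat.one_le_pow _ _ (by omega)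
    nlinarith
  induction φ with
  | eq a b =>
    refine ⟨.seq (.pair (.seq .right (nthProg a)) (.seq .right (nthProg b))) .same,
      fun x S v M hM => ?_⟩
    obtain ⟨T₁, h1, h2⟩ := run_variable (M := M) (node x S) v a (by omega)
    obtain ⟨T₂, h3, h4⟩ := run_variable (M := M) (node x S) v b (by omega)
    have h5 := h1.output_size_le
    have h6 := h3.output_size_le
    have h7 := hbig x S v
    have h8 := hhM M
    by_cases hab : v a = v b
    · refine ⟨_, _, Run.seq (Run.pair h1 h3) (Run.same_pos _ hab), by simp; omega,
        by simpa [HoldsAfter, FOFormula.HoldsOn] using hab, hatom _ _ _ ?_⟩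
      simp only [size_node]
      omega
    · refine ⟨_, _, Run.seq (Run.pair h1 h3) (Run.same_neg _ hab), by simp; omega,
        by simpa [HoldsAfter, FOFormula.HoldsOn] using hab, hatom _ _ _ ?_⟩
      simp only [size_node]
      omega
  | rel R a =>
    refine ⟨.seq (.pair (.seq .left .left) (.pair (.seq .right (nthProg (a (0 : Fin 2))))
      (.seq .right (nthProg (a (1 : Fin 2)))))) q, fun x S v M hM => ?_⟩
    obtain ⟨T₁, h1, h2⟩ := run_variable (M := M) (node x S) v (a (0 : Fin 2)) (by omega)
    obtain ⟨T₂, h3, h4⟩ := run_variable (M := M) (node x S) v (a (1 : Fin 2)) (by omega)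
    have hs : ∀ i, (v i).size ≤ M := fun i => by
      have h1 : v i ∈ (ofList (List.ofFn v)).toList := by simp
      have h2 := size_lt_of_mem_toList h1
      simp only [evalTree, size_node] at hM
      omega
    have hx : x.size ≤ M := by simp only [evalTree, size_node] at hM; omega
    obtain ⟨T₃, h5, h6⟩ := hqr (node x (node (v (a (0 : Fin 2))) (v (a (1 : Fin 2))))) (3 * M + 3) (by
      have := hs (a (0 : Fin 2))
      have := hs (a (1 : Fin 2))
      simp only [size_node]
      omega)
    have h7 := hbig x S v
    have h8 := hhM M
    refine ⟨_, _, Run.seq (Run.pair (Run.seq (Run.left _) (Run.left _)) (Run.pair h1 h3)) h5,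
      (hf3 _).trans (by omega), (hfs _).trans Iff.rfl, hatom _ _ _ ?_⟩
    have h9 : (evalTree (node x S) v).left.size ≤ (evalTree (node x S) v).size := size_left_le _
    omega
  | not φ ih =>
    obtain ⟨p, hp⟩ := ih
    refine ⟨.branch p .empty yesProg, fun x S v M hM => ?_⟩
    simp only [FOFormula.length] at hM ⊢
    obtain ⟨y, T, h1, h2, h3, h4⟩ := hp x S v M (by nlinarith)
    have h7 := hbig x S v
    have h8 := hhM M
    have h9 := add_le_pow_succ_mul (by omega) h4
    by_cases hy : y = nil
    · exact ⟨_, _, Run.branch_neg (hy ▸ h1) (run_yesProg _), by simp; omega,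
        by simpa [HoldsAfter, FOFormula.HoldsOn, hy] using h3, by omega⟩
    · exact ⟨_, _, Run.branch_pos h1 hy (Run.empty _), by simp; omega,
        by simpa [HoldsAfter, FOFormula.HoldsOn, hy] using h3, by omega⟩
  | and φ ψ ih₁ ih₂ =>
    obtain ⟨p, hp⟩ := ih₁
    obtain ⟨p', hp'⟩ := ih₂
    refine ⟨.branch p p' .empty, fun x S v M hM => ?_⟩
    simp only [FOFormula.length] at hM ⊢
    obtain ⟨y, T, h1, h2, h3, h4⟩ := hp x S v M (by nlinarith)
    obtain ⟨y', T', h1', h2', h3', h4'⟩ := hp' x S v M (by nlinarith)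
    have h7 := hbig x S v
    have h8 := hhM M
    have h9 := add_le_pow_mul (by omega) h4 h4'
    have h10 : HoldsAfter x S.toList (.and φ ψ) v ↔ y ≠ nil ∧ y' ≠ nil := (and_congr h3 h3').symm
    by_cases hy : y = nil
    · exact ⟨_, _, Run.branch_neg (hy ▸ h1) (Run.empty _), by simp; omega, by simp [h10, hy],
        by omega⟩
    · exact ⟨_, _, Run.branch_pos h1 hy h1', h2', by simp [h10, hy], by omega⟩
  | or φ ψ ih₁ ih₂ =>
    obtain ⟨p, hp⟩ := ih₁
    obtain ⟨p', hp'⟩ := ih₂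
    refine ⟨.branch p yesProg p', fun x S v M hM => ?_⟩
    simp only [FOFormula.length] at hM ⊢
    obtain ⟨y, T, h1, h2, h3, h4⟩ := hp x S v M (by nlinarith)
    obtain ⟨y', T', h1', h2', h3', h4'⟩ := hp' x S v M (by nlinarith)
    have h7 := hbig x S v
    have h8 := hhM M
    have h9 := add_le_pow_mul (by omega) h4 h4'
    have h10 : HoldsAfter x S.toList (.or φ ψ) v ↔ y ≠ nil ∨ y' ≠ nil := (or_congr h3 h3').symm
    by_cases hy : y = nil
    · exact ⟨_, _, Run.branch_neg (hy ▸ h1) h1', h2', by simp [h10, hy], by omega⟩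
    · exact ⟨_, _, Run.branch_pos h1 hy (run_yesProg _), by simp; omega, by simp [h10, hy],
        by omega⟩
  | imp φ ψ ih₁ ih₂ =>
    obtain ⟨p, hp⟩ := ih₁
    obtain ⟨p', hp'⟩ := ih₂
    refine ⟨.branch p p' yesProg, fun x S v M hM => ?_⟩
    simp only [FOFormula.length] at hM ⊢
    obtain ⟨y, T, h1, h2, h3, h4⟩ := hp x S v M (by nlinarith)
    obtain ⟨y', T', h1', h2', h3', h4'⟩ := hp' x S v M (by nlinarith)
    have h7 := hbig x S v
    have h8 := hhM M
    have h9 := add_le_pow_mul (by omega) h4 h4'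
    have h10 : HoldsAfter x S.toList (.imp φ ψ) v ↔ (y ≠ nil → y' ≠ nil) := (imp_congr h3 h3').symm
    by_cases hy : y = nil
    · exact ⟨_, _, Run.branch_neg (hy ▸ h1) (run_yesProg _), by simp; omega, by simp [h10, hy],
        by omega⟩
    · exact ⟨_, _, Run.branch_pos h1 hy h1', h2', by simp [h10, hy], by omega⟩
  | iff φ ψ ih₁ ih₂ =>
    obtain ⟨p, hp⟩ := ih₁
    obtain ⟨p', hp'⟩ := ih₂
    refine ⟨.branch p p' (.branch p' .empty yesProg), fun x S v M hM => ?_⟩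
    simp only [FOFormula.length] at hM ⊢
    obtain ⟨y, T, h1, h2, h3, h4⟩ := hp x S v M (by nlinarith)
    obtain ⟨y', T', h1', h2', h3', h4'⟩ := hp' x S v M (by nlinarith)
    have h7 := hbig x S v
    have h8 := hhM M
    have h9 := add_le_pow_mul (by omega) h4 h4'
    have h10 : HoldsAfter x S.toList (.iff φ ψ) v ↔ (y ≠ nil ↔ y' ≠ nil) := (iff_congr h3 h3').symm
    by_cases hy : y = nil
    · by_cases hy' : y' = nil
      · exact ⟨_, _, Run.branch_neg (hy ▸ h1) (Run.branch_neg (hy' ▸ h1') (run_yesProg _)),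
          by simp; omega, by simp [h10, hy, hy'], by omega⟩
      · exact ⟨_, _, Run.branch_neg (hy ▸ h1) (Run.branch_pos h1' hy' (Run.empty _)),
          by simp; omega, by simp [h10, hy, hy'], by omega⟩
    · exact ⟨_, _, Run.branch_pos h1 hy h1', h2', by simp [h10, hy], by omega⟩
  | @all n φ ih =>
    obtain ⟨p, hp⟩ := ih
    -- A universal quantifier is evaluated as an unsuccessful search for a counterexample.
    refine ⟨.branch (F (.branch p .empty yesProg)) .empty yesProg, fun x S v M hM => ?_⟩
    simp only [FOFormula.length] at hM ⊢
    have h7 := hbig x S v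
    have h8 := hhM M
    have hel : (evalTree (node x S) v).elements = x.left.toList := rfl
    obtain ⟨y, T, h1, h2, h3, h4⟩ := hFind (.branch p .empty yesProg) (evalTree (node x S) v) M
      ((x.left.toList.length + 1) ^ φ.length * (φ.length * h M) + (M + M + 2))
      (fun u y => y ≠ nil ↔ ¬ HoldsAfter x S.toList φ (Fin.cons u v : Fin (n + 1) → BinTree))
      (by omega) (fun u hu hS => by
        have hsz : ((evalTree (node x S) v).extend u).size + φ.length * x.size ≤ M := by
          have := (size_lt_of_mem_toList hu).trans_le x.size_left_le
          simp only [evalTree, extend, left_node, right_node, size_node] at hM ⊢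
          nlinarith
        rw [extend_evalTree] at hsz ⊢
        obtain ⟨y, T, h1, h2, h3, h4⟩ := hp x S (Fin.cons u v : Fin (n + 1) → BinTree) M hsz
        refine ⟨by omega, ?_⟩
        by_cases hy : y = nil
        · exact ⟨_, _, Run.branch_neg (hy ▸ h1) (run_yesProg _), by omega, by simp; omega,
            by simpa [hy] using h3⟩
        · exact ⟨_, _, Run.branch_pos h1 hy (Run.empty _), by omega, by simp; omega,
            by simpa [hy] using h3⟩)
    have h10 := mul_add_le_pow_mul (a := x.left.toList.length + 1) (l := φ.length) (H := h M)
      (by omega) le_rfl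
    rw [hel] at h2
    have h11 := h2.trans (Nat.mul_le_mul_left _ (show _ ≤
      (x.left.toList.length + 1) ^ φ.length * (φ.length * h M) + h M by omega))
    rcases h4 with ⟨rfl, h4⟩ | ⟨h4, u, hu, hS, h5⟩
    · refine ⟨_, _, Run.branch_neg h1 (run_yesProg _), by simp; omega, ?_, by omega⟩
      refine ⟨fun _ u hu => ?_, fun _ => by simp⟩
      exact not_not.1 fun hφ => (h4 u hu.1 hu.2).2 hφ rfl
    · refine ⟨_, _, Run.branch_pos h1 h4 (Run.empty _), by simp; omega, ?_, by omega⟩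
      simp only [ne_eq, not_true_eq_false, false_iff]
      exact fun hall => h5.1 h4 (hall u ⟨hu, hS⟩)
  | @ex n φ ih =>
    obtain ⟨p, hp⟩ := ih
    refine ⟨F p, fun x S v M hM => ?_⟩
    simp only [FOFormula.length] at hM ⊢
    have h7 := hbig x S v
    have h8 := hhM M
    have hel : (evalTree (node x S) v).elements = x.left.toList := rfl
    obtain ⟨y, T, h1, h2, h3, h4⟩ := hFind p (evalTree (node x S) v) M
      ((x.left.toList.length + 1) ^ φ.length * (φ.length * h M))
      (fun u y => y ≠ nil ↔ HoldsAfter x S.toList φ (Fin.cons u v : Fin (n + 1) → BinTree))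
      (by omega) (fun u hu hS => by
        have hsz : ((evalTree (node x S) v).extend u).size + φ.length * x.size ≤ M := by
          have := (size_lt_of_mem_toList hu).trans_le x.size_left_le
          simp only [evalTree, extend, left_node, right_node, size_node] at hM ⊢
          nlinarith
        rw [extend_evalTree] at hsz ⊢
        obtain ⟨y, T, h1, h2, h3, h4⟩ := hp x S (Fin.cons u v : Fin (n + 1) → BinTree) M hsz
        exact ⟨by omega, y, T, h1, h4, h2, h3⟩)
    refine ⟨y, T, h1, h3, ?_, ?_⟩
    · rcases h4 with ⟨rfl, h4⟩ | ⟨h4, u, hu, hS, h5⟩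
      · simp only [ne_eq, not_true_eq_false, false_iff]
        rintro ⟨u, hu, hφ⟩
        exact absurd ((h4 u hu.1 hu.2).2 hφ) (by simp)
      · exact ⟨fun _ => ⟨u, ⟨hu, hS⟩, h5.1 h4⟩, fun _ => h4⟩
    · have h10 := mul_add_le_pow_mul (a := x.left.toList.length + 1) (l := φ.length) (H := h M)
        (by omega) le_rfl
      rw [hel] at h2
      refine le_trans (h2.trans (Nat.mul_le_mul_left _ ?_)) ((Nat.le_add_right _ _).trans h10)
      omega

-- Preservation of existential formulas, and violating tuples.

theorem FOFormula.IsQuantifierFree.holdsOn_congr {ι : Type} {ar : ι → ℕ} {D D' : BinTree → Prop}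
    {I : (R : ι) → (Fin (ar R) → BinTree) → Prop} {n : ℕ} {φ : FOFormula ar n}
    (hφ : φ.IsQuantifierFree) (v : Fin n → BinTree) : φ.HoldsOn D I v ↔ φ.HoldsOn D' I v := by
  induction φ with
  | eq => exact Iff.rfl
  | rel => exact Iff.rfl
  | not φ ih => exact not_congr (ih hφ v)
  | and φ ψ ih₁ ih₂ => exact and_congr (ih₁ hφ.1 v) (ih₂ hφ.2 v)
  | or φ ψ ih₁ ih₂ => exact or_congr (ih₁ hφ.1 v) (ih₂ hφ.2 v)
  | imp φ ψ ih₁ ih₂ => exact imp_congr (ih₁ hφ.1 v) (ih₂ hφ.2 v)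
  | iff φ ψ ih₁ ih₂ => exact iff_congr (ih₁ hφ.1 v) (ih₂ hφ.2 v)
  | all => exact hφ.elim
  | ex => exact hφ.elim

/-- Witnesses stay available in a larger domain, and the kernel does not see the domain. Read
backwards: removing vertices never repairs a false existential formula. -/
theorem FOFormula.IsSigma.holdsOn_mono {ι : Type} {ar : ι → ℕ} {D D' : BinTree → Prop}
    {I : (R : ι) → (Fin (ar R) → BinTree) → Prop} (hD : ∀ u, D u → D' u) {n : ℕ}
    {φ : FOFormula ar n} (hφ : FOFormula.IsSigma 1 n φ) {v : Fin n → BinTree}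
    (h : φ.HoldsOn D I v) : φ.HoldsOn D' I v := by
  change FOFormula.ExPrefix (fun _ φ => φ.IsQuantifierFree) n φ at hφ
  induction hφ with
  | base hφ => exact (hφ.holdsOn_congr v).1 h
  | ex _ ih => exact h.imp fun u hu => ⟨hD u hu.1, ih hu.2⟩

-- `A` collects the values of the universal variables in a violated instance. A set that repairs the
-- formula must meet `A` or the assignment, since otherwise `FOFormula.IsSigma.holdsOn_mono` would
-- make the instance true already. The relation of `b` to the length counts `2` for each quantifier
-- and `3` for the rest.
open BinTree in
theorem exists_violation : ∃ h : ℕ → ℕ, NatPoly h ∧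
    ∀ {n : ℕ} {φ : FOFormula (fun _ : Unit => 2) n}, FOFormula.IsPi 2 n φ →
    ∃ (p : Prog) (b : ℕ), 2 * b + 3 ≤ φ.length ∧
      ∀ (x S : BinTree) (v : Fin n → BinTree) (M : ℕ),
      (evalTree (node x S) v).size + φ.length * x.size ≤ M →
      ∃ y T, Run p (evalTree (node x S) v) y T ∧ y.size ≤ M ∧
        T ≤ (x.left.toList.length + 1) ^ φ.length * (φ.length * h M) ∧
        ((y = nil ∧ HoldsAfter x S.toList φ v) ∨
          ∃ A : List BinTree, A.length ≤ b ∧ y = node (ofList (A ++ List.ofFn v)) nil ∧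
            (∀ u ∈ A, u ∈ x.left.toList) ∧
            ∀ L, HoldsAfter x (L ++ S.toList) φ v → ∃ u ∈ A ++ List.ofFn v, u ∈ L) := by
  obtain ⟨hE, hEp, heval⟩ := exists_eval
  obtain ⟨F, hF, hFp, hFind⟩ := exists_guardedFind
  refine ⟨fun M => hE M + hF M + (M + M + 2),
    (hEp.add hFp).add ((NatPoly.id.add .id).add (.const 2)), fun {n φ} hφ => ?_⟩
  change FOFormula.AllPrefix (FOFormula.IsSigma 1) n φ at hφ
  induction hφ with
  | @base n φ hφ =>
    obtain ⟨p, hp⟩ := heval φ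
    -- The violating list may be empty; the outer `node` keeps the answer different from `nil`.
    refine ⟨.branch p .empty (.pair .right .empty), 0, by simpa using φ.three_le_length,
      fun x S v M hM => ?_⟩
    obtain ⟨y, T, h1, h2, h3, h4⟩ := hp x S v M hM
    have hT : T + (M + M + 2) ≤ (x.left.toList.length + 1) ^ φ.length *
        (φ.length * (hE M + hF M + (M + M + 2))) := by
      have h5 : 1 ≤ (x.left.toList.length + 1) ^ φ.length * φ.length :=
        Nat.mul_pos (Nat.pow_pos (by omega)) (by have := φ.three_le_length; omega)
      nlinarith [Nat.le_mul_of_pos_left (hF M) h5, Nat.le_mul_of_pos_left (M + M + 2) h5]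
    have hle : (evalTree (node x S) v).size ≤ M := by omega
    by_cases hy : y = nil
    · refine ⟨_, _, Run.branch_neg (hy ▸ h1) (Run.pair (Run.right _) (Run.empty _)), ?_,
        by beta_reduce; omega,
        .inr ⟨[], le_rfl, rfl, by simp, fun L hL => ?_⟩⟩
      · have := x.size_pos
        have := S.size_pos
        simp only [evalTree, size_node, right_node, size_nil] at hle ⊢
        omega
      · refine absurd (hφ.holdsOn_mono (D' := Remaining x S.toList) ?_ hL)
          fun h => (h3.2 h) hy
        exact fun u hu => ⟨hu.1, fun h => hu.2 (List.mem_append_right _ h)⟩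
    · refine ⟨_, _, Run.branch_pos h1 hy (Run.empty _), ?_, by beta_reduce; omega, .inl ⟨rfl, h3.1 hy⟩⟩
      have := (evalTree (node x S) v).size_pos
      simp only [size_nil]
      omega
  | @all n φ _ ih =>
    obtain ⟨p, b, hb, hp⟩ := ih
    refine ⟨F p, b + 1, by simp only [FOFormula.length]; omega, fun x S v M hM => ?_⟩
    simp only [FOFormula.length] at hM ⊢
    set H := hE M + hF M + (M + M + 2) with hH
    obtain ⟨y, T, h1, h2, h3, h4⟩ := hFind p (evalTree (node x S) v) M
      ((x.left.toList.length + 1) ^ φ.length * (φ.length * H))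
      (fun u y => (y = nil ∧ HoldsAfter x S.toList φ (Fin.cons u v : Fin (n + 1) → BinTree)) ∨
          ∃ A : List BinTree, A.length ≤ b ∧
            y = node (ofList (A ++ List.ofFn (Fin.cons u v : Fin (n + 1) → BinTree))) nil ∧
            (∀ u ∈ A, u ∈ x.left.toList) ∧
            ∀ L, HoldsAfter x (L ++ S.toList) φ (Fin.cons u v : Fin (n + 1) → BinTree) →
              ∃ w ∈ A ++ List.ofFn (Fin.cons u v : Fin (n + 1) → BinTree), w ∈ L)
      (by omega) (fun u hu hS => by
        have hsz : ((evalTree (node x S) v).extend u).size + φ.length * x.size ≤ M := by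
          have := (size_lt_of_mem_toList hu).trans_le x.size_left_le
          simp only [evalTree, extend, left_node, right_node, size_node] at hM ⊢
          nlinarith
        rw [extend_evalTree] at hsz ⊢
        obtain ⟨y, T, h1, h2, h3, h4⟩ := hp x S (Fin.cons u v : Fin (n + 1) → BinTree) M hsz
        exact ⟨by omega, y, T, h1, h3, h2, h4⟩)
    have hel : (evalTree (node x S) v).elements = x.left.toList := rfl
    rw [hel] at h2 h4
    refine ⟨y, T, h1, h3, ?_, ?_⟩
    · refine le_trans (h2.trans (Nat.mul_le_mul_left _ (Nat.add_le_add_left (m := H) ?_ _)))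
        ((Nat.le_add_right _ _).trans (mul_add_le_pow_mul (by omega) le_rfl))
      omega
    · rcases h4 with ⟨rfl, h4⟩ | ⟨h4, u, hu, hS, h5⟩
      · refine .inl ⟨rfl, fun u hu => ?_⟩
        rcases h4 u hu.1 hu.2 with h | ⟨A, -, h, -⟩
        · exact h.2
        · cases h
      · obtain ⟨A, hA, rfl, hAx, h6⟩ := h5.resolve_left fun h => h4 h.1
        have e : A ++ List.ofFn (Fin.cons u v : Fin (n + 1) → BinTree) =
            (A ++ [u]) ++ List.ofFn v := by
          simp [List.ofFn_succ]
        refine .inr ⟨A ++ [u], by simpa using hA, by rw [e], ?_, fun L hL => ?_⟩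
        · simp only [List.mem_append, List.mem_singleton]
          rintro w (hw | rfl)
          · exact hAx w hw
          · exact hu
        -- Either `u` is removed, or it remains and its instance has to become true.
        · by_cases huL : u ∈ L
          · exact ⟨u, by simp, huL⟩
          · rw [← e]
            exact h6 L (hL u ⟨hu, fun h => (List.mem_append.1 h).elim huL hS⟩)

-- The branching rule.

/-- From the graph coded by `x`, from which `S` has been removed, at most `j` more vertices can be
removed so that the formula becomes true and the assigned vertices are kept. -/
def RemovableFrom (x : BinTree) (S : List BinTree) {n : ℕ} (φ : FOFormula (fun _ : Unit => 2) n)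
    (v : Fin n → BinTree) (j : ℕ) : Prop :=
  ∃ L : List BinTree, L.length ≤ j ∧ (∀ i, v i ∉ L ++ S) ∧ HoldsAfter x (L ++ S) φ v

theorem HoldsAfter.congr {x : BinTree} {S S' : List BinTree} (h : ∀ u, u ∈ S ↔ u ∈ S') {n : ℕ}
    {φ : FOFormula (fun _ : Unit => 2) n} {v : Fin n → BinTree} (hφ : HoldsAfter x S φ v) :
    HoldsAfter x S' φ v := by
  have : Remaining x S = Remaining x S' := by
    funext u
    simp only [Remaining, h]
  rwa [HoldsAfter, ← this]

section Branching

variable {x : BinTree} {S A : List BinTree} {n : ℕ} {φ : FOFormula (fun _ : Unit => 2) n}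
  {v : Fin n → BinTree}

theorem removableFrom_of_holdsAfter (hS : ∀ i, v i ∉ S) (h : HoldsAfter x S φ v) (j : ℕ) :
    RemovableFrom x S φ v j :=
  ⟨[], by simp, by simpa using hS, by simpa using h⟩

theorem not_removableFrom_zero
    (hA : ∀ L, HoldsAfter x (L ++ S) φ v → ∃ u ∈ A ++ List.ofFn v, u ∈ L) :
    ¬ RemovableFrom x S φ v 0 := by
  rintro ⟨L, hL, -, h⟩
  obtain ⟨u, -, hu⟩ := hA L h
  simp_all

/-- Every solution contains a member of the violating list, and not one of the assigned vertices;
that member can be removed right away, at the cost of one unit. -/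
theorem removableFrom_succ
    (hA : ∀ L, HoldsAfter x (L ++ S) φ v → ∃ u ∈ A ++ List.ofFn v, u ∈ L) (j : ℕ) :
    RemovableFrom x S φ v (j + 1) ↔
      ∃ u ∈ A ++ List.ofFn v, u ∉ List.ofFn v ∧ RemovableFrom x (u :: S) φ v j := by
  constructor
  · rintro ⟨L, hL, hv, h⟩
    obtain ⟨u, hu, huL⟩ := hA L h
    have hmem : ∀ w, w ∈ L ++ S ↔ w ∈ L.erase u ++ u :: S := fun w => by
      have := (List.perm_cons_erase huL).mem_iff (a := w)
      simp only [List.mem_append, List.mem_cons] at this ⊢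
      rw [this]
      tauto
    refine ⟨u, hu, fun hu' => ?_, L.erase u, ?_, fun i hi => hv i ((hmem _).2 hi), h.congr hmem⟩
    · obtain ⟨i, rfl⟩ := (List.mem_ofFn' _ _).1 hu'
      exact hv i (List.mem_append_left _ huL)
    · rw [List.length_erase_of_mem huL]
      omega
  · rintro ⟨u, -, -, L, hL, hv, h⟩
    have hmem : ∀ w, w ∈ L ++ u :: S ↔ w ∈ (u :: L) ++ S := fun w => by
      simp only [List.mem_append, List.mem_cons]
      tauto
    exact ⟨u :: L, by simpa using hL, fun i hi => hv i ((hmem _).2 hi), h.congr hmem⟩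

end Branching

-- The stack of the depth-first search, its size and its potential.

namespace BinTree

/-- The budget of an entry of the search stack: an entry consists of the list of the removed
vertices and of the number, in unary, of the vertices that may still be removed. -/
def budget (e : BinTree) : ℕ := e.right.toList.length

/-- The entries that follow the entry `e` when one of the members of `A` is removed that do not
belong to `B`. -/
def children (e A B : BinTree) : BinTree :=
  if e.right = nil then nil else
    collect (fun u => if u ∈ B.toList then nil else node (node (node u e.left) e.right.right) nil) A

theorem budget_eq_zero {e : BinTree} : budget e = 0 ↔ e.right = nil := by
  rw [budget]
  cases e.right <;> simp

theorem length_toList_right (t : BinTree) (h : t ≠ nil) :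
    t.right.toList.length + 1 = t.toList.length := by
  cases t with
  | nil => exact absurd rfl h
  | node a b => simp

theorem mem_children {e A B c : BinTree} : c ∈ (children e A B).toList ↔
    e.right ≠ nil ∧ ∃ u ∈ A.toList, u ∉ B.toList ∧ c = node (node u e.left) e.right.right := by
  by_cases h : e.right = nil
  · simp [children, h]
  · simp only [children, h, if_false, mem_collect, ne_eq, not_false_eq_true, true_and]
    refine exists_congr fun u => and_congr_right fun _ => ?_
    by_cases hu : u ∈ B.toList <;> simp [hu]

theorem budget_of_mem_children {e A B c : BinTree} (h : c ∈ (children e A B).toList) :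
    budget c + 1 = budget e := by
  obtain ⟨he, u, -, -, rfl⟩ := mem_children.1 h
  exact length_toList_right _ he

theorem length_collect {F : BinTree → BinTree} (l : BinTree) :
    (collect F l).toList.length = (l.toList.map fun u => (F u).toList.length).sum := by
  have : ∀ (l : List BinTree) (b : BinTree),
      (l.foldl (fun s u => revAppend (F u) s) b).toList.length =
        (l.map fun u => (F u).toList.length).sum + b.toList.length := by
    intro l
    induction l with
    | nil => simp
    | cons u l ih =>
      intro b
      simp only [List.foldl_cons, ih, toList_revAppend, List.length_append, List.length_reverse,
        List.map_cons, List.sum_cons]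
      omega
  simpa [collect] using this l.toList nil

/-- Protected vertices have no child, so the second part of the list does not count. -/
theorem length_children_le (e : BinTree) (A B : List BinTree) :
    (children e (ofList (A ++ B)) (ofList B)).toList.length ≤ A.length := by
  by_cases h : e.right = nil
  · simp [children, h]
  · simp only [children, h, if_false, length_collect, toList_ofList, List.map_append,
      List.sum_append]
    have h1 : ∀ l : List BinTree, (l.map fun u => (if u ∈ B then nil
        else node (node (node u e.left) e.right.right) nil).toList.length).sum ≤ l.length := by
      intro l
      induction l with
      | nil => simp
      | cons u l ih =>
        simp only [List.map_cons, List.sum_cons, List.length_cons]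
        split_ifs <;> simp <;> omega
    have h2 : ∀ l : List BinTree, (∀ u ∈ l, u ∈ B) → (l.map fun u => (if u ∈ B then nil
        else node (node (node u e.left) e.right.right) nil).toList.length).sum = 0 := by
      intro l hl
      refine List.sum_eq_zero fun t ht => ?_
      obtain ⟨u, hu, rfl⟩ := List.mem_map.1 ht
      simp [hl u hu]
    have := h1 A
    have := h2 B fun _ h => h
    omega

/-- In the stack `l` of the depth-first search with branching factor `b` and depth `k`, there are
at most `b` entries for every level above the current one. -/
def StackBounded (b k : ℕ) : List BinTree → Prop
  | [] => True
  | e :: l => l.length + b * budget e ≤ b * k ∧ StackBounded b k l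

theorem StackBounded.length_le {b k : ℕ} {l : List BinTree} (h : StackBounded b k l) :
    l.length ≤ b * k + 1 := by
  cases l with
  | nil => simp
  | cons e l =>
    have := h.1
    simp only [List.length_cons]
    omega

theorem StackBounded.append {b k j : ℕ} {l l' : List BinTree} (h : StackBounded b k l)
    (hl' : ∀ e ∈ l', budget e = j) (hj : l.length + l'.length + b * j ≤ b * k) :
    StackBounded b k (l' ++ l) := by
  induction l' with
  | nil => exact h
  | cons e l' ih =>
    simp only [List.length_cons] at hj
    refine ⟨?_, ih (fun e he => hl' e (by simp [he])) (by omega)⟩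
    rw [hl' e (by simp)]
    show (l' ++ l).length + _ ≤ _
    rw [List.length_append]
    omega

/-- An upper bound for the number of the steps of the search. -/
def potential (b : ℕ) (l : List BinTree) : ℕ := (l.map fun e => (b + 1) ^ budget e).sum

theorem potential_append (b : ℕ) (l l' : List BinTree) :
    potential b (l ++ l') = potential b l + potential b l' := by
  simp [potential]

theorem potential_reverse (b : ℕ) (l : List BinTree) : potential b l.reverse = potential b l :=
  ((List.reverse_perm l).map _).sum_eq

theorem potential_eq {b j : ℕ} {l : List BinTree} (h : ∀ e ∈ l, budget e = j) :
    potential b l = l.length * (b + 1) ^ j := by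
  induction l with
  | nil => simp [potential]
  | cons e l ih =>
    have h1 := ih fun e he => h e (by simp [he])
    rw [potential] at h1 ⊢
    rw [List.map_cons, List.sum_cons, h1, h e (by simp), List.length_cons]
    ring

/-- At most `b` children of weight `(b + 1) ^ j` replace an entry of weight `(b + 1) * (b + 1) ^ j`.
-/
theorem potential_children_lt {b : ℕ} {e A B : BinTree}
    (h : (children e A B).toList.length ≤ b) :
    potential b (children e A B).toList < (b + 1) ^ budget e := by
  cases hj : budget e with
  | zero =>
    have : e.right = nil := budget_eq_zero.1 hj
    simp [children, this, potential]
  | succ j =>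
    rw [potential_eq (j := j) fun c hc => by have := budget_of_mem_children hc; omega]
    have h1 : 0 < (b + 1) ^ j := Nat.pow_pos (by omega)
    rw [pow_succ]
    nlinarith

end BinTree

theorem PolyTime.children {e A B : BinTree → BinTree} (he : PolyTime e) (hA : PolyTime A)
    (hB : PolyTime B) : PolyTime fun x => BinTree.children (e x) (A x) (B x) := by
  have hid := PolyTime.id
  refine .ite (.eq he.right .nil) .nil (.collect (.ite ?_ .nil ?_) hA)
  · exact .mem hid.right (hB.comp hid.left)
  · exact ((hid.right.node (he.comp hid.left).left).node (he.comp hid.left).right.right).node .nil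

/-- A bound for the size of the states of the depth-first search. -/
def searchSpace (l k s : ℕ) : ℕ := (l * k + 1) * (k * (s + 1) + 2 * k + 4) + l * s + 10

/-- The invariant of the stack of the depth-first search. -/
structure SearchStack (b k s : ℕ) {n : ℕ} (v : Fin n → BinTree) (l : List BinTree) : Prop where
  left_size : ∀ e ∈ l, e.left.size + e.budget * (s + 1) ≤ k * (s + 1) + 1
  right_size : ∀ e ∈ l, e.right.size ≤ 2 * k + 1
  kept : ∀ e ∈ l, ∀ i, v i ∉ e.left.toList
  bounded : BinTree.StackBounded b k l

namespace SearchStack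

open BinTree

variable {b k s n : ℕ} {v : Fin n → BinTree} {l : List BinTree}

theorem size_le (h : SearchStack b k s v l) {c : ℕ} (hc : b ≤ c) :
    (ofList l).size ≤ (c * k + 1) * (k * (s + 1) + 2 * k + 4) + 1 := by
  refine (size_ofList_le (M := k * (s + 1) + 2 * k + 3) l fun e he => ?_).trans ?_
  · have h1 := h.left_size e he
    have h2 := h.right_size e he
    have h3 : e.size ≤ e.left.size + e.right.size + 1 := by
      cases e <;> simp
    omega
  · have h1 := h.bounded.length_le
    have h2 : b * k ≤ c * k := Nat.mul_le_mul_right _ hc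
    gcongr
    omega

theorem tail {e : BinTree} (h : SearchStack b k s v (e :: l)) : SearchStack b k s v l :=
  ⟨fun c hc => h.left_size c (by simp [hc]), fun c hc => h.right_size c (by simp [hc]),
    fun c hc => h.kept c (by simp [hc]), h.bounded.2⟩

theorem push {e : BinTree} {A : List BinTree} (h : SearchStack b k s v (e :: l))
    (hA : A.length ≤ b) (hs : ∀ u ∈ A, u.size ≤ s) :
    SearchStack b k s v ((children e (ofList (A ++ List.ofFn v)) (ofList (List.ofFn v))).toList.reverse
      ++ l) := by
  have hchild : ∀ c ∈ (children e (ofList (A ++ List.ofFn v)) (ofList (List.ofFn v))).toList,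
      e.right ≠ nil ∧ ∃ u ∈ A, u ∉ List.ofFn v ∧ c = node (node u e.left) e.right.right := by
    intro c hc
    obtain ⟨h1, u, hu, hv, rfl⟩ := mem_children.1 hc
    rw [toList_ofList] at hu hv
    exact ⟨h1, u, (List.mem_append.1 hu).resolve_right hv, hv, rfl⟩
  have ht := h.tail
  have hlen := length_children_le e A (List.ofFn v)
  refine ⟨fun c hc => ?_, fun c hc => ?_, fun c hc => ?_, ?_⟩
  · rw [List.mem_append, List.mem_reverse] at hc
    rcases hc with hc | hc
    · obtain ⟨-, u, hu, -, e'⟩ := hchild c hc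
      have h1 := budget_of_mem_children hc
      have h2 := h.left_size e (by simp)
      have h3 := hs u hu
      rw [e', left_node, size_node, ← e']
      rw [← h1] at h2
      nlinarith
    · exact ht.left_size c hc
  · rw [List.mem_append, List.mem_reverse] at hc
    rcases hc with hc | hc
    · obtain ⟨-, u, -, -, rfl⟩ := hchild c hc
      exact (size_right_le e.right).trans (h.right_size e (by simp))
    · exact ht.right_size c hc
  · rw [List.mem_append, List.mem_reverse] at hc
    rcases hc with hc | hc
    · obtain ⟨-, u, -, hu, rfl⟩ := hchild c hc
      intro i hi
      rw [left_node, toList_node, List.mem_cons] at hi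
      rcases hi with hi | hi
      · exact hu (hi ▸ (List.mem_ofFn' _ _).2 ⟨i, rfl⟩)
      · exact h.kept e (by simp) i hi
    · exact ht.kept c hc
  · rcases hb : budget e with _ | j
    · have : e.right = nil := budget_eq_zero.1 hb
      simpa [children, this] using ht.bounded
    -- The children have one unit of budget less than their parent, which frees room for `b` more
    -- entries.
    · refine ht.bounded.append (j := j) (fun c hc => ?_) ?_
      · have := budget_of_mem_children (List.mem_reverse.1 hc)
        omega
      · have h1 := h.bounded.1
        rw [hb] at h1
        rw [List.length_reverse]
        nlinarith

end SearchStack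

-- The search tree and the guess of the leading existential variables.

open BinTree in
theorem exists_mem_children_removableFrom {x e : BinTree} {A : List BinTree} {n : ℕ}
    {φ : FOFormula (fun _ : Unit => 2) n} {v : Fin n → BinTree}
    (hA : ∀ L, HoldsAfter x (L ++ e.left.toList) φ v → ∃ u ∈ A ++ List.ofFn v, u ∈ L) :
    RemovableFrom x e.left.toList φ v e.budget ↔
      ∃ c ∈ (children e (ofList (A ++ List.ofFn v)) (ofList (List.ofFn v))).toList,
        RemovableFrom x c.left.toList φ v c.budget := by
  rcases hb : budget e with _ | j
  · have : e.right = nil := budget_eq_zero.1 hb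
    simpa [children, this] using not_removableFrom_zero hA
  · have hr : e.right ≠ nil := fun h => by rw [budget_eq_zero.2 h] at hb; omega
    have hj : e.right.right.toList.length = j := by
      have := length_toList_right _ hr
      rw [budget] at hb
      omega
    rw [removableFrom_succ hA]
    simp only [mem_children, toList_ofList]
    constructor
    · rintro ⟨u, hu, hv, h⟩
      exact ⟨_, ⟨hr, u, hu, hv, rfl⟩, by simpa [budget, hj] using h⟩
    · rintro ⟨_, ⟨-, u, hu, hv, rfl⟩, h⟩
      exact ⟨u, hu, hv, by simpa [budget, hj] using h⟩

-- Each round takes the top entry and looks for a violation: if there is none the search succeeds,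
-- otherwise the children replace the entry. The potential starts at `(b + 1) ^ k` and drops in
-- every round, which bounds the number of rounds, while `SearchStack` keeps the states small.
open BinTree in
theorem exists_search : ∃ h : ℕ → ℕ, NatPoly h ∧
    ∀ {n : ℕ} {φ : FOFormula (fun _ : Unit => 2) n}, FOFormula.IsPi 2 n φ →
    ∃ (p : Prog) (b : ℕ), 2 * b + 3 ≤ φ.length ∧ ∀ (x : BinTree) (k : ℕ) (v : Fin n → BinTree)
      (M : ℕ), (evalTree (node x (ofNat k)) v).size + searchSpace φ.length k x.size ≤ M →
      ∃ y T, Run p (evalTree (node x (ofNat k)) v) y T ∧ y.size ≤ M ∧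
        (y ≠ nil ↔ RemovableFrom x [] φ v k) ∧
        T ≤ (x.left.toList.length + 1) ^ φ.length * (φ.length * ((b + 1) ^ k * h M)) := by
  have hid := PolyTime.id
  obtain ⟨hV, hVp, hviol⟩ := exists_violation
  obtain ⟨pI, hI, hIp, hIr⟩ := (hid.node (((PolyTime.nil.node hid.left.right).node .nil).node
    .nil)).exists_natPoly
  obtain ⟨pC, hC, hCp, hCr⟩ := (hid.right.right.iteNil .nil hid.right.left).exists_natPoly
  obtain ⟨pE, hE, hEp, hEr⟩ := ((hid.left.left.left.node hid.right.left.left.left).node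
    hid.left.right).exists_natPoly
  obtain ⟨pN, hN, hNp, hNr⟩ := (hid.right.iteNil
    (hid.left.left.node (((hid.left.right.left.left.children hid.right.left
      hid.left.left.right).revAppend hid.left.right.left.right).node .nil))
    (hid.left.left.node (hid.left.right.left.node (.const (node nil nil))))).exists_natPoly
  obtain ⟨pO, hO, hOp, hOr⟩ := hid.right.right.exists_natPoly
  have hlin : NatPoly fun M => 2 * M + 1 := ((NatPoly.const 2).mul .id).add (.const 1)
  let r : ℕ → ℕ := fun M => hC M + hE M + hN (2 * M + 1) + M + 4
  let s : ℕ → ℕ := fun M => hI M + hO M + 2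
  refine ⟨fun M => 2 * hV M + 2 * r M + s M, ?_, fun {n φ} hφ => ?_⟩
  · have hr : NatPoly r := (((hCp.add hEp).add (hNp.comp hlin)).add .id).add (.const 4)
    have hs : NatPoly s := (hIp.add hOp).add (.const 2)
    exact (((NatPoly.const 2).mul hVp).add ((NatPoly.const 2).mul hr)).add hs
  obtain ⟨p, b, hb, hp⟩ := hviol hφ
  refine ⟨.seq pI (.seq (.loop pC (.seq (.pair .ident (.seq pE p)) pN)) pO), b, hb,
    fun x k v M hM => ?_⟩
  set env := evalTree (node x (ofNat k)) v with henv
  set Q := (x.left.toList.length + 1) ^ φ.length * φ.length with hQ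
  have hQ1 : 1 ≤ Q := Nat.mul_pos (Nat.pow_pos (by omega)) (by omega)
  have hM' : env.size + ((φ.length * k + 1) * (k * (x.size + 1) + 2 * k + 4) +
    φ.length * x.size + 10) ≤ M := hM
  have hEk : k * (x.size + 1) + 2 * k + 4 ≤
      (φ.length * k + 1) * (k * (x.size + 1) + 2 * k + 4) :=
    Nat.le_mul_of_pos_left _ (by omega)
  let Inv : ℕ → BinTree → Prop := fun m σ =>
    (∃ l, σ = node env (node (ofList l) nil) ∧ m = potential b l ∧ SearchStack b k x.size v l ∧
      (RemovableFrom x [] φ v k ↔ ∃ e ∈ l, RemovableFrom x e.left.toList φ v e.budget)) ∨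
    (∃ l, σ = node env (node (ofList l) (node nil nil)) ∧ SearchStack b k x.size v l ∧
      RemovableFrom x [] φ v k)
  have hsize : ∀ m σ, Inv m σ → σ.size ≤ M := by
    rintro m σ (⟨l, rfl, -, h, -⟩ | ⟨l, rfl, h, -⟩) <;>
    · have := h.size_le (c := φ.length) (by omega)
      simp only [size_node, size_nil]
      omega
  obtain ⟨T₀, hr₀, hT₀⟩ := hIr env M (by omega)
  have hloop := Run.exists_loop (c := pC) (b := .seq (.pair .ident (.seq pE p)) pN)
    (A := Q * hV M + hC M + hE M + hN (2 * M + 1) + M + 3) Inv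
    (fun σ => σ.right.right ≠ nil ∨ σ.right.left = nil) (by
      intro m σ hσ
      have hsz := hsize m σ hσ
      obtain ⟨Tc, hc, hTc⟩ := hCr σ M hsz
      rcases hσ with ⟨l, rfl, rfl, hl, hans⟩ | ⟨l, rfl, -, -⟩
      · cases l with
        | nil =>
          left
          exact ⟨.inr rfl, Tc, by omega, by simpa using hc⟩
        | cons e l =>
          right
          obtain ⟨Te, he, hTe⟩ := hEr _ M hsz
          have hev : (node (node env.left.left e.left) env.right) =
            evalTree (node x e.left) v := rfl
          simp only [left_node, right_node, ofList_cons] at he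
          rw [hev] at he
          have hkept := hl.kept e (by simp)
          have hsmall : (evalTree (node x e.left) v).size + φ.length * x.size ≤ M := by
            have := hl.left_size e (by simp)
            have h1 : env.size = x.size + (ofNat k).size + 1 + (ofList (List.ofFn v)).size + 1 := rfl
            simp only [evalTree, size_node]
            omega
          obtain ⟨y, Tp, hpr, hys, hTp, hy⟩ := hp x e.left v M hsmall
          obtain ⟨Tn, hn, hTn⟩ := hNr (node (node env (node (ofList (e :: l)) nil)) y) (2 * M + 1)
            (by simp only [size_node] at hsz ⊢; omega)
          have hTp' : Tp ≤ Q * hV M := by rw [hQ, mul_assoc]; exact hTp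
          have hcne : (if (node env (node (ofList (e :: l)) nil)).right.right = nil then
              (node env (node (ofList (e :: l)) nil)).right.left else nil) ≠ nil := by simp
          rcases hy with ⟨rfl, hh⟩ | ⟨A, hA, rfl, hAx, hviolA⟩
          · refine ⟨0, ?_, _, node env (node (ofList (e :: l)) (node nil nil)), Tc, _,
              .inr ⟨_, rfl, hl, hans.2 ⟨e, by simp, removableFrom_of_holdsAfter hkept hh _⟩⟩, hc,
              hcne, Run.seq (Run.pair (Run.ident _) (Run.seq he hpr)) hn, by omega⟩
            have : 0 < (b + 1) ^ budget e := Nat.pow_pos (by omega)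
            simp only [potential, List.map_cons, List.sum_cons]
            omega
          · refine ⟨_, ?_, _, node env (node (ofList ((children e (ofList (A ++ List.ofFn v))
              (ofList (List.ofFn v))).toList.reverse ++ l)) nil), Tc, _,
              .inl ⟨_, rfl, rfl, hl.push hA fun u hu =>
                ((size_lt_of_mem_toList (hAx u hu)).trans_le x.size_left_le).le, ?_⟩, hc,
              hcne, Run.seq (Run.pair (Run.ident _) (Run.seq he hpr)) (T₂ := Tn) ?_, by omega⟩
            · rw [potential_append, potential_reverse]
              have := potential_children_lt (b := b) (e := e) (A := ofList (A ++ List.ofFn v))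
                (B := ofList (List.ofFn v)) ((length_children_le e A _).trans hA)
              simp only [potential, List.map_cons, List.sum_cons] at this ⊢
              omega
            · rw [hans, List.exists_mem_cons_iff, exists_mem_children_removableFrom hviolA]
              simp only [List.mem_append, List.mem_reverse, or_and_right, exists_or]
            · have e1 : revAppend (children e (ofList (A ++ List.ofFn v)) (ofList (List.ofFn v)))
                  (ofList l) = ofList ((children e (ofList (A ++ List.ofFn v))
                    (ofList (List.ofFn v))).toList.reverse ++ l) := by
                rw [← ofList_toList (revAppend _ _), toList_revAppend, toList_ofList]
              rw [← e1]
              exact hn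
      · left
        exact ⟨.inl (by simp), Tc, by omega, by simpa using hc⟩)
    ((b + 1) ^ k) (node env (node (node (node nil (ofNat k)) nil) nil)) (by
      refine .inl ⟨[node nil (ofNat k)], rfl, ?_, ⟨?_, ?_, ?_, ?_⟩, ?_⟩
      · simp [potential, budget]
      · simp [budget]; omega
      · simp
      · simp
      · simp [StackBounded, budget]
      · simp [budget])
  obtain ⟨σ, m, T₁, hInv, hD, hr₁, hT₁⟩ := hloop
  obtain ⟨T₂, hr₂, hT₂⟩ := hOr σ M (hsize _ _ hInv)
  refine ⟨_, _, Run.seq hr₀ (Run.seq hr₁ hr₂), (size_right_le _).trans ((size_right_le _).trans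
    (hsize _ _ hInv)), ?_, ?_⟩
  · rcases hInv with ⟨l, rfl, -, -, hans⟩ | ⟨l, rfl, -, hans⟩
    · have hl : l = [] := by
        rcases hD with hD | hD
        · exact absurd rfl hD
        · cases l with
          | nil => rfl
          | cons u l => simp at hD
      simp [hans, hl]
    · simp [hans]
  · have hW : 1 ≤ (b + 1) ^ k := Nat.one_le_pow _ _ (by omega)
    set W := (b + 1) ^ k
    have h1 : T₁ ≤ (W + 1) * (Q * hV M + r M) := hT₁.trans_eq (by simp only [r]; ring)
    have h2 : T₀ + T₂ + 2 ≤ s M := by show _ ≤ hI M + hO M + 2; omega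
    have h3 : (W + 1) * (Q * hV M + r M) ≤ 2 * W * (Q * hV M + Q * r M) :=
      Nat.mul_le_mul (by omega) (Nat.add_le_add_left (Nat.le_mul_of_pos_left _ hQ1) _)
    have h4 : s M ≤ Q * W * s M := Nat.le_mul_of_pos_left _ (Nat.mul_pos hQ1 hW)
    calc T₀ + (T₁ + T₂ + 1) + 1 = T₁ + (T₀ + T₂ + 2) := by ring
      _ ≤ 2 * W * (Q * hV M + Q * r M) + Q * W * s M :=
        Nat.add_le_add (h1.trans h3) (h2.trans h4)
      _ = _ := by rw [hQ]; ring

-- The leading variables and the removed set are both chosen existentially, so the variables may be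
-- fixed first, provided that they are kept; this is why `RemovableFrom` protects the assignment.
-- Nothing has been removed yet, so the search needs no guard.
open BinTree in
theorem exists_prefixSearch : ∃ h : ℕ → ℕ, NatPoly h ∧
    ∀ {n : ℕ} {φ : FOFormula (fun _ : Unit => 2) n}, FOFormula.IsSigma 3 n φ →
    ∃ (p : Prog) (b : ℕ), 2 * b + 3 ≤ φ.length ∧ ∀ (x : BinTree) (k : ℕ) (v : Fin n → BinTree)
      (M : ℕ), (evalTree (node x (ofNat k)) v).size + searchSpace φ.length k x.size ≤ M →
      ∃ y T, Run p (evalTree (node x (ofNat k)) v) y T ∧ y.size ≤ M ∧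
        (y ≠ nil ↔ RemovableFrom x [] φ v k) ∧
        T ≤ (x.left.toList.length + 1) ^ φ.length * (φ.length * ((b + 1) ^ k * h M)) := by
  obtain ⟨hS, hSp, hsearch⟩ := exists_search
  obtain ⟨F, hF, hFp, hFind⟩ := exists_find
  refine ⟨fun M => hS M + hF M, hSp.add hFp, fun {n φ} hφ => ?_⟩
  change FOFormula.ExPrefix (FOFormula.IsPi 2) n φ at hφ
  induction hφ with
  | @base n φ hφ =>
    obtain ⟨p, b, hb, hp⟩ := hsearch hφ
    refine ⟨p, b, hb, fun x k v M hM => ?_⟩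
    obtain ⟨y, T, h1, h2, h3, h4⟩ := hp x k v M hM
    refine ⟨y, T, h1, h2, h3, h4.trans ?_⟩
    gcongr
    exact Nat.le_add_right _ _
  | @ex n φ _ ih =>
    obtain ⟨p, b, hb, hp⟩ := ih
    refine ⟨F p, b, by simp only [FOFormula.length]; omega, fun x k v M hM => ?_⟩
    simp only [FOFormula.length] at hM ⊢
    set H := (b + 1) ^ k * (hS M + hF M) with hH
    obtain ⟨y, T, h1, h2, h3, h4⟩ := hFind p (evalTree (node x (ofNat k)) v) M
      ((x.left.toList.length + 1) ^ φ.length * (φ.length * H))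
      (fun u y => y ≠ nil ↔ RemovableFrom x [] φ (Fin.cons u v : Fin (n + 1) → BinTree) k)
      (by omega) (fun u hu => by
        have hsz : ((evalTree (node x (ofNat k)) v).extend u).size +
            searchSpace φ.length k x.size ≤ M := by
          have h1 := (size_lt_of_mem_toList hu).trans_le x.size_left_le
          have h2 : searchSpace φ.length k x.size + x.size ≤
              searchSpace (φ.length + 2) k x.size := by
            have : (φ.length * k + 1) * (k * (x.size + 1) + 2 * k + 4) ≤
                ((φ.length + 2) * k + 1) * (k * (x.size + 1) + 2 * k + 4) := by
              gcongr
              omega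
            simp only [searchSpace]
            nlinarith
          simp only [evalTree, extend, left_node, right_node, size_node] at hM ⊢
          omega
        rw [extend_evalTree] at hsz ⊢
        obtain ⟨y, T, h1, h2, h3, h4⟩ := hp x k (Fin.cons u v : Fin (n + 1) → BinTree) M hsz
        exact ⟨y, T, h1, h4, h2, h3⟩)
    have hel : (evalTree (node x (ofNat k)) v).elements = x.left.toList := rfl
    rw [hel] at h2 h4
    refine ⟨y, T, h1, h3, ?_, ?_⟩
    · have hex : RemovableFrom x [] (.ex φ) v k ↔ ∃ u ∈ x.left.toList,
          RemovableFrom x [] φ (Fin.cons u v : Fin (n + 1) → BinTree) k := by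
        constructor
        · rintro ⟨L, hL, hv, u, hu, h⟩
          exact ⟨u, hu.1, L, hL, fun i => Fin.cases hu.2 hv i, h⟩
        · rintro ⟨u, hu, L, hL, hv, h⟩
          exact ⟨L, hL, fun i => hv i.succ, u, ⟨hu, hv 0⟩, h⟩
      rw [hex]
      rcases h4 with ⟨rfl, h4⟩ | ⟨h4, u, hu, h5⟩
      · simp only [ne_eq, not_true_eq_false, false_iff]
        rintro ⟨u, hu, hφ⟩
        exact (h4 u hu).2 hφ rfl
      · exact ⟨fun _ => ⟨u, hu, h5.1 h4⟩, fun _ => h4⟩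
    · refine le_trans (h2.trans (Nat.mul_le_mul_left _ (Nat.add_le_add_left (m := H) ?_ _)))
        ((Nat.le_add_right _ _).trans (mul_add_le_pow_mul (by omega) le_rfl))
      exact (Nat.le_add_left _ _).trans (Nat.le_mul_of_pos_left _ (Nat.pow_pos (by omega)))

-- From graphs to their codes.

/-- Stated for an arbitrary injective coding of the vertices, to cover coded graphs and standard
codes alike. Repetitions and trees that are no vertices in the list `L` only waste budget. -/
theorem vertexRemovable_iff {V : Type} (G : SimpleGraph V) (φ : GraphSentence) (k : ℕ)
    {x : BinTree} {f : V → BinTree} (hf : Function.Injective f)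
    (hx : ∀ t, t ∈ x.left.toList ↔ ∃ u, f u = t)
    (hadj : ∀ u w, G.Adj u w ↔ f u ≠ f w ∧
      (.node (f u) (f w) ∈ x.right.toList ∨ .node (f w) (f u) ∈ x.right.toList)) :
    VertexRemovable φ G k ↔ RemovableFrom x [] φ Fin.elim0 k := by
  classical
  have key : ∀ (S : Finset V) (L : List BinTree), (∀ u, f u ∈ L ↔ u ∈ S) →
      (GraphModels (G.induce {v | v ∉ S}) φ ↔ HoldsAfter x (L ++ []) φ Fin.elim0) := by
    intro S L hSL
    rw [GraphModels, FOFormula.holds_iff_holdsOn (D := Remaining x (L ++ [])) (I := graphRel x)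
      (f := fun u : {v | v ∉ S} => f u.1) (hf.comp Subtype.val_injective)]
    · rw [HoldsAfter, show ((fun u : {v | v ∉ S} => f u.1) ∘ (Fin.elim0 : Fin 0 → {v | v ∉ S})) =
        Fin.elim0 from funext fun i => i.elim0]
    · intro t
      rw [Remaining, hx, List.append_nil]
      constructor
      · rintro ⟨⟨u, rfl⟩, hu⟩
        exact ⟨⟨u, fun h => hu ((hSL u).2 h)⟩, rfl⟩
      · rintro ⟨u, rfl⟩
        exact ⟨⟨u.1, rfl⟩, fun h => u.2 ((hSL u.1).1 h)⟩
    · exact fun _ v => hadj _ _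
  constructor
  · rintro ⟨S, hS, h⟩
    refine ⟨S.toList.map f, by simpa using hS, fun i => i.elim0, (key S _ fun u => ?_).1 h⟩
    simp [hf.eq_iff]
  · rintro ⟨L, hL, -, h⟩
    refine ⟨L.toFinset.preimage f hf.injOn, ?_, (key _ L fun u => by simp).2 h⟩
    refine le_trans ?_ (L.toFinset_card_le.trans hL)
    exact Finset.card_le_card_of_injOn f (fun u hu => by simpa using hu) hf.injOn

theorem mem_vertexRemoval_iff (φ : GraphSentence) (x : BinTree) (k : ℕ) :
    (x, k) ∈ vertexRemoval φ ↔ RemovableFrom x [] φ Fin.elim0 k :=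
  vertexRemovable_iff (codedGraph x) φ k Subtype.val_injective
    (fun t => ⟨fun h => ⟨⟨t, h⟩, rfl⟩, by rintro ⟨u, rfl⟩; exact u.2⟩)
    fun u w => and_congr_left' (not_congr Subtype.ext_iff)

-- The final time bounds.

/-- This absorbs the polynomial dependence on `k` into the factor `2 ^ k` that `(b + 1) ^ k` leaves
free in `φ.length ^ k`. -/
theorem exists_succ_pow_le (c : ℕ) : ∃ K : ℕ, ∀ k : ℕ, (k + 1) ^ c ≤ K * 2 ^ k := by
  obtain ⟨B, hB⟩ := (tendsto_pow_const_div_const_pow_of_one_lt c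
    (one_lt_two (α := ℝ))).bddAbove_range
  refine ⟨⌈B⌉₊ * 2, fun k => ?_⟩
  have h : ((k + 1 : ℕ) : ℝ) ^ c / 2 ^ (k + 1) ≤ ⌈B⌉₊ :=
    (hB ⟨k + 1, rfl⟩).trans (Nat.le_ceil B)
  rw [div_le_iff₀ (by positivity)] at h
  rw [mul_assoc, ← pow_succ']
  exact_mod_cast h

open BinTree in
theorem exists_decider : ∃ C : ℕ, ∀ φ : GraphSentence, FOFormula.IsSigma 3 0 φ →
    ∃ p : Prog, ∀ x k, DecidesWithin p x k (RemovableFrom x [] φ Fin.elim0 k)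
      (φ.length ^ k * (x.size + 1) ^ (C * φ.length)) := by
  obtain ⟨h, hh, hprog⟩ := exists_prefixSearch
  -- The search and the preparation of its input are bounded by one polynomial in `M`.
  obtain ⟨c, hc⟩ := hh.add (((NatPoly.const 2).mul .id).add (.const 2))
  obtain ⟨K, hK⟩ := exists_succ_pow_le (2 * c)
  -- Measured in powers of `Y ^ l`: `2` for the factors `Y ^ l` and `l`, `5 * c` for `20 ^ c ≤ 2 ^
  -- (5 * c)`, `c` each for `l ^ c` and `Y ^ c`, and `K` for the constant from `exists_succ_pow_le`.
  refine ⟨2 + 7 * c + K, fun φ hφ => ?_⟩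
  obtain ⟨p, b, hb, hp⟩ := hprog hφ
  refine ⟨.seq (.pair .ident .empty) p, fun x k => ?_⟩
  set l := φ.length
  set Y := x.size + 1 with hY
  set M := (evalTree (node x (ofNat k)) (Fin.elim0 : Fin 0 → BinTree)).size +
    searchSpace l k x.size with hM
  obtain ⟨y, T, h1, -, h3, h4⟩ := hp x k Fin.elim0 M le_rfl
  have hrun : Run (.pair .ident .empty) (inputTree x k)
      (evalTree (node x (ofNat k)) Fin.elim0)
      ((inputTree x k).size + (inputTree x k).size + 1) := by
    rw [evalTree_elim0]
    exact Run.pair (Run.ident _) (Run.empty _)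
  refine ⟨y, _, Run.seq hrun h1, ?_, h3⟩
  have hx := x.size_pos
  have hY2 : 2 ≤ Y := by omega
  have hsz : (evalTree (node x (ofNat k)) (Fin.elim0 : Fin 0 → BinTree)).size =
      x.size + 2 * k + 4 := by
    rw [evalTree_elim0]
    simp
    omega
  have hin := inputTree_size x k
  have hl1 : 1 ≤ l := by omega
  have hM1 : M + 2 ≤ 20 * l * (k + 1) ^ 2 * Y := by
    have h1 : l * k + 1 ≤ l * (k + 1) := by rw [mul_add]; omega
    have h2 : k * Y + 2 * k + 4 ≤ 2 * ((k + 1) * Y) := by nlinarith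
    have h3 : (l * k + 1) * (k * Y + 2 * k + 4) ≤ 2 * (l * (k + 1) ^ 2 * Y) :=
      (Nat.mul_le_mul h1 h2).trans (by apply le_of_eq; ring)
    have h4 : (k + 1) * Y ≤ l * (k + 1) ^ 2 * Y := by
      rw [pow_two, ← mul_assoc]
      gcongr
      exact Nat.le_mul_of_pos_left _ (by positivity)
    have h5 : l * Y ≤ l * (k + 1) ^ 2 * Y := by
      gcongr
      exact Nat.le_mul_of_pos_right _ (by positivity)
    rw [hM, hsz, searchSpace, ← hY]
    have h6 : l * x.size ≤ l * Y := by gcongr; omega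
    have h7 : 2 * k + 2 ≤ (k + 1) * Y := by nlinarith
    have h8 : Y ≤ (k + 1) * Y := Nat.le_mul_of_pos_left _ (by omega)
    have h9 : 20 * l * (k + 1) ^ 2 * Y = 20 * (l * (k + 1) ^ 2 * Y) := by ring
    rw [h9]
    omega
  have hN : x.left.toList.length + 1 ≤ Y := by
    have := x.left.length_toList_lt_size
    have := x.size_left_le
    omega
  have hle : ∀ a : ℕ, a ≤ Y ^ a := fun a =>
    (Nat.lt_two_pow_self).le.trans (Nat.pow_le_pow_left hY2 a)
  -- Here `2 * (b + 1) ≤ 2 * b + 3 ≤ l` enters.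
  have hbk : (b + 1) ^ k * 2 ^ k ≤ l ^ k := by
    rw [← mul_pow]
    exact Nat.pow_le_pow_left (by omega) _
  have hW : 1 ≤ (x.left.toList.length + 1) ^ l * (l * (b + 1) ^ k) :=
    Nat.mul_pos (Nat.pow_pos (by omega)) (Nat.mul_pos hl1 (Nat.pow_pos (by omega)))
  calc (inputTree x k).size + (inputTree x k).size + 1 + T + 1
      ≤ (x.left.toList.length + 1) ^ l * (l * ((b + 1) ^ k * h M)) + (2 * M + 2) := by omega
    _ ≤ (x.left.toList.length + 1) ^ l * (l * ((b + 1) ^ k * h M)) +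
        (x.left.toList.length + 1) ^ l * (l * (b + 1) ^ k) * (2 * M + 2) :=
      Nat.add_le_add_left (Nat.le_mul_of_pos_left _ hW) _
    _ = (x.left.toList.length + 1) ^ l * l * (b + 1) ^ k * (h M + (2 * M + 2)) := by ring
    _ ≤ Y ^ l * l * (b + 1) ^ k * (20 * l * (k + 1) ^ 2 * Y) ^ c := by
      gcongr
      exact (hc M).trans (Nat.pow_le_pow_left hM1 _)
    _ = Y ^ l * l * ((b + 1) ^ k * (k + 1) ^ (2 * c)) * 20 ^ c * l ^ c * Y ^ c := by
      rw [pow_mul]; simp only [mul_pow]; ring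
    _ ≤ Y ^ l * Y ^ l * ((b + 1) ^ k * (K * 2 ^ k)) * (2 ^ 5) ^ c * (Y ^ l) ^ c * Y ^ c := by
      gcongr
      · exact hle l
      · exact hK k
      · norm_num
      · exact hle l
    _ = Y ^ l * Y ^ l * (K * ((b + 1) ^ k * 2 ^ k)) * 2 ^ (5 * c) * (Y ^ l) ^ c * Y ^ c := by
      rw [← pow_mul 2]; ring
    _ ≤ Y ^ l * Y ^ l * ((Y ^ l) ^ K * l ^ k) * (Y ^ l) ^ (5 * c) * (Y ^ l) ^ c * (Y ^ l) ^ c := by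
      have hYl : Y ≤ Y ^ l := Nat.le_self_pow (by omega) _
      gcongr
      · exact (hle K).trans (Nat.pow_le_pow_left hYl _)
      · omega
    _ = l ^ k * Y ^ ((2 + 7 * c + K) * l) := by ring

theorem Computable.const_natPow (a : ℕ) : Computable fun k : ℕ => a ^ k := by
  refine (Computable.nat_rec (f := fun k : ℕ => k) (g := fun _ => 1)
    (h := fun _ p => p.2 * a) .id (.const 1) ?_).of_eq fun k => ?_
  · exact (Primrec.nat_mul.comp (Primrec.snd.comp Primrec.snd) (.const a)).to_comp.to₂
  · induction k with
    | zero => rfl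
    | succ k ih => rw [pow_succ, ← ih]

theorem isFPT_vertexRemoval {φ : GraphSentence} (hφ : FOFormula.IsSigma 3 0 φ) :
    IsFPT (vertexRemoval φ) := by
  obtain ⟨C, hC⟩ := exists_decider
  obtain ⟨p, hp⟩ := hC φ hφ
  -- The power of `2` comes from `x.size + 1 ≤ 2 * x.size`.
  refine ⟨p, fun k => φ.length ^ k * 2 ^ (C * φ.length), C * φ.length,
    Primrec.nat_mul.to_comp.comp (Computable.const_natPow _) (.const _), fun x k => ?_⟩
  obtain ⟨y, T, h1, h2, h3⟩ := hp x k
  refine ⟨y, T, h1, h2.trans ?_, h3.trans (mem_vertexRemoval_iff φ x k).symm⟩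
  rw [mul_assoc, ← mul_pow]
  have := x.size_pos
  gcongr
  omega

-- Standard codes of graphs.

theorem left_graphCode {n : ℕ} (G : SimpleGraph (Fin n)) :
    (graphCode G).left = BinTree.ofList ((List.finRange n).map fun i => BinTree.ofNat i.1) := by
  simp only [graphCode, BinTree.left, List.pure_def, List.bind_eq_flatMap, ← List.map_eq_flatMap,
    List.map_map, Function.comp_def]

/-- There are at most `n ^ 2` pairs of unary numbers of linear size; the exponent `5` in place of
`3` absorbs the constants. -/
theorem size_graphCode_le {n : ℕ} (G : SimpleGraph (Fin n)) :
    (graphCode G).size + 1 ≤ (n + 2) ^ 5 := by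
  classical
  have h1 : (graphCode G).left.size ≤ n * (2 * n + 1 + 1) + 1 := by
    rw [left_graphCode]
    refine (BinTree.size_ofList_le (M := 2 * n + 1) _ ?_).trans ?_
    · simp only [List.mem_map]
      rintro _ ⟨i, -, rfl⟩
      have := i.2
      simp
    · simp
  have h2 : (graphCode G).right.size ≤ n * n * (4 * n + 3 + 1) + 1 := by
    refine (BinTree.size_ofList_le (M := 4 * n + 3) _ ?_).trans ?_
    · simp only [List.mem_map]
      rintro _ ⟨⟨i, j⟩, -, rfl⟩
      have := i.2
      have := j.2
      simp
      omega
    · gcongr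
      rw [List.length_map]
      refine (List.length_filter_le _ _).trans ?_
      rw [List.length_product, List.length_finRange]
  have h3 : (graphCode G).size = (graphCode G).left.size + (graphCode G).right.size + 1 := rfl
  have h4 : n * (2 * n + 1 + 1) + 1 + (n * n * (4 * n + 3 + 1) + 1) + 2 ≤ (n + 2) ^ 5 := by
    ring_nf
    nlinarith [Nat.zero_le (n ^ 5), Nat.zero_le (n ^ 4), Nat.zero_le (n ^ 3), Nat.zero_le (n ^ 2)]
  omega

theorem vertexRemovable_iff_graphCode (φ : GraphSentence) {n : ℕ} (G : SimpleGraph (Fin n))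
    (k : ℕ) : VertexRemovable φ G k ↔ RemovableFrom (graphCode G) [] φ Fin.elim0 k := by
  refine vertexRemovable_iff G φ k (f := fun i => BinTree.ofNat i)
    (fun i j h => Fin.ext (BinTree.ofNat_injective h)) (fun t => ?_) fun u w => ?_
  · simp [left_graphCode]
  · have key : ∀ i j : Fin n, BinTree.node (BinTree.ofNat i) (BinTree.ofNat j) ∈
        (graphCode G).right.toList ↔ G.Adj i j := by
      intro i j
      simp only [graphCode, BinTree.right, BinTree.toList_ofList, List.mem_map, List.mem_filter,
        BinTree.node.injEq, decide_eq_true_eq, Prod.exists]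
      constructor
      · rintro ⟨i', j', ⟨-, h⟩, hi, hj⟩
        rwa [← Fin.ext (BinTree.ofNat_injective hi), ← Fin.ext (BinTree.ofNat_injective hj)]
      · exact fun h => ⟨i, j, ⟨List.mem_product.2 ⟨List.mem_finRange _, List.mem_finRange _⟩, h⟩,
          rfl, rfl⟩
    rw [key, key, G.adj_comm w u, or_self]
    exact ⟨fun h => ⟨fun he => h.ne (Fin.ext (BinTree.ofNat_injective he)), h⟩, fun h => h.2⟩

theorem exists_decider_graphCode : ∃ C : ℕ, ∀ φ : GraphSentence, FOFormula.IsSigma 3 0 φ →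
    ∃ p : Prog, ∀ (n : ℕ) (G : SimpleGraph (Fin n)) (k : ℕ),
      DecidesWithin p (graphCode G) k (VertexRemovable φ G k)
        (φ.length ^ k * (n + 2) ^ (C * φ.length)) := by
  obtain ⟨C, hC⟩ := exists_decider
  refine ⟨5 * C, fun φ hφ => ?_⟩
  obtain ⟨p, hp⟩ := hC φ hφ
  refine ⟨p, fun n G k => ?_⟩
  obtain ⟨y, T, h1, h2, h3⟩ := hp (graphCode G) k
  refine ⟨y, T, h1, h2.trans ?_, h3.trans (vertexRemovable_iff_graphCode φ G k).symm⟩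
  rw [mul_assoc 5, pow_mul _ 5]
  gcongr
  exact size_graphCode_le G

theorem theorem1 :
    (∀ φ : GraphSentence, FOFormula.IsSigma 3 0 φ → IsFPT (vertexRemoval φ)) ∧
    (∃ C : ℕ, ∀ φ : GraphSentence, FOFormula.IsSigma 3 0 φ →
      ∃ p : Prog, ∀ (n : ℕ) (G : SimpleGraph (Fin n)) (k : ℕ),
        DecidesWithin p (graphCode G) k (VertexRemovable φ G k)
          (φ.length ^ k * (n + 2) ^ (C * φ.length))) ∧
    (∃ φ : GraphSentence, FOFormula.IsPi 3 0 φ ∧ WHard 2 (vertexRemoval φ)) :=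
  ⟨fun _ => isFPT_vertexRemoval, exists_decider_graphCode, triangleSentence,
    triangleSentence_isPi, wHard_vertexRemoval_triangleSentence⟩
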